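/- **Setting.** Let $V$ be a unitary vertex operator algebra of CFT type (that is, $V(0)=\mathbb C\Omega$ and $V(n)=0$ for $n<0$) which is $C_2$-cofinite. A $V$-module $W=\bigoplus_{s\in\mathbb R}W(s)$ has finite-dimensional weight spaces, which vanish for $s$ sufficiently small; it is unitary if it carries an inner product $\langle\cdot|\cdot\rangle$ (antilinear in the second variable) with $Y(v,x)^\dagger=Y(e^{xL_1}(-x^{-2})^{L_0}\theta v,x^{-1})$ for all $v\in V$, where $\theta$ is the PCT operator of $V$. Let $W_i,W_j,W_k$ be unitary $V$-modules with Hilbert space completions $\mathcal H_i,\mathcal H_j,\mathcal H_k$. For $p\in\mathbb R$ let $\mathcal H_j^p$ be the domain of $(1+\overline{L_0})^p$, put $\|\xi\|_p=\|(1+\overline{L_0})^p\xi\|$ for $\xi\in\mathcal H_j^p$, and let $\mathcal H_j^\infty=\bigcap_{p\ge0}\mathcal H_j^p$; similarly for $k$. Let $\mathcal Y_\alpha$ be an intertwining operator of type $\binom{k}{i\;j}$, $\mathcal Y_\alpha(w,x)=\sum_{s\in\mathbb R}\mathcal Y_\alpha(w,s)x^{-s-1}$. For $w\in W_i$ write $\overline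 w=\langle\,\cdot\,|w\rangle$, an element of the contragredient space $W_{\overline i}=\bigoplus_sW_i(s)^*$. The adjoint intertwining operator $\mathcal Y_{\alpha^*}$, of type $\binom{j}{\overline i\;k}$, is given by $\mathcal Y_{\alpha^*}(\overline w,x)=\mathcal Y_\alpha(e^{xL_1}(e^{-i\pi}x^{-2})^{L_0}w,x^{-1})^\dagger$; in modes, for $w$ homogeneous of weight $\Delta$, $$\mathcal Y_{\alpha^*}(\overline w,s)=\sum_{m\ge0}\frac{e^{i\pi\Delta}}{m!}\,\mathcal Y_\alpha(L_1^mw,-s-m-2+2\Delta)^\dagger .$$ For $f\in C_c^\infty(S^1\setminus\{-1\})$ and $s,q\in\mathbb R$ put $$\widehat f(s)=\int_{-\pi}^{\pi}f(e^{i\theta})e^{-is\theta}\frac{d\theta}{2\pi},\qquad |f|_{V,q}=\sum_{s\in\mathbb Z_V}(1+|s|)^q|\widehat f(s)|,$$ where $\mathbb Z_V=\mathbb Z+\{\Delta_a+\Delta_b-\Delta_c\}$ and $\Delta_a,\Delta_b,\Delta_c$ run over the conformal weights (lowest $L_0$-eigenvalues) of irreducible $V$-modules. Put $e_\rho(e^{i\theta})=e^{i\rho\theta}$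 for $-\pi<\theta<\pi$ and $\rho\in\mathbb R$. Let $A(x)=\sum_{s\in\mathbb R}A(s)x^{-s-1}$ be one of the series $\mathcal Y_\alpha(w,x)$ or $\mathcal Y_{\alpha^*}(\overline w,x)$, with coefficients mapping $W_a$ to $W_b$. Then $A(f)$ denotes the operator from $\mathcal H_a$ to $\mathcal H_b$ with $$\langle A(f)x|y\rangle=\int_{-\pi}^{\pi}\langle A(e^{i\theta})x|y\rangle f(e^{i\theta})\,\frac{e^{i\theta}d\theta}{2\pi}\qquad(x\in W_a,\ y\in W_b),$$ where $\arg e^{i\theta}=\theta$ and the domain consists of those $x\in W_a$ for which such a vector $A(f)x\in\mathcal H_b$ exists. When it is preclosed with $\mathcal H_a^\infty$ in the domain of its closure, $A(f)$ also denotes the restriction of the closure to $\mathcal H_a^\infty$. The formal adjoint $A(f)^\dagger$ is the restriction of the Hilbert space adjoint of $A(f)$ to $\mathcal H_b^\infty$. **Statement.** Let $w\in W_i$ be homogeneous of weight $\Delta$, and suppose that for some $M,r,t\ge0$ $$\|\mathcal Y_\alpha(w,s)w^{(j)}\|\le M(1+|s|)^t\|w^{(j)}\|_r\qquad\text{for all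 }s\in\mathbb R,\ w^{(j)}\in W_j .$$ Then $|f|_{V,q}<\infty$ for all $q\in\mathbb R$ and all $f\in C_c^\infty(S^1\setminus\{-1\})$, the operator $\mathcal Y_\alpha(w,f)$ is defined on all of $W_j$ and preclosed, $\mathcal H_j^\infty$ lies in the domain of its closure, and: (a) $\mathcal Y_\alpha(w,f)\mathcal H_j^\infty\subset\mathcal H_k^\infty$. Moreover, for every $p\in\mathbb R$ there is $M_p\ge0$, independent of $f$, such that for all $f\in C_c^\infty(S^1\setminus\{-1\})$ and $\xi\in\mathcal H_j^\infty$ $$\|\mathcal Y_\alpha(w,f)\xi\|_p\le M_p\,|f|_{V,|p|+t}\,\|\xi\|_{p+r}.$$ (b) The formal adjoint $\mathcal Y_\alpha(w,f)^\dagger$ is defined on all of $\mathcal H_k^\infty$ and maps it into $\mathcal H_j^\infty$; all the operators $\mathcal Y_{\alpha^*}(\overline{L_1^mw},\overline{e_{m+2-2\Delta}f})$, $m\ge0$, are defined on $\mathcal H_k^\infty$, and on $\mathcal H_k^\infty$ $$\mathcal Y_\alpha(w,f)^\dagger=\sum_{m\ge0}\frac{e^{-i\pi\Delta}}{m!}\,\mathcal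 Y_{\alpha^*}\big(\overline{L_1^mw},\overline{e_{m+2-2\Delta}f}\big).$$ In particular, if $w$ is quasi-primary ($L_1w=0$), then $$\mathcal Y_\alpha(w,f)^\dagger=e^{-i\pi\Delta}\,\mathcal Y_{\alpha^*}\big(\overline w,\overline{e_{2-2\Delta}f}\big).$$ -/

import Mathlib

open scoped ContDiff ComplexConjugate

universe u v

noncomputable section

/-! ## Vertex operator algebras and their modules -/

/-- A vertex operator algebra structure on the complex vector space `V`.
`Y v n` is the mode `Y(v,n)`, the coefficient of `x^(-n-1)` in `Y(v,x)`.
Sums over `l : ℕ` are finite by the truncation axiom. -/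
structure VOA (V : Type u) [AddCommGroup V] [Module ℂ V] where
  grading : ℤ → Submodule ℂ V
  internal : DirectSum.IsInternal grading
  finiteDim : ∀ n, FiniteDimensional ℂ (grading n)
  lowerBounded : ∃ N : ℤ, ∀ n < N, grading n = ⊥
  Y : V →ₗ[ℂ] (ℤ → V →ₗ[ℂ] V)
  truncation : ∀ u v : V, ∃ N : ℤ, ∀ n ≥ N, Y u n v = 0
  jacobi : ∀ (u v x : V) (m n h : ℤ),
    ∑ᶠ l : ℕ, ((Ring.choose m l : ℤ) : ℂ) • Y (Y u (n + l) v) (m + h - l) x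
      = ∑ᶠ l : ℕ, ((-1 : ℂ) ^ l * ((Ring.choose n l : ℤ) : ℂ)) •
            Y u (m + n - l) (Y v (h + l) x)
        - ∑ᶠ l : ℕ, ((-1 : ℂ) ^ ((l : ℤ) + n) * ((Ring.choose n l : ℤ) : ℂ)) •
            Y v (n + h - l) (Y u (m + l) x)
  /-- the vacuum vector -/
  Ω : V
  vacuum_mem : Ω ∈ grading 0
  vacuum_mode : ∀ (n : ℤ) (x : V), Y Ω n x = if n = -1 then x else 0
  creation_zero : ∀ (v : V) (n : ℤ), 0 ≤ n → Y v n Ω = 0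
  creation : ∀ v : V, Y v (-1) Ω = v
  /-- the conformal vector -/
  ν : V
  conformal_mem : ν ∈ grading 2
  centralCharge : ℂ
  virasoro : ∀ (m n : ℤ) (x : V),
    Y ν (m + 1) (Y ν (n + 1) x) - Y ν (n + 1) (Y ν (m + 1) x)
      = ((m : ℂ) - n) • Y ν (m + n + 1) x
        + (if m = -n then (((m : ℂ) ^ 3 - m) / 12 * centralCharge) else 0) • x
  energy : ∀ (n : ℤ), ∀ v ∈ grading n, Y ν 1 v = (n : ℂ) • v
  translation : ∀ (v : V) (n : ℤ) (x : V), Y (Y ν 0 v) n x = (-(n : ℂ)) • Y v (n - 1) x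

namespace VOA

variable {V : Type u} [AddCommGroup V] [Module ℂ V]

/-- The Virasoro operator `L_n = Y(ν, n+1)` on `V`. -/
def L (𝓥 : VOA V) (n : ℤ) : V →ₗ[ℂ] V := 𝓥.Y 𝓥.ν (n + 1)

/-- CFT type: `V(0) = ℂ Ω` and `V(n) = 0` for `n < 0`. -/
def IsCFTType (𝓥 : VOA V) : Prop :=
  𝓥.grading 0 = Submodule.span ℂ {𝓥.Ω} ∧ ∀ n < 0, 𝓥.grading n = ⊥

/-- `C_2(V)`, the span of all `Y(u,-2)v`. -/
def C2 (𝓥 : VOA V) : Submodule ℂ V :=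
  Submodule.span ℂ {x | ∃ u v : V, x = 𝓥.Y u (-2) v}

/-- `C_2`-cofiniteness: `V / C_2(V)` is finite dimensional. -/
def IsC2Cofinite (𝓥 : VOA V) : Prop := FiniteDimensional ℂ (V ⧸ 𝓥.C2)

end VOA

/-- A unitary vertex operator algebra. In `inner ℂ y x` the first slot is the antilinear one, so
`inner ℂ y x` is `⟨x|y⟩` in the convention where `⟨·|·⟩` is antilinear in the second variable.
The field `unitary` is the identity `Y(v,x)† = Y(e^{xL_1}(-x^{-2})^{L_0} θ v, x^{-1})`, written mode
by mode for `v ∈ V(Δ)` (homogeneous vectors span `V`; `θ` preserves weights). -/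
structure UnitaryVOA (V : Type u) [NormedAddCommGroup V] [InnerProductSpace ℂ V]
    extends VOA V where
  /-- the PCT operator -/
  θ : V ≃ₛₗ[starRingEnd ℂ] V
  θ_vacuum : θ Ω = Ω
  θ_conformal : θ ν = ν
  θ_mode : ∀ (v : V) (n : ℤ) (x : V), θ (Y v n x) = Y (θ v) n (θ x)
  vacuum_norm : inner ℂ Ω Ω = (1 : ℂ)
  unitary : ∀ (Δ : ℤ), ∀ v ∈ grading Δ, ∀ (n : ℤ) (a b : V),
    inner ℂ b (Y v n a)
      = inner ℂ (∑ᶠ m : ℕ, ((-1 : ℂ) ^ Δ / (m.factorial : ℂ)) •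
          Y (((Y ν 2) ^ m : V →ₗ[ℂ] V) (θ v)) (2 * Δ - m - n - 2) b) a

/-- A `V`-module (representation of `V`) on the complex vector space `W`, graded by `ℝ`. -/
structure VOAModule {V : Type u} [AddCommGroup V] [Module ℂ V] (𝓥 : VOA V)
    (W : Type v) [AddCommGroup W] [Module ℂ W] where
  grading : ℝ → Submodule ℂ W
  internal : DirectSum.IsInternal grading
  finiteDim : ∀ s, FiniteDimensional ℂ (grading s)
  lowerBounded : ∃ N : ℝ, ∀ s < N, grading s = ⊥
  Y : V →ₗ[ℂ] (ℤ → W →ₗ[ℂ] W)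
  truncation : ∀ (u : V) (w : W), ∃ N : ℤ, ∀ n ≥ N, Y u n w = 0
  jacobi : ∀ (u v : V) (x : W) (m n h : ℤ),
    ∑ᶠ l : ℕ, ((Ring.choose m l : ℤ) : ℂ) • Y (𝓥.Y u (n + l) v) (m + h - l) x
      = ∑ᶠ l : ℕ, ((-1 : ℂ) ^ l * ((Ring.choose n l : ℤ) : ℂ)) •
            Y u (m + n - l) (Y v (h + l) x)
        - ∑ᶠ l : ℕ, ((-1 : ℂ) ^ ((l : ℤ) + n) * ((Ring.choose n l : ℤ) : ℂ)) •
            Y v (n + h - l) (Y u (m + l) x)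
  vacuum_mode : ∀ (n : ℤ) (x : W), Y 𝓥.Ω n x = if n = -1 then x else 0
  virasoro : ∀ (m n : ℤ) (x : W),
    Y 𝓥.ν (m + 1) (Y 𝓥.ν (n + 1) x) - Y 𝓥.ν (n + 1) (Y 𝓥.ν (m + 1) x)
      = ((m : ℂ) - n) • Y 𝓥.ν (m + n + 1) x
        + (if m = -n then (((m : ℂ) ^ 3 - m) / 12 * 𝓥.centralCharge) else 0) • x
  energy : ∀ (s : ℝ), ∀ w ∈ grading s, Y 𝓥.ν 1 w = (s : ℂ) • w
  translation : ∀ (v : V) (n : ℤ) (x : W), Y (𝓥.L (-1) v) n x = (-(n : ℂ)) • Y v (n - 1) x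

namespace VOAModule

variable {V : Type u} [AddCommGroup V] [Module ℂ V] {𝓥 : VOA V}
  {W : Type v} [AddCommGroup W] [Module ℂ W]

/-- The Virasoro operator `L_n = Y(ν, n+1)` on `W`. -/
def L (M : VOAModule 𝓥 W) (n : ℤ) : W →ₗ[ℂ] W := M.Y 𝓥.ν (n + 1)

/-- The identification of `W` with the direct sum of its weight spaces. -/
def decomp (M : VOAModule 𝓥 W) : DirectSum ℝ (fun q => M.grading q) ≃ₗ[ℂ] W :=
  LinearEquiv.ofBijective (DirectSum.coeLinearMap M.grading)
    (show Function.Bijective _ from M.internal)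

/-- The projection `P_s` of `W` onto `W(s)` along the other weight spaces. -/
def P (M : VOAModule 𝓥 W) (s : ℝ) : W →ₗ[ℂ] W :=
  (M.grading s).subtype ∘ₗ DirectSum.component ℂ ℝ (fun q => M.grading q) s ∘ₗ
    (M.decomp.symm : W →ₗ[ℂ] _)

/-- `W` is irreducible: nonzero, without proper nonzero `V`-invariant subspaces. -/
def IsIrreducible (M : VOAModule 𝓥 W) : Prop :=
  Nontrivial W ∧ ∀ S : Submodule ℂ W,
    (∀ (v : V) (n : ℤ), ∀ x ∈ S, M.Y v n x ∈ S) → S = ⊥ ∨ S = ⊤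

/-- The lowest weight `inf {s | dim W(s) > 0}`. -/
def conformalWeight (M : VOAModule 𝓥 W) : ℝ := sInf {s | M.grading s ≠ ⊥}

/-- The graded dual `⨁_s W(s)^*`, the vector space underlying the contragredient module: the
functionals that vanish on all but finitely many of the weight spaces. -/
def gradedDual (M : VOAModule 𝓥 W) : Submodule ℂ (Module.Dual ℂ W) where
  carrier := {φ | {s | ∃ x ∈ M.grading s, φ x ≠ 0}.Finite}
  zero_mem' := by simp
  add_mem' := by
    intro φ ψ hφ hψ
    refine (Set.Finite.union hφ hψ).subset ?_
    rintro s ⟨x, hx, h⟩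
    by_cases h1 : φ x = 0
    · exact Or.inr ⟨x, hx, fun h2 => h (by simp [h1, h2])⟩
    · exact Or.inl ⟨x, hx, h1⟩
  smul_mem' := by
    intro c φ hφ
    refine Set.Finite.subset hφ ?_
    rintro s ⟨x, hx, h⟩
    exact ⟨x, hx, fun h2 => h (by simp [h2])⟩

theorem induction_grading (M : VOAModule 𝓥 W) {p : W → Prop} (x : W)
    (h0 : p 0) (hmem : ∀ s, ∀ y ∈ M.grading s, p y)
    (hadd : ∀ y z, p y → p z → p (y + z)) : p x := by
  have hx : x ∈ ⨆ s, M.grading s := by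
    rw [M.internal.submodule_iSup_eq_top]; trivial
  exact Submodule.iSup_induction M.grading (motive := p) hx hmem h0 hadd

theorem P_of_mem (M : VOAModule 𝓥 W) {s : ℝ} {x : W} (hx : x ∈ M.grading s) : M.P s x = x := by
  have h : M.decomp.symm x = DirectSum.lof ℂ ℝ (fun q => M.grading q) s ⟨x, hx⟩ := by
    rw [LinearEquiv.symm_apply_eq]
    exact (DirectSum.coeLinearMap_lof M.grading s ⟨x, hx⟩).symm
  simp [P, h]

theorem P_of_ne (M : VOAModule 𝓥 W) {s q : ℝ} {x : W} (hx : x ∈ M.grading s) (hq : q ≠ s) :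
    M.P q x = 0 := by
  have h : M.decomp.symm x = DirectSum.lof ℂ ℝ (fun q => M.grading q) s ⟨x, hx⟩ := by
    rw [LinearEquiv.symm_apply_eq]
    exact (DirectSum.coeLinearMap_lof M.grading s ⟨x, hx⟩).symm
  simp [P, h, DirectSum.component.of, Ne.symm hq]

theorem P_mem (M : VOAModule 𝓥 W) (s : ℝ) (x : W) : M.P s x ∈ M.grading s := by
  simp [P]

theorem finite_support_P (M : VOAModule 𝓥 W) (x : W) : {s | M.P s x ≠ 0}.Finite := by
  induction x using M.induction_grading with
  | h0 => simp
  | hmem s y hy =>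
    refine (Set.finite_singleton s).subset ?_
    intro q hq
    by_contra h
    exact hq (M.P_of_ne hy h)
  | hadd y z hy hz =>
    refine (hy.union hz).subset ?_
    intro s hs
    by_cases h : M.P s y = 0
    · exact Or.inr fun h2 => hs (by simp [h, h2])
    · exact Or.inl h

theorem eq_of_P (M : VOAModule 𝓥 W) {x y : W} (h : ∀ s, M.P s x = M.P s y) : x = y := by
  apply M.decomp.symm.injective
  exact DFinsupp.ext fun s => Subtype.ext (h s)

theorem P_L0 (M : VOAModule 𝓥 W) (s : ℝ) (x : W) : M.P s (M.Y 𝓥.ν 1 x) = (s : ℂ) • M.P s x := by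
  induction x using M.induction_grading with
  | h0 => simp
  | hmem q y hy =>
    rw [M.energy q y hy, map_smul]
    by_cases h : s = q
    · rw [h]
    · rw [M.P_of_ne hy h, smul_zero, smul_zero]
  | hadd y z hy hz => simp [hy, hz]

/-- An eigenvector of `L_0` is homogeneous. -/
theorem mem_grading_of_L0 (M : VOAModule 𝓥 W) {s : ℝ} {x : W}
    (h : M.Y 𝓥.ν 1 x = (s : ℂ) • x) : x ∈ M.grading s := by
  have hx : x = M.P s x := by
    apply M.eq_of_P
    intro q
    by_cases hq : q = s
    · subst hq
      rw [M.P_of_mem (M.P_mem q x)]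
    · rw [M.P_of_ne (M.P_mem s x) hq]
      have h1 := M.P_L0 q x
      rw [h, map_smul] at h1
      have h2 : ((s : ℂ) - q) • M.P q x = 0 := by rw [sub_smul, h1, sub_self]
      rcases smul_eq_zero.1 h2 with h3 | h3
      · exact absurd (by exact_mod_cast (sub_eq_zero.1 h3).symm) hq
      · exact h3
  rw [hx]
  exact M.P_mem s x

/-- `L_1` lowers the weight by one. -/
theorem L1_mem (M : VOAModule 𝓥 W) {s : ℝ} {x : W} (hx : x ∈ M.grading s) :
    M.L 1 x ∈ M.grading (s - 1) := by
  apply M.mem_grading_of_L0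
  have h := M.virasoro 0 1 x
  have e := M.energy s x hx
  simp only [zero_add, Int.reduceAdd] at h
  rw [e, map_smul] at h
  simp only [L, Int.reduceAdd]
  rw [sub_eq_iff_eq_add] at h
  rw [h]
  push_cast
  norm_num
  module

theorem L1_pow_mem (M : VOAModule 𝓥 W) {s : ℝ} {x : W} (hx : x ∈ M.grading s) (m : ℕ) :
    ((M.L 1) ^ m : W →ₗ[ℂ] W) x ∈ M.grading (s - m) := by
  induction m with
  | zero => simpa using hx
  | succ k ih =>
    rw [pow_succ']
    have := M.L1_mem ih
    rw [show s - ((k + 1 : ℕ) : ℝ) = s - k - 1 by push_cast; ring]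
    exact this

end VOAModule

/-- The finite set (up to integers) governing the powers of `x` in intertwining operators:
`ℤ_V = ℤ + {Δ_i + Δ_j - Δ_k}`, where `Δ_i, Δ_j, Δ_k` run over the conformal weights of irreducible
`V`-modules. -/
def VOA.exponents {V : Type u} [AddCommGroup V] [Module ℂ V] (𝓥 : VOA V) : Set ℝ :=
  let weights : Set ℝ := {h | ∃ (W : Type v) (_ : AddCommGroup W) (_ : Module ℂ W)
    (M : VOAModule 𝓥 W), M.IsIrreducible ∧ M.conformalWeight = h}
  {s | ∃ a ∈ weights, ∃ b ∈ weights, ∃ c ∈ weights, ∃ n : ℤ, s = n + (a + b - c)}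

/-- A unitary `V`-module: `Y(v,x)† = Y(e^{xL_1}(-x^{-2})^{L_0} θ v, x^{-1})`, mode by mode. -/
structure UnitaryModule {V : Type u} [NormedAddCommGroup V] [InnerProductSpace ℂ V]
    (𝓥 : UnitaryVOA V) (W : Type v) [NormedAddCommGroup W] [InnerProductSpace ℂ W]
    extends VOAModule 𝓥.toVOA W where
  unitary : ∀ (Δ : ℤ), ∀ v ∈ 𝓥.grading Δ, ∀ (n : ℤ) (a b : W),
    inner ℂ b (Y v n a)
      = inner ℂ (∑ᶠ m : ℕ, ((-1 : ℂ) ^ Δ / (m.factorial : ℂ)) •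
          Y (((𝓥.L 1) ^ m : V →ₗ[ℂ] V) (𝓥.θ v)) (2 * Δ - m - n - 2) b) a

/-- An intertwining operator of type `W_k` over `W_i`, `W_j`; `Y w s` is the coefficient of
`x^(-s-1)` in `𝒴(w,x)`. -/
structure IntertwiningOperator {V : Type u} [AddCommGroup V] [Module ℂ V] {𝓥 : VOA V}
    {Wi Wj Wk : Type v} [AddCommGroup Wi] [Module ℂ Wi] [AddCommGroup Wj] [Module ℂ Wj]
    [AddCommGroup Wk] [Module ℂ Wk]
    (Mi : VOAModule 𝓥 Wi) (Mj : VOAModule 𝓥 Wj) (Mk : VOAModule 𝓥 Wk) where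
  Y : Wi →ₗ[ℂ] (ℝ → Wj →ₗ[ℂ] Wk)
  truncation : ∀ (w : Wi) (x : Wj), ∃ N : ℝ, ∀ s ≥ N, Y w s x = 0
  jacobi : ∀ (u : V) (w : Wi) (x : Wj) (m n : ℤ) (s : ℝ),
    ∑ᶠ l : ℕ, ((Ring.choose m l : ℤ) : ℂ) • Y (Mi.Y u (n + l) w) (m + s - l) x
      = ∑ᶠ l : ℕ, ((-1 : ℂ) ^ l * ((Ring.choose n l : ℤ) : ℂ)) •
            Mk.Y u (m + n - l) (Y w (s + l) x)
        - ∑ᶠ l : ℕ, ((-1 : ℂ) ^ ((l : ℤ) + n) * ((Ring.choose n l : ℤ) : ℂ)) •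
            Y w (n + s - l) (Mj.Y u (m + l) x)
  translation : ∀ (w : Wi) (s : ℝ) (x : Wj), Y (Mi.L (-1) w) s x = (-(s : ℂ)) • Y w (s - 1) x

namespace IntertwiningOperator

variable {V : Type u} [AddCommGroup V] [Module ℂ V] {𝓥 : VOA V}
  {Wi Wj Wk : Type v} [AddCommGroup Wi] [Module ℂ Wi] [AddCommGroup Wj] [Module ℂ Wj]
  [AddCommGroup Wk] [Module ℂ Wk]
  {Mi : VOAModule 𝓥 Wi} {Mj : VOAModule 𝓥 Wj} {Mk : VOAModule 𝓥 Wk}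

/-- `𝒴(w,s)` raises the weight by `Δ_w - s - 1`. -/
theorem mode_mem (α : IntertwiningOperator Mi Mj Mk) {Δ : ℝ} {w : Wi} (hw : w ∈ Mi.grading Δ)
    (s : ℝ) {q : ℝ} {x : Wj} (hx : x ∈ Mj.grading q) :
    α.Y w s x ∈ Mk.grading (q + (Δ - s - 1)) := by
  apply Mk.mem_grading_of_L0
  have h := α.jacobi 𝓥.ν w x 1 0 s
  have e1 := finsum_eq_finsetSum_of_support_subset (s := Finset.range 2)
    (fun l : ℕ => ((Ring.choose (1 : ℤ) l : ℤ) : ℂ) •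
      α.Y (Mi.Y 𝓥.ν (0 + l) w) ((1 : ℤ) + s - l) x) (by
      intro l hl
      by_contra hc
      apply hl
      have hl2 : 1 < l := by simp at hc; omega
      have : Ring.choose (1 : ℤ) l = 0 := by
        have := Ring.choose_natCast (R := ℤ) 1 l
        simp only [Nat.cast_one] at this
        rw [this, Nat.choose_eq_zero_of_lt hl2]; rfl
      simp [this])
  have z : ∀ l : ℕ, l ≠ 0 → Ring.choose (0 : ℤ) l = 0 := by
    intro l hl
    have := Ring.choose_natCast (R := ℤ) 0 l
    simp only [Nat.cast_zero] at this
    rw [this, Nat.choose_eq_zero_of_lt (Nat.pos_of_ne_zero hl)]; rfl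
  have e2 := finsum_eq_single (fun l : ℕ => ((-1 : ℂ) ^ l * ((Ring.choose (0 : ℤ) l : ℤ) : ℂ)) •
            Mk.Y 𝓥.ν (1 + 0 - l) (α.Y w (s + l) x)) 0 (by intro l hl; simp [z l hl])
  have e3 := finsum_eq_single
    (fun l : ℕ => ((-1 : ℂ) ^ ((l : ℤ) + 0) * ((Ring.choose (0 : ℤ) l : ℤ) : ℂ)) •
            α.Y w ((0 : ℤ) + s - l) (Mj.Y 𝓥.ν (1 + l) x)) 0 (by intro l hl; simp [z l hl])
  rw [e1, e2, e3] at h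
  have t := α.translation w (1 + s) x
  simp only [VOAModule.L] at t
  norm_num [Finset.sum_range_succ, Mi.energy Δ w hw, Mj.energy q x hx] at h t
  rw [t] at h
  rw [sub_eq_iff_eq_add.1 h.symm]
  simp only [← Complex.coe_smul]
  push_cast
  module

/-- `e^{xL_1}(e^{-iπ}x^{-2})^{L_0}` inside an intertwining operator: the coefficient of
`x^(-s-1)` in `𝒴(e^{xL_1}(e^{-iπ}x^{-2})^{L_0} w, x^{-1})`. For homogeneous `w` of weight `Δ` it is
`∑_m e^{-iπΔ} / m! • 𝒴(L_1^m w, 2Δ-s-m-2)`; in general `w = ∑_Δ P_Δ w`. All sums are finite. -/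
def reflectedMode (α : IntertwiningOperator Mi Mj Mk) (w : Wi) (s : ℝ) : Wj →ₗ[ℂ] Wk :=
  ∑ᶠ (Δ : ℝ), ∑ᶠ (m : ℕ), (Complex.exp (-(Complex.I * Real.pi * Δ)) / (m.factorial : ℂ)) •
    α.Y (((Mi.L 1) ^ m : Wi →ₗ[ℂ] Wi) (Mi.P Δ w)) (2 * Δ - s - m - 2)

theorem reflectedMode_shift (α : IntertwiningOperator Mi Mj Mk) (w : Wi) (s : ℝ) :
    ∃ T : Set ℝ, T.Finite ∧ ∀ (q : ℝ), ∀ x ∈ Mj.grading q,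
      α.reflectedMode w s x ∈ ⨆ d ∈ T, Mk.grading (q + d) := by
  refine ⟨(fun Δ : ℝ => -Δ + s + 1) '' {Δ | Mi.P Δ w ≠ 0},
    (Mi.finite_support_P w).image _, ?_⟩
  intro q x hx
  let N : Submodule ℂ Wk :=
    ⨆ d ∈ (fun Δ : ℝ => -Δ + s + 1) '' {Δ | Mi.P Δ w ≠ 0}, Mk.grading (q + d)
  let p : Submodule ℂ (Wj →ₗ[ℂ] Wk) := N.comap (LinearMap.applyₗ x)
  change α.reflectedMode w s ∈ p
  refine finsum_induction (· ∈ p) p.zero_mem (fun _ _ => p.add_mem) fun Δ => ?_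
  refine finsum_induction (· ∈ p) p.zero_mem (fun _ _ => p.add_mem) fun m => ?_
  by_cases h0 : Mi.P Δ w = 0
  · simp [h0]
  · apply p.smul_mem
    change α.Y _ _ x ∈ N
    have h1 := α.mode_mem (Mi.L1_pow_mem (Mi.P_mem Δ w) m) (2 * Δ - s - m - 2) hx
    have h2 : q + (Δ - m - (2 * Δ - s - m - 2) - 1) = q + (-Δ + s + 1) := by ring
    rw [h2] at h1
    exact Submodule.mem_iSup_of_mem _
      (Submodule.mem_iSup_of_mem (⟨Δ, h0, rfl⟩ : _ ∈ _ '' _) h1)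

/-- The contragredient intertwining operator `C𝒴`, mode by mode: `(C𝒴)(w,s)` maps the graded dual
of `W_k` to the graded dual of `W_j` and is the transpose of
`𝒴(e^{xL_1}(e^{-iπ}x^{-2})^{L_0} w, x^{-1})`. -/
def contragredient (α : IntertwiningOperator Mi Mj Mk) (w : Wi) (s : ℝ) :
    Mk.gradedDual →ₗ[ℂ] Mj.gradedDual :=
  ((α.reflectedMode w s).dualMap).restrict (p := Mk.gradedDual) (q := Mj.gradedDual) (by
    intro φ hφ
    obtain ⟨T, hT, hmem⟩ := α.reflectedMode_shift w s
    refine ((Set.Finite.image2 (fun a d => a - d) hφ hT)).subset ?_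
    rintro q ⟨x, hx, hne⟩
    by_contra hc
    apply hne
    have h2 : ⨆ d ∈ T, Mk.grading (q + d) ≤ LinearMap.ker φ := by
      refine iSup₂_le fun d hd y hy => ?_
      by_contra hy2
      exact hc ⟨q + d, ⟨y, hy, hy2⟩, d, hd, by ring⟩
    exact h2 (hmem q x hx))

end IntertwiningOperator

/-! ## Hilbert space completions and Sobolev norms -/

namespace UnitaryModule

variable {V : Type u} [NormedAddCommGroup V] [InnerProductSpace ℂ V] {𝓥 : UnitaryVOA V}
  {W : Type v} [NormedAddCommGroup W] [InnerProductSpace ℂ W]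

theorem L0_symmetric (M : UnitaryModule 𝓥 W) (a b : W) :
    inner ℂ b (M.Y 𝓥.ν 1 a) = inner ℂ (M.Y 𝓥.ν 1 b) a := by
  have hL1 : 𝓥.L 1 𝓥.ν = 0 := by
    have h := 𝓥.virasoro 1 (-2) 𝓥.Ω
    have h1 := 𝓥.creation 𝓥.ν
    have h2 := 𝓥.creation_zero 𝓥.ν 2 (by norm_num)
    have h3 := 𝓥.creation_zero 𝓥.ν 0 (by norm_num)
    norm_num [h1, h2, h3] at h
    exact h
  have h := M.unitary 2 𝓥.ν 𝓥.conformal_mem 1 a b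
  rw [h, finsum_eq_single _ 0]
  · norm_num [𝓥.θ_conformal]
  · intro m hm
    obtain ⟨k, rfl⟩ := Nat.exists_eq_succ_of_ne_zero hm
    simp [𝓥.θ_conformal, pow_succ, hL1]

/-- Distinct weight spaces are orthogonal. -/
theorem inner_eq_zero (M : UnitaryModule 𝓥 W) {s q : ℝ} (h : s ≠ q) {a b : W}
    (ha : a ∈ M.grading s) (hb : b ∈ M.grading q) : inner ℂ b a = (0 : ℂ) := by
  have e := M.L0_symmetric a b
  rw [M.energy s a ha, M.energy q b hb, inner_smul_left, inner_smul_right, Complex.conj_ofReal] at e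
  have e2 : ((s : ℂ) - q) * inner ℂ b a = 0 := by rw [sub_mul, e, sub_self]
  rcases mul_eq_zero.1 e2 with h3 | h3
  · exact absurd (by exact_mod_cast sub_eq_zero.1 h3) h
  · exact h3

theorem inner_mem_gradedDual (M : UnitaryModule 𝓥 W) (w : W) :
    (innerSL ℂ w : W →L[ℂ] ℂ).toLinearMap ∈ M.gradedDual := by
  induction w using M.toVOAModule.induction_grading with
  | h0 => simp
  | hmem s y hy =>
    refine (Set.finite_singleton s).subset ?_
    rintro q ⟨x, hx, hne⟩
    by_contra hc
    exact hne (M.inner_eq_zero hc hx hy)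
  | hadd y z hy hz =>
    rw [map_add]
    exact M.gradedDual.add_mem hy hz

/-- The map `w ↦ ⟨·|w⟩` from `W` to its graded dual. -/
def conjMap (M : UnitaryModule 𝓥 W) : W →ₛₗ[starRingEnd ℂ] M.gradedDual where
  toFun w := ⟨(innerSL ℂ w : W →L[ℂ] ℂ).toLinearMap, M.inner_mem_gradedDual w⟩
  map_add' x y := by ext; simp
  map_smul' c x := by ext; simp

theorem conjMap_bijective (M : UnitaryModule 𝓥 W) : Function.Bijective M.conjMap := by
  constructor
  · rw [injective_iff_map_eq_zero]
    intro w hw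
    have h := congrArg (fun φ : M.gradedDual => (φ : Module.Dual ℂ W) w) hw
    simpa [conjMap] using h
  · rintro ⟨φ, hφ⟩
    have riesz : ∀ s, ∃ u ∈ M.grading s, ∀ x ∈ M.grading s, inner ℂ u x = φ x := by
      intro s
      have := M.finiteDim s
      have : CompleteSpace (M.grading s) := FiniteDimensional.complete ℂ _
      let ψ : M.grading s →L[ℂ] ℂ := LinearMap.toContinuousLinearMap (φ ∘ₗ (M.grading s).subtype)
      refine ⟨((InnerProductSpace.toDual ℂ (M.grading s)).symm ψ : M.grading s),
        Subtype.mem _, fun x hx => ?_⟩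
      have := InnerProductSpace.toDual_symm_apply (𝕜 := ℂ) (x := (⟨x, hx⟩ : M.grading s)) (y := ψ)
      exact this
    choose u hu hux using riesz
    refine ⟨∑ s ∈ hφ.toFinset, u s, Subtype.ext (LinearMap.ext fun x => ?_)⟩
    change inner ℂ (∑ s ∈ hφ.toFinset, u s) x = φ x
    induction x using M.toVOAModule.induction_grading with
    | h0 => simp
    | hmem q x hx =>
      rw [sum_inner]
      by_cases hq : q ∈ hφ.toFinset
      · rw [Finset.sum_eq_single_of_mem q hq, hux q x hx]
        intro b _ hb
        exact M.inner_eq_zero (Ne.symm hb) hx (hu b)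
      · rw [Finset.sum_eq_zero]
        · by_contra hne
          exact hq (by exact (Set.Finite.mem_toFinset _).2 ⟨x, hx, Ne.symm hne⟩)
        · intro b hb
          refine M.inner_eq_zero ?_ hx (hu b)
          rintro rfl
          exact hq hb
    | hadd y z hy hz => rw [inner_add_right, hy, hz, map_add]

/-- The conjugation map `C : W → W'`, `w ↦ w̄ = ⟨·|w⟩`, an antilinear bijection onto the
contragredient space. -/
def C (M : UnitaryModule 𝓥 W) : W ≃ₛₗ[starRingEnd ℂ] M.gradedDual :=
  LinearEquiv.ofBijective M.conjMap M.conjMap_bijective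

/-- The orthogonal projection of the Hilbert space completion `ℋ` of `W` onto `W(s)`. -/
def proj (M : UnitaryModule 𝓥 W) (s : ℝ) :
    UniformSpace.Completion W →L[ℂ] UniformSpace.Completion W :=
  haveI := M.finiteDim s
  ((M.grading s).map
    (UniformSpace.Completion.toComplₗᵢ (𝕜 := ℂ) (E := W)).toLinearMap).starProjection

/-- The self-adjoint operator `(1 + L̄_0)^r` on `ℋ`. As `L̄_0` is diagonalised with eigenvalues `s`
and eigenspaces `W(s)`, this is `ξ ↦ ∑_s (1+s)^r P_s ξ`, with domain the vectors for which the
(orthogonal) series converges. -/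
def onePlusL0Pow (M : UnitaryModule 𝓥 W) (r : ℝ) :
    UniformSpace.Completion W →ₗ.[ℂ] UniformSpace.Completion W where
  domain :=
    { carrier := {ξ | Summable fun s : ℝ => (((1 + s) ^ r : ℝ) : ℂ) • M.proj s ξ}
      zero_mem' := by simp
      add_mem' := by
        intro a b ha hb
        simpa only [Set.mem_ofPred_eq, map_add, smul_add] using ha.add hb
      smul_mem' := by
        intro c a ha
        have := Summable.const_smul c ha
        simpa only [Set.mem_ofPred_eq, map_smul, smul_comm c] using this }
  toFun :=
    { toFun := fun ξ => ∑' s : ℝ, (((1 + s) ^ r : ℝ) : ℂ) • M.proj s ξ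
      map_add' := by
        intro a b
        simp only [Submodule.coe_add, map_add, smul_add]
        exact Summable.tsum_add a.2 b.2
      map_smul' := by
        intro c a
        simp only [Submodule.coe_smul, map_smul, smul_comm _ c]
        exact Summable.tsum_const_smul c a.2 }

/-- `ℋ^r`, the domain of `(1 + L̄_0)^r`. -/
def sobolevSpace (M : UnitaryModule 𝓥 W) (r : ℝ) : Submodule ℂ (UniformSpace.Completion W) :=
  (M.onePlusL0Pow r).domain

open Classical in
/-- The Sobolev norm `‖ξ‖_r = ‖(1 + L̄_0)^r ξ‖` (and `0` if `ξ ∉ ℋ^r`). -/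
def sobolevNorm (M : UnitaryModule 𝓥 W) (r : ℝ) (ξ : UniformSpace.Completion W) : ℝ :=
  if h : ξ ∈ (M.onePlusL0Pow r).domain then ‖M.onePlusL0Pow r ⟨ξ, h⟩‖ else 0

/-- `ℋ^∞`, the space of smooth vectors. -/
def smooth (M : UnitaryModule 𝓥 W) : Submodule ℂ (UniformSpace.Completion W) :=
  ⨅ (r : ℝ) (_ : 0 ≤ r), M.sobolevSpace r

end UnitaryModule

/-! ## Test functions on the circle -/

/-- `C_c^∞(S^1 ∖ {-1})`: smooth functions on the circle whose support does not contain `-1`.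
Smoothness is tested along the covering `θ ↦ e^{iθ}`. -/
structure TestFun where
  toFun : Circle → ℂ
  smooth' : ContDiff ℝ ∞ fun t : ℝ => toFun (Circle.exp t)
  support' : (-1 : Circle) ∉ tsupport toFun

namespace TestFun

/-- `e_r(e^{iθ}) = e^{irθ}` for `-π < θ < π`. (The value at `-1` plays no role.) -/
def e (r : ℝ) (z : Circle) : ℂ := Complex.exp (Complex.I * r * Complex.arg z)

/-- The test function `conj (e_r f)`. -/
def conjE (r : ℝ) (f : TestFun) : TestFun where
  toFun z := conj (e r z * f.toFun z)
  smooth' := by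
    rw [contDiff_iff_contDiffAt]
    intro t
    by_cases ht : Circle.exp t = -1
    · have h1 : f.toFun =ᶠ[nhds (Circle.exp t)] 0 := by
        rw [ht]
        exact notMem_tsupport_iff_eventuallyEq.1 f.support'
      have h2 := (Circle.exp.continuous.tendsto t).eventually h1
      refine (contDiffAt_const (c := (0 : ℂ))).congr_of_eventuallyEq ?_
      filter_upwards [h2] with x hx
      simp [hx]
    · have hs : ((Circle.exp t : Circle) : ℂ) ∈ Complex.slitPlane := by
        rw [Complex.mem_slitPlane_iff_arg]
        refine ⟨fun h => ht ?_, Circle.coe_ne_zero _⟩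
        apply Circle.ext
        rw [Complex.arg_eq_pi_iff] at h
        have hn : Complex.normSq ((Circle.exp t : Circle) : ℂ) = 1 := Circle.normSq_coe _
        rw [Complex.normSq_apply, h.2] at hn
        have hre : ((Circle.exp t : Circle) : ℂ).re = -1 := by nlinarith [h.1]
        apply Complex.ext
        · simpa using hre
        · simpa using h.2
      have hexp : ContDiffAt ℝ ∞ (fun x : ℝ => ((Circle.exp x : Circle) : ℂ)) t := by
        simp only [Circle.coe_exp]
        exact ((Complex.ofRealCLM.contDiff.mul contDiff_const).cexp).contDiffAt
      have hlog : ContDiffAt ℝ ∞ (fun x : ℝ => Complex.log ((Circle.exp x : Circle) : ℂ)) t :=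
        ContDiffAt.comp (g := Complex.log) t ((Complex.contDiffAt_log hs).restrict_scalars ℝ) hexp
      have harg : ContDiffAt ℝ ∞
          (fun x : ℝ => (Complex.arg ((Circle.exp x : Circle) : ℂ) : ℂ)) t := by
        have := (Complex.ofRealCLM.contDiff.comp Complex.imCLM.contDiff).contDiffAt.comp t hlog
        simpa [Function.comp_def, Complex.log_im] using this
      exact Complex.conjCLE.contDiff.contDiffAt.comp t
        (((contDiffAt_const.mul harg).cexp).mul f.smooth'.contDiffAt)
  support' := fun h => f.support' (closure_mono (by
    intro z hz hf
    exact hz (by simp [hf])) h)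

/-- The mode `f^(s) = ∫_{-π}^{π} f(e^{iθ}) e^{-isθ} dθ/2π`. -/
def mode (f : TestFun) (s : ℝ) : ℂ :=
  ∫ t in (-Real.pi)..Real.pi,
    f.toFun (Circle.exp t) * Complex.exp (-(Complex.I * s * t)) / (2 * Real.pi)

/-- The terms `(1+|s|)^t |f^(s)|`, `s ∈ ℤ_V`, of the norm `|f|_{V,t}`. -/
def normTerm {V : Type u} [AddCommGroup V] [Module ℂ V] (𝓥 : VOA V) (t : ℝ) (f : TestFun)
    (s : VOA.exponents.{u, v} 𝓥) : ℝ :=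
  (1 + |(s : ℝ)|) ^ t * ‖f.mode s‖

/-- The norm `|f|_{V,t} = ∑_{s ∈ ℤ_V} (1+|s|)^t |f^(s)|`. -/
def norm {V : Type u} [AddCommGroup V] [Module ℂ V] (𝓥 : VOA V) (t : ℝ) (f : TestFun) : ℝ :=
  ∑' s, normTerm.{u, v} 𝓥 t f s

end TestFun

/-! ## Smeared operators -/

section Smeared

variable {Wj Wk : Type v} [NormedAddCommGroup Wj] [InnerProductSpace ℂ Wj]
  [NormedAddCommGroup Wk] [InnerProductSpace ℂ Wk]

/-- For a family of modes `A s`, i.e. the series `A(x) = ∑_s A_s x^(-s-1)`, the value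
`⟨A(e^{iθ}) x | y⟩` (a finite sum of powers of `e^{iθ}`, with `arg e^{iθ} = θ`). -/
def pointForm (A : ℝ → Wj →ₗ[ℂ] Wk) (x : Wj) (y : Wk) (t : ℝ) : ℂ :=
  ∑ᶠ s : ℝ, inner ℂ y (A s x) * Complex.exp (-(Complex.I * (s + 1) * t))

/-- The sesquilinear form `⟨A(f) x | y⟩ = ∫_{-π}^{π} ⟨A(e^{iθ}) x | y⟩ f(e^{iθ}) e^{iθ} dθ/2π`. -/
def smearedForm (A : ℝ → Wj →ₗ[ℂ] Wk) (f : TestFun) (x : Wj) (y : Wk) : ℂ :=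
  ∫ t in (-Real.pi)..Real.pi,
    pointForm A x y t * f.toFun (Circle.exp t) * (Complex.exp (Complex.I * t) / (2 * Real.pi))

theorem continuous_pointForm (A : ℝ → Wj →ₗ[ℂ] Wk) (x : Wj) (y : Wk)
    (h : {s : ℝ | inner ℂ y (A s x) ≠ (0 : ℂ)}.Finite) : Continuous (pointForm A x y) := by
  have : pointForm A x y = fun t : ℝ => ∑ s ∈ h.toFinset,
      inner ℂ y (A s x) * Complex.exp (-(Complex.I * (s + 1) * t)) := by
    funext t
    refine finsum_eq_finsetSum_of_support_subset _ ?_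
    intro s hs
    simp only [Set.Finite.coe_toFinset, Set.mem_ofPred_eq]
    exact fun h0 => hs (by simp [h0])
  rw [this]
  fun_prop

theorem intervalIntegrable_smearedForm (A : ℝ → Wj →ₗ[ℂ] Wk) (f : TestFun) (x : Wj) (y : Wk)
    (h : {s : ℝ | inner ℂ y (A s x) ≠ (0 : ℂ)}.Finite) :
    IntervalIntegrable (fun t : ℝ => pointForm A x y t * f.toFun (Circle.exp t) *
      (Complex.exp (Complex.I * t) / (2 * Real.pi))) MeasureTheory.volume (-Real.pi) Real.pi := by
  apply Continuous.intervalIntegrable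
  have := continuous_pointForm A x y h
  have := f.smooth'.continuous
  fun_prop

theorem pointForm_add (A : ℝ → Wj →ₗ[ℂ] Wk) (x x' : Wj) (y : Wk)
    (h : {s : ℝ | inner ℂ y (A s x) ≠ (0 : ℂ)}.Finite)
    (h' : {s : ℝ | inner ℂ y (A s x') ≠ (0 : ℂ)}.Finite) (t : ℝ) :
    pointForm A (x + x') y t = pointForm A x y t + pointForm A x' y t := by
  unfold pointForm
  rw [← finsum_add_distrib]
  · simp [add_mul]
  · exact h.subset fun s hs h0 => hs (by simp [h0])
  · exact h'.subset fun s hs h0 => hs (by simp [h0])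

theorem pointForm_smul (A : ℝ → Wj →ₗ[ℂ] Wk) (c : ℂ) (x : Wj) (y : Wk)
    (t : ℝ) :
    pointForm A (c • x) y t = c * pointForm A x y t := by
  unfold pointForm
  rw [← smul_eq_mul c, smul_finsum]
  simp [mul_assoc]

/-- The graph of `A(f)`, as an operator from `ℋ_j` to `ℋ_k` with domain contained in `W_j`: the
pairs `(x, ξ)`, `x ∈ W_j`, `ξ ∈ ℋ_k`, such that `ξ` represents the form: `⟨ξ|y⟩ = ⟨A(f)x|y⟩` for all
`y ∈ W_k`. -/
def smearedGraph (A : ℝ → Wj →ₗ[ℂ] Wk) (f : TestFun) :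
    Submodule ℂ (UniformSpace.Completion Wj × UniformSpace.Completion Wk) where
  carrier := {q | ∃ x : Wj, q.1 = (x : UniformSpace.Completion Wj) ∧ ∀ y : Wk,
    {s : ℝ | inner ℂ y (A s x) ≠ (0 : ℂ)}.Finite ∧
    inner ℂ (y : UniformSpace.Completion Wk) q.2 = smearedForm A f x y}
  zero_mem' := ⟨0, UniformSpace.Completion.coe_zero.symm, fun y => by simp [smearedForm, pointForm]⟩
  add_mem' := by
    rintro ⟨a, b⟩ ⟨a', b'⟩ ⟨x, hx, h⟩ ⟨x', hx', h'⟩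
    dsimp only at hx hx' h h'
    refine ⟨x + x', by simp [hx, hx', UniformSpace.Completion.coe_add], fun y => ⟨?_, ?_⟩⟩
    · refine ((h y).1.union (h' y).1).subset ?_
      intro s hs
      by_cases h0 : inner ℂ y (A s x) = (0 : ℂ)
      · exact Or.inr fun h1 => hs (by simp [h0, h1])
      · exact Or.inl h0
    · simp only [Prod.mk_add_mk, inner_add_right, (h y).2, (h' y).2]
      unfold smearedForm
      rw [← intervalIntegral.integral_add (intervalIntegrable_smearedForm A f x y (h y).1)
        (intervalIntegrable_smearedForm A f x' y (h' y).1)]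
      congr 1
      funext t
      rw [pointForm_add A x x' y (h y).1 (h' y).1]
      ring
  smul_mem' := by
    rintro c ⟨a, b⟩ ⟨x, hx, h⟩
    dsimp only at hx h
    refine ⟨c • x, by simp [hx, UniformSpace.Completion.coe_smul], fun y => ⟨?_, ?_⟩⟩
    · refine (h y).1.subset ?_
      intro s hs h0
      exact hs (by simp [h0])
    · simp only [Prod.smul_mk, inner_smul_right, (h y).2]
      unfold smearedForm
      rw [← intervalIntegral.integral_const_mul]
      congr 1
      funext t
      rw [pointForm_smul]
      ring

/-- `A(f)` as an unbounded operator from `ℋ_j` to `ℋ_k` with domain contained in `W_j`. -/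
def smearedCore (A : ℝ → Wj →ₗ[ℂ] Wk) (f : TestFun) :
    UniformSpace.Completion Wj →ₗ.[ℂ] UniformSpace.Completion Wk :=
  (smearedGraph A f).toLinearPMap

variable {V : Type u} [NormedAddCommGroup V] [InnerProductSpace ℂ V] {𝓥 : UnitaryVOA V}

/-- The smeared operator `A(f)`: the restriction to `ℋ_j^∞` of the closure of `A(f)|_{W_j}`. -/
def smeared (Mj : UnitaryModule 𝓥 Wj) (A : ℝ → Wj →ₗ[ℂ] Wk) (f : TestFun) :
    UniformSpace.Completion Wj →ₗ.[ℂ] UniformSpace.Completion Wk :=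
  (smearedCore A f).closure.domRestrict Mj.smooth

/-- The formal adjoint of an operator from `ℋ_j` to `ℋ_k`: the restriction of its adjoint to
`ℋ_k^∞`. -/
def formalAdjoint (Mk : UnitaryModule 𝓥 Wk)
    (T : UniformSpace.Completion Wj →ₗ.[ℂ] UniformSpace.Completion Wk) :
    UniformSpace.Completion Wk →ₗ.[ℂ] UniformSpace.Completion Wj :=
  T.adjoint.domRestrict Mk.smooth

variable {Wi : Type v} [NormedAddCommGroup Wi] [InnerProductSpace ℂ Wi]
  {Mi : UnitaryModule 𝓥 Wi} {Mj : UnitaryModule 𝓥 Wj} {Mk : UnitaryModule 𝓥 Wk}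

/-- The adjoint intertwining operator `𝒴_{α*}`, the conjugate of the contragredient of `𝒴_α`, mode
by mode: for `φ = w̄` in the contragredient space of `W_i`,
`𝒴_{α*}(w̄,s) = C_j⁻¹ ∘ (C𝒴_α)(w,s) ∘ C_k` maps `W_k` to `W_j`. -/
def adjointIntertwiner
    (α : IntertwiningOperator Mi.toVOAModule Mj.toVOAModule Mk.toVOAModule)
    (φ : Mi.gradedDual) (s : ℝ) : Wk →ₗ[ℂ] Wj :=
  (Mj.C.symm : Mj.gradedDual →ₛₗ[starRingEnd ℂ] Wj).comp
    ((α.contragredient (Mi.C.symm φ) s).comp (Mk.C : Wk →ₛₗ[starRingEnd ℂ] Mk.gradedDual))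

end Smeared

end

/-! ## Finite sums in the Jacobi identity -/

/-! The smeared operator is the series `∑ f^(s) A(s)` over the modes, and everything is read off
from it. Three facts make the series converge in every Sobolev norm.

The modes that do not vanish are indexed by a finite union of cosets of `ℤ`. Unitarity gives, for
every weight of a module, an irreducible submodule whose conformal weight lies in the same class
modulo `ℤ`, so the indices lie in `ℤ_V`. By `C_2`-cofiniteness the quotient `V / O(V)` underlying
Zhu's algebra is finite dimensional. Hence one nonzero polynomial in the conformal vector is
annihilated there, and its finitely many roots include all conformal weights.

The test function vanishes near `-1`, so integration by parts makes `f^(s)` decrease faster than any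
power of the real variable `s`. This gives the finite norms `|f|_{V,q}`.

The mode `A(s)` moves every weight by the same amount `D - s - 1`. Since weight spaces are
orthogonal, a bound on homogeneous vectors extends blockwise to all of `W_j`, and Peetre's
inequality exchanges a Sobolev order `p` for a factor `(1+|s|)^|p|`
(`EnergyBounded.norm_cutoff_mode_le`). Summing over `s` gives the estimate of (a) on `W_j`. At order
`-r` the right side involves only the Hilbert norm, which gives closability. Truncating smooth
vectors to finitely many weights extends everything to `ℋ_j^∞`.

For (b) the adjoint modes need energy bounds of their own. The commutator with `L_1`, together with
`‖L_1 x‖ ≤ q ‖x‖` on weight `q`, carries bounds from `w` to `L_1^m w`. Testing an adjoint mode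
against its own value then carries them to the adjoint operator. The adjoint relation on finite
vectors is the inversion `e^{-X} e^{X} = 1` written in modes (`smearedForm_eq_sum`), and it passes
to smooth vectors by truncation. -/

theorem ringChoose_natCast_eq (m l : ℕ) :
    ((Ring.choose (m : ℤ) l : ℤ) : ℂ) = (m.choose l : ℂ) := by
  rw [Ring.choose_natCast]; push_cast; rfl

theorem finsum_ringChoose_smul {X : Type*} [AddCommGroup X] [Module ℂ X] (m : ℕ) (F : ℕ → X) :
    ∑ᶠ l : ℕ, ((Ring.choose (m : ℤ) l : ℤ) : ℂ) • F l
      = ∑ l ∈ Finset.range (m + 1), (m.choose l : ℂ) • F l := by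
  simp_rw [ringChoose_natCast_eq]
  refine finsum_eq_finsetSum_of_support_subset _ fun l hl => ?_
  by_contra hc
  refine hl ?_
  have : m < l := by simpa using hc
  simp [Nat.choose_eq_zero_of_lt this]

theorem finsum_ringChoose_zero_smul {X : Type*} [AddCommGroup X] [Module ℂ X] (c : ℕ → ℂ)
    (F : ℕ → X) :
    ∑ᶠ l : ℕ, (c l * ((Ring.choose (0 : ℤ) l : ℤ) : ℂ)) • F l = c 0 • F 0 := by
  rw [finsum_eq_single _ 0]
  · simp
  · intro l hl
    have := ringChoose_natCast_eq 0 l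
    rw [Nat.cast_zero] at this
    rw [this, Nat.choose_eq_zero_of_lt (Nat.pos_of_ne_zero hl)]
    simp

/-- Eigenspaces for distinct eigenvalues are independent, so no eigenvector escapes the summand with
its eigenvalue. Applied to `L_0` on `V`, this reduces weight computations to commutators. -/
theorem mem_of_eigenvector {X ι : Type*} [AddCommGroup X] [Module ℂ X] [DecidableEq ι]
    {G : ι → Submodule ℂ X} (hG : DirectSum.IsInternal G) (T : Module.End ℂ X) {c : ι → ℂ}
    (hc : Function.Injective c) (h : ∀ i, ∀ x ∈ G i, T x = c i • x) {i : ι} {x : X}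
    (hx : T x = c i • x) : x ∈ G i := by
  have hle : ∀ j, G j ≤ T.eigenspace (c j) := fun j y hy =>
    Module.End.mem_eigenspace_iff.2 (h j y hy)
  have htop : x ∈ ⨆ j, G j := by rw [hG.submodule_iSup_eq_top]; trivial
  have hsplit : ⨆ j, G j ≤ G i ⊔ ⨆ (μ) (_ : μ ≠ c i), T.eigenspace μ := by
    refine iSup_le fun j => ?_
    by_cases hj : j = i
    · subst hj; exact le_sup_left
    · exact ((hle j).trans (le_iSup₂_of_le (c j) (fun e => hj (hc e)) le_rfl)).trans le_sup_right
  obtain ⟨a, ha, b, hb, rfl⟩ := Submodule.mem_sup.1 (hsplit htop)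
  have hb' : b ∈ T.eigenspace (c i) := by
    have := (T.eigenspace (c i)).sub_mem (Module.End.mem_eigenspace_iff.2 hx) (hle i ha)
    simpa using this
  have := (T.eigenspaces_iSupIndep (c i)).le_bot ⟨hb', hb⟩
  rw [(Submodule.mem_bot ℂ).1 this, add_zero]
  exact ha

/-! ## Zhu's argument: finiteness of the lowest weights -/

namespace VOAModule

variable {V : Type u} [AddCommGroup V] [Module ℂ V] {𝓥 : VOA V}
  {W : Type v} [AddCommGroup W] [Module ℂ W]

theorem commutator (M : VOAModule 𝓥 W) (a b : V) (m : ℕ) (n : ℤ) (x : W) :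
    M.Y a m (M.Y b n x) - M.Y b n (M.Y a m x)
      = ∑ l ∈ Finset.range (m + 1), (m.choose l : ℂ) • M.Y (𝓥.Y a l b) (m + n - l) x := by
  have h := M.jacobi a b x m 0 n
  rw [finsum_ringChoose_smul, finsum_ringChoose_zero_smul, finsum_ringChoose_zero_smul] at h
  simpa using h.symm

/-- The commutator with `L_0 = Y(ν,1)` has two terms, containing `L_{-1} a` and `L_0 a`. The
translation axiom turns the first into a multiple of the same mode. -/
theorem mode_mem (M : VOAModule 𝓥 W) {d : ℤ} {a : V} (ha : a ∈ 𝓥.grading d) (n : ℤ) {q : ℝ}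
    {x : W} (hx : x ∈ M.grading q) : M.Y a n x ∈ M.grading (q + (d - n - 1)) := by
  apply M.mem_grading_of_L0
  have h := M.commutator 𝓥.ν a 1 n x
  have t := M.translation a (1 + n) x
  simp only [VOA.L] at t
  norm_num [Finset.sum_range_succ, M.energy q x hx, 𝓥.energy d a ha] at h t
  rw [sub_eq_iff_eq_add] at h
  rw [h, t]
  simp only [← Complex.coe_smul]
  push_cast
  module

end VOAModule

namespace VOA

variable {V : Type u} [AddCommGroup V] [Module ℂ V]

theorem commutator (𝓥 : VOA V) (a b : V) (m : ℕ) (n : ℤ) (x : V) :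
    𝓥.Y a m (𝓥.Y b n x) - 𝓥.Y b n (𝓥.Y a m x)
      = ∑ l ∈ Finset.range (m + 1), (m.choose l : ℂ) • 𝓥.Y (𝓥.Y a l b) (m + n - l) x := by
  have h := 𝓥.jacobi a b x m 0 n
  rw [finsum_ringChoose_smul, finsum_ringChoose_zero_smul, finsum_ringChoose_zero_smul] at h
  simpa using h.symm

theorem mode_mem (𝓥 : VOA V) {d q : ℤ} {a x : V} (ha : a ∈ 𝓥.grading d) (n : ℤ)
    (hx : x ∈ 𝓥.grading q) : 𝓥.Y a n x ∈ 𝓥.grading (q + d - n - 1) := by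
  refine mem_of_eigenvector 𝓥.internal (𝓥.Y 𝓥.ν 1) (c := fun n : ℤ => (n : ℂ))
    Int.cast_injective 𝓥.energy ?_
  have h := 𝓥.commutator 𝓥.ν a 1 n x
  have t := 𝓥.translation a (1 + n) x
  norm_num [Finset.sum_range_succ, 𝓥.energy q x hx, 𝓥.energy d a ha] at h t
  rw [sub_eq_iff_eq_add] at h
  rw [h, t]
  push_cast
  module

/-- The product `a ∘ b = ∑_l (n choose l) a_{l-2} b` of Zhu, where `n` is the weight of `a`. -/
noncomputable def zhuCircle (𝓥 : VOA V) (n : ℤ) (a b : V) : V :=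
  ∑ᶠ l : ℕ, ((Ring.choose n l : ℤ) : ℂ) • 𝓥.Y a (-2 + l) b

/-- The kernel `O(V)` of the projection onto Zhu's algebra. -/
noncomputable def zhuO (𝓥 : VOA V) : Submodule ℂ V :=
  Submodule.span ℂ {x | ∃ m n : ℤ, ∃ a ∈ 𝓥.grading m, ∃ b ∈ 𝓥.grading n, x = 𝓥.zhuCircle m a b}

theorem homogeneous_induction (𝓥 : VOA V) {p : V → Prop} (x : V)
    (h0 : p 0) (hmem : ∀ n, ∀ y ∈ 𝓥.grading n, p y)
    (hadd : ∀ y z, p y → p z → p (y + z)) : p x := by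
  have hx : x ∈ ⨆ s, 𝓥.grading s := by
    rw [𝓥.internal.submodule_iSup_eq_top]; trivial
  exact Submodule.iSup_induction 𝓥.grading (motive := p) hx hmem h0 hadd

theorem finite_mode_ne_zero (𝓥 : VOA V) {a b : V} (n : ℤ) :
    {l : ℕ | 𝓥.Y a (n + l) b ≠ 0}.Finite := by
  obtain ⟨N, hN⟩ := 𝓥.truncation a b
  refine (Set.finite_Iio (N - n).toNat).subset fun l hl => ?_
  by_contra hc
  refine hl (hN _ ?_)
  simp only [Set.mem_Iio, not_lt] at hc
  omega

theorem zhuCircle_eq (𝓥 : VOA V) (n : ℤ) (a b : V) :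
    𝓥.zhuCircle n a b = 𝓥.Y a (-2) b +
      ∑ᶠ l : ℕ, ((Ring.choose n (l + 1) : ℤ) : ℂ) • 𝓥.Y a (-2 + (l + 1 : ℕ)) b := by
  obtain ⟨N, hN⟩ := 𝓥.truncation a b
  have hs : ∀ l : ℕ, (N + 2).toNat ≤ l → 𝓥.Y a (-2 + l) b = 0 := by
    intro l hl
    exact hN _ (by omega)
  rw [zhuCircle, finsum_eq_finsetSum_of_support_subset (s := Finset.range ((N + 2).toNat + 1)),
    finsum_eq_finsetSum_of_support_subset (s := Finset.range ((N + 2).toNat)),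
    Finset.sum_range_succ']
  · simp [add_comm]
  · intro l hl
    by_contra hc
    refine hl ?_
    simp only [Finset.coe_range, Set.mem_Iio, not_lt] at hc
    have := hs (l + 1) (by omega)
    simp only [this, smul_zero]
  · intro l hl
    by_contra hc
    refine hl ?_
    simp only [Finset.coe_range, Set.mem_Iio, not_lt] at hc
    simp only [hs l (by omega), smul_zero]

/-- Finitely many weight spaces span a complement of `C_2(V)`. -/
theorem IsC2Cofinite.exists_finset {𝓥 : VOA V} (h : 𝓥.IsC2Cofinite) :
    ∃ s : Finset ℤ, (⨆ n ∈ s, 𝓥.grading n) ⊔ 𝓥.C2 = ⊤ := by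
  have : FiniteDimensional ℂ (V ⧸ 𝓥.C2) := h
  -- A finitely generated submodule is a compact element of the lattice, so finitely many of the
  -- images of the weight spaces already fill the quotient.
  have hfg : (⊤ : Submodule ℂ (V ⧸ 𝓥.C2)).FG := Module.finite_def.1 this
  have hc := (Submodule.fg_iff_compact _).1 hfg
  have htop : (⊤ : Submodule ℂ (V ⧸ 𝓥.C2)) ≤ ⨆ n, (𝓥.grading n).map 𝓥.C2.mkQ := by
    rw [← Submodule.map_iSup, 𝓥.internal.submodule_iSup_eq_top, Submodule.map_top,
      Submodule.range_mkQ]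
  obtain ⟨s, hs⟩ := CompleteLattice.IsCompactElement.exists_finset_of_le_iSup _ hc _ htop
  refine ⟨s, ?_⟩
  simp_rw [← Submodule.map_iSup] at hs
  have := Submodule.comap_mono (f := 𝓥.C2.mkQ) hs
  rw [Submodule.comap_map_mkQ, Submodule.comap_top] at this
  rw [sup_comm]
  exact top_le_iff.1 this

/-- The projection onto a weight space of `V`. -/
noncomputable def homProj (𝓥 : VOA V) (n : ℤ) : V →ₗ[ℂ] V :=
  (𝓥.grading n).subtype ∘ₗ DirectSum.component ℂ ℤ (fun q => 𝓥.grading q) n ∘ₗ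
    ((LinearEquiv.ofBijective (DirectSum.coeLinearMap 𝓥.grading)
      (show Function.Bijective _ from 𝓥.internal)).symm : V →ₗ[ℂ] _)

theorem homProj_apply (𝓥 : VOA V) {n m : ℤ} {x : V} (hx : x ∈ 𝓥.grading n) :
    𝓥.homProj m x = if m = n then x else 0 := by
  have h : (LinearEquiv.ofBijective (DirectSum.coeLinearMap 𝓥.grading)
      (show Function.Bijective _ from 𝓥.internal)).symm x
        = DirectSum.lof ℂ ℤ (fun q => 𝓥.grading q) n ⟨x, hx⟩ := by
    rw [LinearEquiv.symm_apply_eq]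
    exact (DirectSum.coeLinearMap_lof 𝓥.grading n ⟨x, hx⟩).symm
  split_ifs with hm
  · subst hm; simp [homProj, h]
  · simp [homProj, h, DirectSum.component.of, Ne.symm hm]

/-- The vector `a_{-2} b` is the top weight term of `a ∘ b`; the other terms have strictly smaller
weight. Thus `C_2(V)` can be replaced by `O(V)` by induction on the weight, starting below the
lowest weight of `V`. -/
theorem IsC2Cofinite.exists_sup_zhuO {𝓥 : VOA V} (h : 𝓥.IsC2Cofinite) :
    ∃ s : Finset ℤ, (⨆ n ∈ s, 𝓥.grading n) ⊔ 𝓥.zhuO = ⊤ := by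
  obtain ⟨s, hs⟩ := h.exists_finset
  refine ⟨s, ?_⟩
  set Q : Submodule ℂ V := (⨆ n ∈ s, 𝓥.grading n) ⊔ 𝓥.zhuO with hQ
  obtain ⟨N, hN⟩ := 𝓥.lowerBounded
  have key : ∀ k : ℕ, ∀ n : ℤ, n < N + k → 𝓥.grading n ≤ Q := by
    intro k
    induction k with
    | zero => intro n hn; rw [hN n (by simpa using hn)]; exact bot_le
    | succ k ih =>
      intro n hn
      by_cases hns : n ∈ s
      · exact le_sup_of_le_left
          (le_iSup₂_of_le (f := fun n (_ : n ∈ s) => 𝓥.grading n) n hns le_rfl)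
      have ih' : ∀ i < n, 𝓥.grading i ≤ Q := fun i hi => ih i (by push_cast at hn; omega)
      -- Generators of `C_2(V)` need not be homogeneous, so the induction handles only their
      -- components of weight `n`.
      have hC : ∀ a b : V, 𝓥.homProj n (𝓥.Y a (-2) b) ∈ Q := by
        intro a b
        induction a using 𝓥.homogeneous_induction with
        | h0 => simp
        | hadd y z hy hz => simpa using Q.add_mem hy hz
        | hmem i a ha =>
          induction b using 𝓥.homogeneous_induction with
          | h0 => simp
          | hadd y z hy hz => simpa using Q.add_mem hy hz
          | hmem j b hb =>
            have hab := 𝓥.mode_mem ha (-2) hb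
            rw [𝓥.homProj_apply hab]
            split_ifs with hn'
            · have e := 𝓥.zhuCircle_eq i a b
              rw [eq_sub_of_add_eq e.symm]
              refine Q.sub_mem (Submodule.mem_sup_right
                (Submodule.subset_span ⟨i, j, a, ha, b, hb, rfl⟩)) ?_
              refine finsum_induction (· ∈ Q) Q.zero_mem (fun _ _ => Q.add_mem) fun l => ?_
              exact Q.smul_mem _ (ih' _ (by push_cast; omega) (𝓥.mode_mem ha _ hb))
            · exact Q.zero_mem
      intro x hx
      have hx' : x ∈ (⨆ n ∈ s, 𝓥.grading n) ⊔ 𝓥.C2 := by rw [hs]; trivial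
      obtain ⟨y, hy, z, hz, rfl⟩ := Submodule.mem_sup.1 hx'
      have hy0 : 𝓥.homProj n y = 0 := by
        have : (⨆ n ∈ s, 𝓥.grading n) ≤ LinearMap.ker (𝓥.homProj n) := by
          refine iSup₂_le fun j hj y hy => ?_
          rw [LinearMap.mem_ker, 𝓥.homProj_apply hy, if_neg]
          rintro rfl
          exact hns hj
        exact this hy
      have hzQ : 𝓥.homProj n z ∈ Q := by
        have : 𝓥.C2 ≤ Q.comap (𝓥.homProj n) := by
          refine Submodule.span_le.2 ?_
          rintro _ ⟨a, b, rfl⟩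
          exact hC a b
        exact this hz
      have e := 𝓥.homProj_apply (m := n) hx
      rw [if_pos rfl, map_add, hy0, zero_add] at e
      rw [← e]
      exact hzQ
  refine top_le_iff.1 ?_
  rw [← 𝓥.internal.submodule_iSup_eq_top]
  exact iSup_le fun n => key (n - N + 1).toNat n (by omega)

theorem IsC2Cofinite.finiteDimensional_zhu {𝓥 : VOA V} (h : 𝓥.IsC2Cofinite) :
    FiniteDimensional ℂ (V ⧸ 𝓥.zhuO) := by
  obtain ⟨s, hs⟩ := h.exists_sup_zhuO
  set U : Submodule ℂ V := ⨆ n ∈ s, 𝓥.grading n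
  have := 𝓥.finiteDim
  have hU : FiniteDimensional ℂ U := by
    change FiniteDimensional ℂ (⨆ n ∈ s, 𝓥.grading n : Submodule ℂ V)
    rw [← Finset.sup_eq_iSup]; infer_instance
  refine Module.Finite.of_surjective (𝓥.zhuO.mkQ ∘ₗ U.subtype) ?_
  rw [← LinearMap.range_eq_top, LinearMap.range_comp, Submodule.range_subtype]
  have := congrArg (Submodule.map 𝓥.zhuO.mkQ) hs
  rwa [Submodule.map_sup, Submodule.map_top, Submodule.range_mkQ, Submodule.mkQ_map_self,
    sup_bot_eq] at this

/-- Left multiplication by the conformal vector in Zhu's algebra. -/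
def zhuMul (𝓥 : VOA V) : V →ₗ[ℂ] V := 𝓥.Y 𝓥.ν (-1) + (2 : ℂ) • 𝓥.Y 𝓥.ν 0 + 𝓥.Y 𝓥.ν 1

/-- The space of polynomials is infinite dimensional and cannot embed in `V / O(V)`. Only the linear
map `p ↦ p(zhuMul) Ω` is used, so neither associativity of Zhu's product nor the ideal property of
`O(V)` is needed. -/
theorem IsC2Cofinite.exists_polynomial {𝓥 : VOA V} (h : 𝓥.IsC2Cofinite) :
    ∃ p : Polynomial ℂ, p ≠ 0 ∧ Polynomial.aeval 𝓥.zhuMul p 𝓥.Ω ∈ 𝓥.zhuO := by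
  have := h.finiteDimensional_zhu
  let F : Polynomial ℂ →ₗ[ℂ] V ⧸ 𝓥.zhuO := 𝓥.zhuO.mkQ ∘ₗ (LinearMap.applyₗ 𝓥.Ω) ∘ₗ
    (Polynomial.aeval (R := ℂ) (A := Module.End ℂ V) 𝓥.zhuMul).toLinearMap
  by_contra! hc
  have hinj : Function.Injective F := by
    rw [injective_iff_map_eq_zero]
    intro p hp
    by_contra hp0
    exact hc p hp0 ((Submodule.Quotient.mk_eq_zero _).1 hp)
  have := Module.Finite.of_injective F hinj
  exact Polynomial.not_finite this

end VOA

namespace VOAModule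

variable {V : Type u} [AddCommGroup V] [Module ℂ V] {𝓥 : VOA V}
  {W : Type v} [AddCommGroup W] [Module ℂ W]

/-- `v ↦ o(v) x`, where `o(v) = Y(v, n - 1)` for `v ∈ V(n)`. -/
noncomputable def zeroMode (M : VOAModule 𝓥 W) (x : W) : V →ₗ[ℂ] W :=
  DirectSum.toModule ℂ ℤ W (fun n =>
    (LinearMap.applyₗ x ∘ₗ LinearMap.proj (n - 1) ∘ₗ M.Y) ∘ₗ (𝓥.grading n).subtype) ∘ₗ
    ((LinearEquiv.ofBijective (DirectSum.coeLinearMap 𝓥.grading)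
      (show Function.Bijective _ from 𝓥.internal)).symm : V →ₗ[ℂ] _)

theorem zeroMode_apply (M : VOAModule 𝓥 W) (x : W) {n : ℤ} {a : V} (ha : a ∈ 𝓥.grading n) :
    M.zeroMode x a = M.Y a (n - 1) x := by
  have h : (LinearEquiv.ofBijective (DirectSum.coeLinearMap 𝓥.grading)
      (show Function.Bijective _ from 𝓥.internal)).symm a
        = DirectSum.lof ℂ ℤ (fun q => 𝓥.grading q) n ⟨a, ha⟩ := by
    rw [LinearEquiv.symm_apply_eq]
    exact (DirectSum.coeLinearMap_lof 𝓥.grading n ⟨a, ha⟩).symm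
  simp [zeroMode, h]

/-- `h` is the smallest weight in its coset modulo `ℤ`. -/
def IsLowest (M : VOAModule 𝓥 W) (h : ℝ) : Prop :=
  M.grading h ≠ ⊥ ∧ ∀ k : ℕ, 0 < k → M.grading (h - k) = ⊥

/-- Such a mode lowers the weight by the positive integer `n - d + 1`, into a space that is zero. -/
theorem IsLowest.eq_zero {M : VOAModule 𝓥 W} {h : ℝ} (H : M.IsLowest h) {d n : ℤ} (hn : d ≤ n)
    {a : V} (ha : a ∈ 𝓥.grading d) {x : W} (hx : x ∈ M.grading h) : M.Y a n x = 0 := by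
  have := M.mode_mem ha n hx
  obtain ⟨k, hk⟩ := Int.eq_ofNat_of_zero_le (sub_nonneg.2 hn)
  have e : h + ((d : ℝ) - n - 1) = h - ((k + 1 : ℕ) : ℝ) := by
    have : (n : ℝ) - d = k := by exact_mod_cast hk
    push_cast
    linarith
  rw [e, H.2 _ k.succ_pos] at this
  simpa using this

/-- In the Jacobi identity with indices `wt a`, `-2`, `wt b`, both sums on the right begin with a
mode that annihilates `x`. The left side is the zero mode of `a ∘ b`. -/
theorem IsLowest.zeroMode_zhuO {M : VOAModule 𝓥 W} {h : ℝ} (H : M.IsLowest h) {x : W}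
    (hx : x ∈ M.grading h) {a : V} (ha : a ∈ 𝓥.zhuO) : M.zeroMode x a = 0 := by
  suffices 𝓥.zhuO ≤ LinearMap.ker (M.zeroMode x) from this ha
  refine Submodule.span_le.2 ?_
  rintro _ ⟨m, n, a, ha, b, hb, rfl⟩
  have hj := M.jacobi a b x m (-2) n
  rw [finsum_eq_zero_of_forall_eq_zero (f := fun l : ℕ =>
      ((-1 : ℂ) ^ l * ((Ring.choose (-2 : ℤ) l : ℤ) : ℂ)) •
        M.Y a (m + -2 - l) (M.Y b (n + l) x)) (fun l => by
        rw [H.eq_zero (by omega) hb hx, map_zero, smul_zero]),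
    finsum_eq_zero_of_forall_eq_zero (f := fun l : ℕ =>
      ((-1 : ℂ) ^ ((l : ℤ) + -2) * ((Ring.choose (-2 : ℤ) l : ℤ) : ℂ)) •
        M.Y b (-2 + n - l) (M.Y a (m + l) x)) (fun l => by
        rw [H.eq_zero (by omega) ha hx, map_zero, smul_zero]), sub_zero] at hj
  change M.zeroMode x (𝓥.zhuCircle m a b) = 0
  rw [VOA.zhuCircle, ← hj, map_finsum (M.zeroMode x)]
  · refine finsum_congr fun l => ?_
    rw [map_smul, M.zeroMode_apply x (𝓥.mode_mem ha _ hb)]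
    rw [show n + m - (-2 + (l : ℤ)) - 1 - 1 = m + n - l by ring]
  · refine (𝓥.finite_mode_ne_zero (a := a) (b := b) (-2)).subset fun l hl h0 => hl ?_
    simp [h0]

/-- In the Jacobi identity with indices `2`, `-1`, `wt b - 1`, the only surviving term on the right
is `L_0 o(b) x`, and `o(b)` preserves the weight. The binomials `1, 2, 1` on the left are the
coefficients in `zhuMul`. -/
theorem IsLowest.zeroMode_zhuMul {M : VOAModule 𝓥 W} {h : ℝ} (H : M.IsLowest h) {x : W}
    (hx : x ∈ M.grading h) (b : V) : M.zeroMode x (𝓥.zhuMul b) = (h : ℂ) • M.zeroMode x b := by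
  induction b using 𝓥.homogeneous_induction with
  | h0 => simp
  | hadd y z hy hz => simp only [map_add, smul_add, hy, hz]
  | hmem n b hb =>
    have hj := M.jacobi 𝓥.ν b x (2 : ℕ) (-1) (n - 1)
    have hν := 𝓥.conformal_mem
    rw [finsum_ringChoose_smul, finsum_eq_single _ 0 (fun l hl => by
        rw [H.eq_zero (by omega) hb hx, map_zero, smul_zero]),
      finsum_eq_zero_of_forall_eq_zero (f := fun l : ℕ =>
      ((-1 : ℂ) ^ ((l : ℤ) + -1) * ((Ring.choose (-1 : ℤ) l : ℤ) : ℂ)) •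
        M.Y b (-1 + (n - 1) - l) (M.Y 𝓥.ν ((2 : ℕ) + l) x)) (fun l => by
        rw [H.eq_zero (by push_cast; omega) hν hx, map_zero, smul_zero]), sub_zero] at hj
    have hmem : M.Y b (n - 1) x ∈ M.grading h := by
      have := M.mode_mem hb (n - 1) hx
      rwa [show h + ((n : ℝ) - (n - 1 : ℤ) - 1) = h by push_cast; ring] at this
    have e := M.energy h _ hmem
    rw [VOA.zhuMul]
    simp only [LinearMap.add_apply, LinearMap.smul_apply, map_add, map_smul]
    rw [M.zeroMode_apply x (𝓥.mode_mem hν _ hb), M.zeroMode_apply x (𝓥.mode_mem hν _ hb),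
      M.zeroMode_apply x (𝓥.mode_mem hν _ hb), M.zeroMode_apply x hb, ← e]
    norm_num [Finset.sum_range_succ] at hj
    rw [← hj]
    have e1 : n + 2 - -1 - 1 - 1 = 2 + (n - 1) := by ring
    have e2 : n + 2 - 0 - 1 - 1 = 2 + (n - 1) - 1 := by ring
    have e3 : n + 2 - 1 - 1 - 1 = n - 1 := by ring
    rw [e1, e2, e3]

/-- The zero mode of `p(zhuMul) Ω` acts on a lowest vector as the scalar `p(h)`, and it vanishes
because it comes from `O(V)`. -/
theorem IsLowest.isRoot {M : VOAModule 𝓥 W} {h : ℝ} (H : M.IsLowest h) {p : Polynomial ℂ}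
    (hp : Polynomial.aeval 𝓥.zhuMul p 𝓥.Ω ∈ 𝓥.zhuO) : p.IsRoot (h : ℂ) := by
  obtain ⟨x, hx, hx0⟩ := Submodule.exists_mem_ne_zero_of_ne_bot H.1
  have hpow : ∀ q : Polynomial ℂ,
      M.zeroMode x (Polynomial.aeval 𝓥.zhuMul q 𝓥.Ω) = q.eval (h : ℂ) • x := by
    have hmon : ∀ k : ℕ, M.zeroMode x ((𝓥.zhuMul ^ k : V →ₗ[ℂ] V) 𝓥.Ω) = (h : ℂ) ^ k • x := by
      intro k
      induction k with
      | zero =>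
        rw [pow_zero, pow_zero, Module.End.one_apply, M.zeroMode_apply x 𝓥.vacuum_mem,
          M.vacuum_mode]
        simp
      | succ k ih =>
        rw [pow_succ', Module.End.mul_apply, H.zeroMode_zhuMul hx, ih, smul_smul, pow_succ']
    intro q
    induction q using Polynomial.induction_on' with
    | add p q hp hq => simp only [map_add, LinearMap.add_apply, hp, hq, Polynomial.eval_add,
        add_smul]
    | monomial k c =>
      rw [Polynomial.aeval_monomial, Polynomial.eval_monomial, ← smul_smul, ← hmon k,
        ← map_smul, Module.algebraMap_end_eq_smul_id]
      rfl
  have := H.zeroMode_zhuO hx hp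
  rw [hpow] at this
  exact (smul_eq_zero.1 this).resolve_right hx0

theorem exists_isLowest (M : VOAModule 𝓥 W) {s : ℝ} (hs : M.grading s ≠ ⊥) :
    ∃ n : ℕ, M.IsLowest (s - n) := by
  obtain ⟨N, hN⟩ := M.lowerBounded
  have hbd : ∀ n : ℕ, M.grading (s - n) ≠ ⊥ → n ≤ ⌈s - N⌉₊ := by
    intro n hn
    by_contra! hc
    refine hn (hN _ ?_)
    have := (Nat.le_ceil (s - N)).trans_lt (Nat.cast_lt.2 hc)
    linarith
  classical
  let n := Nat.findGreatest (fun n => M.grading (s - n) ≠ ⊥) ⌈s - N⌉₊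
  have hn : M.grading (s - n) ≠ ⊥ := Nat.findGreatest_spec
    (P := fun n => M.grading (s - (n : ℕ)) ≠ ⊥) (Nat.zero_le _) (by simpa using hs)
  refine ⟨n, hn, fun k hk => ?_⟩
  by_contra hc
  rw [sub_sub, ← Nat.cast_add] at hc
  have := Nat.le_findGreatest (P := fun n => M.grading (s - (n : ℕ)) ≠ ⊥) (hbd _ hc) hc
  exact absurd this (by change ¬ n + k ≤ n; omega)

theorem exists_grading_ne_bot (M : VOAModule 𝓥 W) [Nontrivial W] : ∃ s, M.grading s ≠ ⊥ := by
  by_contra! hc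
  have := M.internal.submodule_iSup_eq_top
  rw [iSup_congr hc, iSup_bot] at this
  exact bot_ne_top this

/-- The infimum defining the conformal weight ranges over real weights, so it must be shown to be
attained. Every weight lies above a lowest one in its coset, and the lowest ones are among the
finitely many roots of `p`. -/
theorem isRoot_conformalWeight (M : VOAModule 𝓥 W) [Nontrivial W] {p : Polynomial ℂ} (hp0 : p ≠ 0)
    (hp : Polynomial.aeval 𝓥.zhuMul p 𝓥.Ω ∈ 𝓥.zhuO) : p.IsRoot (M.conformalWeight : ℂ) := by
  have hfin : {h : ℝ | M.IsLowest h}.Finite := by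
    have h1 : {z : ℂ | p.IsRoot z}.Finite := Polynomial.finite_setOfPred_isRoot hp0
    exact (h1.preimage Complex.ofReal_injective.injOn).subset fun h H => H.isRoot hp
  obtain ⟨s, hs⟩ := M.exists_grading_ne_bot
  obtain ⟨n, hn⟩ := M.exists_isLowest hs
  obtain ⟨h, hh, hmin⟩ := Set.exists_min_image _ id hfin ⟨_, hn⟩
  have : IsLeast {s | M.grading s ≠ ⊥} h := by
    refine ⟨hh.1, fun q hq => ?_⟩
    obtain ⟨k, hk⟩ := M.exists_isLowest hq
    have := hmin _ hk
    simp only [id] at this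
    have : (0 : ℝ) ≤ k := k.cast_nonneg
    linarith
  rw [conformalWeight, this.csInf_eq]
  exact IsLowest.isRoot hh hp

end VOAModule

/-- The conformal weights of the irreducible modules of `V`. -/
def VOA.conformalWeights {V : Type u} [AddCommGroup V] [Module ℂ V] (𝓥 : VOA V) : Set ℝ :=
  {h | ∃ (W : Type v) (_ : AddCommGroup W) (_ : Module ℂ W)
    (M : VOAModule 𝓥 W), M.IsIrreducible ∧ M.conformalWeight = h}

theorem VOA.IsC2Cofinite.finite_conformalWeights {V : Type u} [AddCommGroup V] [Module ℂ V]
    {𝓥 : VOA V} (h : 𝓥.IsC2Cofinite) : (VOA.conformalWeights.{u, v} 𝓥).Finite := by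
  obtain ⟨p, hp0, hp⟩ := h.exists_polynomial
  refine ((Polynomial.finite_setOfPred_isRoot hp0).preimage
    Complex.ofReal_injective.injOn).subset ?_
  rintro _ ⟨W, _, _, M, ⟨hW, _⟩, rfl⟩
  exact M.isRoot_conformalWeight hp0 hp

theorem VOA.mem_exponents {V : Type u} [AddCommGroup V] [Module ℂ V] (𝓥 : VOA V) {s : ℝ} :
    s ∈ VOA.exponents.{u, v} 𝓥 ↔ ∃ a ∈ VOA.conformalWeights.{u, v} 𝓥,
      ∃ b ∈ VOA.conformalWeights.{u, v} 𝓥, ∃ c ∈ VOA.conformalWeights.{u, v} 𝓥,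
      ∃ n : ℤ, s = n + (a + b - c) := Iff.rfl

/-! ## Weights of unitary modules -/

namespace VOAModule

variable {V : Type u} [AddCommGroup V] [Module ℂ V] {𝓥 : VOA V}
  {W : Type v} [AddCommGroup W] [Module ℂ W]

theorem sum_P (M : VOAModule 𝓥 W) {F : Finset ℝ} {x : W} (hF : ∀ s ∉ F, M.P s x = 0) :
    ∑ s ∈ F, M.P s x = x := by
  apply M.eq_of_P
  intro q
  rw [map_sum]
  by_cases hq : q ∈ F
  · rw [Finset.sum_eq_single_of_mem q hq, M.P_of_mem (M.P_mem q x)]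
    intro b _ hb
    exact M.P_of_ne (M.P_mem b x) (Ne.symm hb)
  · rw [hF q hq, Finset.sum_eq_zero]
    intro b hb
    refine M.P_of_ne (M.P_mem b x) ?_
    rintro rfl
    exact hq hb

/-- Applying `L_0 - a` removes the component of weight `a` and rescales each other component by a
nonzero factor. Induction on the support then isolates the components inside `S`. -/
theorem P_mem_of_invariant (M : VOAModule 𝓥 W) {S : Submodule ℂ W}
    (hS : ∀ x ∈ S, M.Y 𝓥.ν 1 x ∈ S) {x : W} (hx : x ∈ S) (s : ℝ) : M.P s x ∈ S := by
  have key : ∀ (F : Finset ℝ) (x : W), x ∈ S → (∀ q ∉ F, M.P q x = 0) → ∀ s, M.P s x ∈ S := by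
    intro F
    induction F using Finset.induction_on with
    | empty => intro x _ h s; rw [h s (Finset.notMem_empty s)]; exact S.zero_mem
    | insert a F ha ih =>
      intro x hx h
      let y := M.Y 𝓥.ν 1 x - (a : ℂ) • x
      have hyP : ∀ q, M.P q y = ((q : ℂ) - a) • M.P q x := by
        intro q
        simp only [y, map_sub, map_smul, M.P_L0, sub_smul]
      have hy := ih y (S.sub_mem (hS x hx) (S.smul_mem _ hx)) (fun q hq => by
        rw [hyP]
        by_cases hqa : q = a
        · simp [hqa]
        · rw [h q (by simp [hqa, hq]), smul_zero])
      have hne : ∀ q, q ≠ a → M.P q x ∈ S := by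
        intro q hq
        have h1 := hy q
        rw [hyP] at h1
        have h0 : (q : ℂ) - a ≠ 0 := sub_ne_zero.2 (by exact_mod_cast hq)
        simpa [smul_smul, inv_mul_cancel₀ h0] using S.smul_mem ((q : ℂ) - a)⁻¹ h1
      intro s
      by_cases hs : s = a
      · subst hs
        have e := M.sum_P h
        rw [Finset.sum_insert ha] at e
        rw [eq_sub_of_add_eq e]
        refine S.sub_mem hx (S.sum_mem fun q hq => hne q ?_)
        rintro rfl
        exact ha hq
      · exact hne s hs
  exact key (M.finite_support_P x).toFinset x hx (fun q hq => by simpa using hq) s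

/-- The restriction of the module structure to an invariant subspace. -/
def restrict (M : VOAModule 𝓥 W) (S : Submodule ℂ W)
    (hS : ∀ (a : V) (n : ℤ), ∀ x ∈ S, M.Y a n x ∈ S) : VOAModule 𝓥 S where
  grading s := (M.grading s).comap S.subtype
  internal := by
    rw [DirectSum.isInternal_submodule_iff_iSupIndep_and_iSup_eq_top]
    constructor
    · intro s
      rw [disjoint_iff_inf_le]
      rintro x ⟨hx1, hx2⟩
      have h1 : (x : W) ∈ ⨆ (q) (_ : q ≠ s), M.grading q := by
        have := Submodule.mem_map_of_mem (f := S.subtype) hx2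
        simp only [Submodule.map_iSup] at this
        exact (iSup₂_mono fun q _ => Submodule.map_comap_le _ _) this
      have := (M.internal.submodule_iSupIndep s).le_bot ⟨hx1, h1⟩
      exact Subtype.ext this
    · rw [← top_le_iff]
      rintro x -
      have hP : ∀ s, M.P s x ∈ S := M.P_mem_of_invariant (hS 𝓥.ν 1) x.2
      have e := M.sum_P (F := (M.finite_support_P x).toFinset) (x := x)
        (fun q hq => by simpa using hq)
      have e' : x = ∑ s ∈ (M.finite_support_P x).toFinset, (⟨M.P s x, hP s⟩ : S) := by
        apply Subtype.ext
        rw [← S.subtype_apply (∑ s ∈ _, _), map_sum]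
        exact e.symm
      rw [e']
      exact Submodule.sum_mem _ fun s _ => Submodule.mem_iSup_of_mem s (M.P_mem s x)
  finiteDim s := by
    have := M.finiteDim s
    exact Module.Finite.of_injective
      (S.subtype.restrict (p := (M.grading s).comap S.subtype) (q := M.grading s)
        (fun x hx => hx)) (fun a b h => by
          have := congrArg (fun z : M.grading s => (z : W)) h
          exact Subtype.ext (Subtype.ext this))
  lowerBounded := by
    obtain ⟨N, hN⟩ := M.lowerBounded
    refine ⟨N, fun s hs => ?_⟩
    rw [hN s hs, eq_bot_iff]
    intro x hx
    exact Subtype.ext hx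
  Y :=
    { toFun := fun a n => (M.Y a n).restrict (hS a n)
      map_add' := by intros; ext; simp
      map_smul' := by intros; ext; simp }
  truncation := by
    intro a x
    obtain ⟨N, hN⟩ := M.truncation a x
    exact ⟨N, fun n hn => Subtype.ext (hN n hn)⟩
  jacobi := by
    intro a b x m n h
    apply Subtype.ext
    -- Injectivity of the inclusion preserves supports, so it commutes with `finsum` without any
    -- finiteness check.
    have hf : ∀ F : ℕ → S, ((∑ᶠ l, F l : S) : W) = ∑ᶠ l, (F l : W) := fun F =>
      S.subtype.toAddMonoidHom.map_finsum_of_injective Subtype.val_injective F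
    simpa [hf] using M.jacobi a b x m n h
  vacuum_mode := by
    intro n x
    apply Subtype.ext
    have := M.vacuum_mode n x
    split_ifs at this ⊢ <;> simpa using this
  virasoro := by
    intro m n x
    apply Subtype.ext
    have := M.virasoro m n x
    split_ifs at this ⊢ <;> simpa using this
  energy := by
    intro s x hx
    apply Subtype.ext
    simpa using M.energy s x hx
  translation := by
    intro a n x
    apply Subtype.ext
    simpa using M.translation a n x

/-- The span of the weight spaces `W(h + k)`, `k ∈ ℕ`, is invariant if `h` is lowest. -/
theorem iSup_coset_invariant (M : VOAModule 𝓥 W) {h : ℝ} (H : M.IsLowest h) (a : V) (n : ℤ)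
    {x : W} (hx : x ∈ ⨆ k : ℕ, M.grading (h + k)) :
    M.Y a n x ∈ ⨆ k : ℕ, M.grading (h + k) := by
  induction a using 𝓥.homogeneous_induction with
  | h0 => simp
  | hadd y z hy hz => simpa using Submodule.add_mem _ hy hz
  | hmem d a ha =>
    suffices (⨆ k : ℕ, M.grading (h + k)) ≤ (⨆ k : ℕ, M.grading (h + k)).comap (M.Y a n) from
      this hx
    refine iSup_le fun k x hx => ?_
    have hm := M.mode_mem ha n hx
    rcases le_or_gt 0 ((k : ℤ) + d - n - 1) with h0 | h0
    · obtain ⟨l, hl⟩ := Int.eq_ofNat_of_zero_le h0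
      have e : h + k + ((d : ℝ) - n - 1) = h + l := by
        have : (k : ℝ) + d - n - 1 = l := by exact_mod_cast hl
        linarith
      rw [e] at hm
      exact Submodule.mem_iSup_of_mem l hm
    · obtain ⟨l, hl⟩ := Int.eq_ofNat_of_zero_le (neg_nonneg.2 h0.le)
      have e : h + k + ((d : ℝ) - n - 1) = h - l := by
        have : -((k : ℝ) + d - n - 1) = l := by exact_mod_cast hl
        linarith
      rw [e, H.2 l (by omega)] at hm
      rw [Submodule.mem_comap, (Submodule.mem_bot ℂ).1 hm]
      exact Submodule.zero_mem _

end VOAModule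

namespace UnitaryModule

variable {V : Type u} [NormedAddCommGroup V] [InnerProductSpace ℂ V] {𝓥 : UnitaryVOA V}
  {W : Type v} [NormedAddCommGroup W] [InnerProductSpace ℂ W]

theorem L_one_conformal (𝓥 : UnitaryVOA V) : 𝓥.L 1 𝓥.ν = 0 := by
  have h := 𝓥.virasoro 1 (-2) 𝓥.Ω
  have h1 := 𝓥.creation 𝓥.ν
  have h2 := 𝓥.creation_zero 𝓥.ν 2 (by norm_num)
  have h3 := 𝓥.creation_zero 𝓥.ν 0 (by norm_num)
  norm_num [h1, h2, h3] at h
  exact h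

/-- `L_{-n}` is the adjoint of `L_n`. -/
theorem inner_L (M : UnitaryModule 𝓥 W) (n : ℤ) (a b : W) :
    inner ℂ b (M.L n a) = inner ℂ (M.L (-n) b) a := by
  have h := M.unitary 2 𝓥.ν 𝓥.conformal_mem (n + 1) a b
  rw [finsum_eq_single _ 0] at h
  · rw [VOAModule.L, VOAModule.L, h]
    have e : 2 * 2 - (0 : ℕ) - (n + 1) - 2 = -n + 1 := by push_cast; ring
    rw [e]
    norm_num [𝓥.θ_conformal]
  · intro m hm
    obtain ⟨k, rfl⟩ := Nat.exists_eq_succ_of_ne_zero hm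
    simp [𝓥.θ_conformal, pow_succ, L_one_conformal]

/-- Unitarity writes the adjoint of a mode as a combination of modes, and these preserve `T`. -/
theorem orthogonal_invariant (M : UnitaryModule 𝓥 W) {T : Submodule ℂ W}
    (hT : ∀ (a : V) (n : ℤ), ∀ x ∈ T, M.Y a n x ∈ T) (a : V) (n : ℤ) {x : W} (hx : x ∈ Tᗮ) :
    M.Y a n x ∈ Tᗮ := by
  induction a using 𝓥.homogeneous_induction with
  | h0 => simp
  | hadd y z hy hz => simpa using Tᗮ.add_mem hy hz
  | hmem d a ha =>
    intro y hy
    rw [M.unitary d a ha]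
    refine hx _ ?_
    exact finsum_induction (· ∈ T) T.zero_mem (fun _ _ => T.add_mem)
      fun m => T.smul_mem _ (hT _ _ _ hy)

theorem eq_zero_of_orthogonal (M : UnitaryModule 𝓥 W) {h : ℝ} {x : W} (hx : M.P h x = 0) :
    x ∈ (M.grading h)ᗮ := by
  intro y hy
  rw [← M.sum_P (F := (M.finite_support_P x).toFinset) (x := x) (fun q hq => by simpa using hq),
    inner_sum]
  refine Finset.sum_eq_zero fun q hq => M.inner_eq_zero ?_ (M.P_mem q x) hy
  rintro rfl
  simp [hx] at hq

/-- Every weight of a unitary module is congruent modulo `ℤ` to the conformal weight of an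
irreducible module. -/
theorem exists_conformalWeight (M : UnitaryModule 𝓥 W) {s : ℝ} (hs : M.grading s ≠ ⊥) :
    ∃ h ∈ VOA.conformalWeights.{u, v} 𝓥.toVOA, ∃ n : ℤ, s = h + n := by
  obtain ⟨n₀, H⟩ := M.exists_isLowest hs
  set h : ℝ := s - n₀ with hh
  have := M.finiteDim h
  let Inv : Submodule ℂ W → Prop := fun S => ∀ (a : V) (n : ℤ), ∀ x ∈ S, M.Y a n x ∈ S
  -- An irreducible submodule is sought through the finite dimensional space `W(h)`: take an
  -- invariant subspace whose intersection `U` with `W(h)` is nonzero of least dimension, then the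
  -- invariant subspace `S` generated by `U`.
  let D : Set ℕ := {d | ∃ S, Inv S ∧ S ⊓ M.grading h ≠ ⊥ ∧
    Module.finrank ℂ (S ⊓ M.grading h : Submodule ℂ W) = d}
  have hD : D.Nonempty := ⟨_, ⊤, fun _ _ _ _ => trivial, by simpa using H.1, rfl⟩
  obtain ⟨S₀, hS₀, hS₀ne, hS₀d⟩ := Nat.sInf_mem hD
  set U : Submodule ℂ W := S₀ ⊓ M.grading h
  let S : Submodule ℂ W := sInf {T | Inv T ∧ U ≤ T}
  have hSinv : Inv S := by
    intro a n x hx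
    simp only [S, Submodule.mem_sInf] at hx ⊢
    exact fun T hT => hT.1 a n x (hx T hT)
  have hUS : U ≤ S := le_sInf fun T hT => hT.2
  have hSle : ∀ T, Inv T → U ≤ T → S ≤ T := fun T h1 h2 => sInf_le ⟨h1, h2⟩
  -- If `T` misses `W(h)`, its orthogonal complement is invariant and contains `U`, hence `S`, so
  -- `T` is orthogonal to itself. Otherwise minimality forces `T` to contain `U`, hence `S`.
  have hirr : ∀ T ≤ S, Inv T → T = ⊥ ∨ T = S := by
    intro T hTS hT
    by_cases hTh : T ⊓ M.grading h = ⊥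
    · left
      have hTP : ∀ x ∈ T, M.P h x = 0 := by
        intro x hx
        have : M.P h x ∈ T ⊓ M.grading h :=
          ⟨M.P_mem_of_invariant (hT 𝓥.ν 1) hx h, M.P_mem h x⟩
        rwa [hTh, Submodule.mem_bot] at this
      have hUT : U ≤ Tᗮ := by
        intro y hy x hx
        exact inner_eq_zero_symm.1 (M.eq_zero_of_orthogonal (hTP x hx) y hy.2)
      have hST : S ≤ Tᗮ := hSle _ (fun a n x hx => M.orthogonal_invariant hT a n hx) hUT
      rw [eq_bot_iff]
      intro x hx
      exact inner_self_eq_zero.1 (hST (hTS hx) x hx)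
    · right
      refine le_antisymm hTS (hSle T hT ?_)
      have hTU : T ⊓ M.grading h ≤ U := by
        refine inf_le_inf_right _ (hTS.trans (hSle S₀ hS₀ inf_le_left))
      have hfd : FiniteDimensional ℂ U := Submodule.finiteDimensional_of_le inf_le_right
      have hle : Module.finrank ℂ U ≤ Module.finrank ℂ (T ⊓ M.grading h : Submodule ℂ W) := by
        rw [hS₀d]
        exact Nat.sInf_le ⟨T, hT, hTh, rfl⟩
      rw [← Submodule.eq_of_le_of_finrank_le hTU hle]
      exact inf_le_left
  obtain ⟨x₀, hx₀, hx₀ne⟩ := Submodule.exists_mem_ne_zero_of_ne_bot hS₀ne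
  let N := M.toVOAModule.restrict S hSinv
  have hN : N.IsIrreducible := by
    refine ⟨⟨⟨⟨x₀, hUS hx₀⟩, 0, fun e => hx₀ne (congrArg Subtype.val e)⟩⟩, fun T hT => ?_⟩
    have hTS : T.map S.subtype ≤ S := Submodule.map_subtype_le S T
    rcases hirr (T.map S.subtype) hTS (by
      rintro a n _ ⟨y, hy, rfl⟩
      exact ⟨_, hT a n y hy, rfl⟩) with e | e
    · left
      exact Submodule.map_injective_of_injective (Submodule.subtype_injective S)
        (by rw [e, Submodule.map_bot])
    · right
      rw [eq_top_iff]
      intro y _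
      have : (y : W) ∈ T.map S.subtype := by rw [e]; exact y.2
      obtain ⟨z, hz, hzy⟩ := this
      rwa [← Subtype.ext hzy]
  refine ⟨h, ⟨S, _, _, N, hN, ?_⟩, n₀, by simp [hh]⟩
  refine IsLeast.csInf_eq ⟨?_, ?_⟩
  · exact (Submodule.ne_bot_iff _).2 ⟨⟨x₀, hUS hx₀⟩, hx₀.2, fun e => hx₀ne (congrArg Subtype.val e)⟩
  · intro q hq
    obtain ⟨y, hy, hy0⟩ := Submodule.exists_mem_ne_zero_of_ne_bot hq
    -- `S` is generated from `W(h)` and `h` is lowest in its coset, so only the weights `h + k`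
    -- occur in `S`; its conformal weight is therefore `h`.
    have hyC : (y : W) ∈ ⨆ k : ℕ, M.grading (h + k) := by
      refine hSle _ (fun a n x hx => M.iSup_coset_invariant H a n hx) ?_ y.2
      refine inf_le_right.trans ?_
      have := le_iSup (fun k : ℕ => M.grading (h + k)) 0
      simpa using this
    by_contra hlt
    have hker : (⨆ k : ℕ, M.grading (h + k)) ≤ LinearMap.ker (M.P q) := by
      refine iSup_le fun k x hx => M.P_of_ne hx ?_
      have : (0 : ℝ) ≤ k := k.cast_nonneg
      intro e
      linarith
    have h0 : M.P q (y : W) = 0 := hker hyC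
    exact hy0 (Subtype.ext ((M.P_of_mem hy).symm.trans h0))

/-! ### Positivity of the energy and the size of `L_1` -/

theorem L_mem (M : UnitaryModule 𝓥 W) (n : ℤ) {q : ℝ} {x : W} (hx : x ∈ M.grading q) :
    M.L n x ∈ M.grading (q - n) := by
  have := M.mode_mem 𝓥.conformal_mem (n + 1) hx
  rwa [show q + ((2 : ℤ) - (n + 1 : ℤ) - 1 : ℝ) = q - n by push_cast; ring] at this

/-- `L_1` and `L_{-1}` are mutually adjoint and `[L_1, L_{-1}] = 2 L_0`. -/
theorem norm_sq_L_neg_one (M : UnitaryModule 𝓥 W) {q : ℝ} {x : W} (hx : x ∈ M.grading q) :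
    ‖M.L (-1) x‖ ^ 2 = ‖M.L 1 x‖ ^ 2 + 2 * q * ‖x‖ ^ 2 := by
  have h := M.virasoro 1 (-1) x
  have e := M.energy q x hx
  norm_num [e] at h
  have h1 : M.L 1 (M.L (-1) x) = M.L (-1) (M.L 1 x) + (2 * q : ℂ) • x := by
    rw [← sub_eq_iff_eq_add', mul_smul, two_smul ℂ ((q : ℂ) • x), ← two_nsmul]
    simpa [VOAModule.L, two_smul] using h
  have a1 := M.inner_L 1 (M.L (-1) x) x
  have a2 := M.inner_L (-1) (M.L 1 x) x
  rw [neg_neg] at a2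
  rw [h1, inner_add_right, a2, inner_smul_right, inner_self_eq_norm_sq_to_K,
    inner_self_eq_norm_sq_to_K, inner_self_eq_norm_sq_to_K] at a1
  have := a1.symm
  simp only [Complex.coe_algebraMap] at this
  exact_mod_cast this

/-- On the lowest weight `q` of the coset `L_1` vanishes, so `2q ‖x‖² = ‖L_{-1} x‖²`. -/
theorem weight_nonneg (M : UnitaryModule 𝓥 W) {s : ℝ} (hs : M.grading s ≠ ⊥) : 0 ≤ s := by
  obtain ⟨n, H⟩ := M.exists_isLowest hs
  obtain ⟨x, hx, hx0⟩ := Submodule.exists_mem_ne_zero_of_ne_bot H.1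
  have h1 : M.L 1 x = 0 := by
    have := M.L_mem 1 hx
    have e : s - n - ((1 : ℤ) : ℝ) = s - n - ((1 : ℕ) : ℝ) := by norm_num
    rw [e, H.2 1 one_pos] at this
    exact this
  have := M.norm_sq_L_neg_one hx
  rw [h1] at this
  have hpos : 0 < ‖x‖ ^ 2 := by positivity
  have : 0 ≤ s - n := by
    have h2 := sq_nonneg ‖M.L (-1) x‖
    rw [this, norm_zero, zero_pow two_ne_zero, zero_add] at h2
    have := nonneg_of_mul_nonneg_left h2 hpos
    linarith
  have : (0 : ℝ) ≤ n := n.cast_nonneg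
  linarith

/-- Induction on the weight. For `y = L_1 x` the inductive bound gives `‖L_{-1} y‖² ≤ ((q-1)² +
2(q-1)) ‖y‖² ≤ q² ‖y‖²`, and `‖y‖²` is the inner product of `x` with `L_{-1} y`. -/
theorem norm_L_one_le (M : UnitaryModule 𝓥 W) {q : ℝ} {x : W} (hx : x ∈ M.grading q) :
    ‖M.L 1 x‖ ≤ |q| * ‖x‖ := by
  have zero_of_neg : ∀ {q : ℝ} {x : W}, x ∈ M.grading q → q < 0 → x = 0 := by
    intro q x hx hq
    by_contra h0
    exact absurd (M.weight_nonneg ((Submodule.ne_bot_iff _).2 ⟨x, hx, h0⟩)) (not_le.2 hq)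
  have key : ∀ n : ℕ, ∀ q : ℝ, q < n → ∀ x ∈ M.grading q, ‖M.L 1 x‖ ≤ |q| * ‖x‖ := by
    intro n
    induction n with
    | zero =>
      intro q hq x hx
      rw [zero_of_neg hx (by simpa using hq)]
      simp
    | succ n ih =>
      intro q hq x hx
      rcases lt_or_ge q 0 with h0 | h0
      · rw [zero_of_neg hx h0]
        simp
      set y := M.L 1 x with hy
      have hym : y ∈ M.grading (q - 1) := by simpa using M.L_mem 1 hx
      by_cases hy0 : y = 0
      · rw [hy0, norm_zero]; positivity
      have hq1 : 0 ≤ q - 1 := M.weight_nonneg ((Submodule.ne_bot_iff _).2 ⟨y, hym, hy0⟩)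
      have h1 := ih (q - 1) (by push_cast at hq; linarith) y hym
      have h2 := M.norm_sq_L_neg_one hym
      rw [abs_of_nonneg hq1] at h1
      have h3 : ‖M.L (-1) y‖ ≤ q * ‖y‖ := by
        refine abs_le_of_sq_le_sq' ?_ (by positivity) |>.2
        have : ‖M.L 1 y‖ ^ 2 ≤ ((q - 1) * ‖y‖) ^ 2 := by gcongr
        rw [h2]
        nlinarith [sq_nonneg ‖y‖]
      have h4 : ‖y‖ ^ 2 ≤ ‖x‖ * ‖M.L (-1) y‖ := by
        have e : inner ℂ y y = inner ℂ (M.L (-1) y) x := M.inner_L 1 x y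
        have := norm_inner_le_norm (𝕜 := ℂ) (M.L (-1) y) x
        rw [← e, inner_self_eq_norm_sq_to_K] at this
        simp only [norm_pow] at this
        rw [mul_comm ‖x‖]
        simpa using this
      have hypos : 0 < ‖y‖ := norm_pos_iff.2 hy0
      rw [abs_of_nonneg h0]
      have : ‖y‖ * ‖y‖ ≤ (q * ‖x‖) * ‖y‖ := by
        calc ‖y‖ * ‖y‖ = ‖y‖ ^ 2 := by ring
          _ ≤ ‖x‖ * ‖M.L (-1) y‖ := h4
          _ ≤ ‖x‖ * (q * ‖y‖) := by gcongr
          _ = _ := by ring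
      exact le_of_mul_le_mul_right this hypos
  exact key (⌊q⌋₊ + 1) q (by simpa using Nat.lt_floor_add_one q) x hx

end UnitaryModule

/-! ## Fourier modes of test functions -/

/-- Integration by parts against an exponential. -/
theorem exists_norm_pow_mul_integral_le (k : ℕ) (φ : ℝ → ℂ) (a b : ℝ) (hab : a ≤ b)
    (hφ : ContDiff ℝ ∞ φ)
    (ha : φ =ᶠ[nhds a] 0) (hb : φ =ᶠ[nhds b] 0) :
    ∃ C, ∀ s : ℝ, |s| ^ k * ‖∫ x in a..b, φ x * Complex.exp (-(Complex.I * s * x))‖ ≤ C := by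
  induction k generalizing φ with
  | zero =>
    refine ⟨∫ x in a..b, ‖φ x‖, fun s => ?_⟩
    rw [pow_zero, one_mul]
    refine (intervalIntegral.norm_integral_le_integral_norm hab).trans (le_of_eq ?_)
    refine intervalIntegral.integral_congr fun x _ => ?_
    have : -(Complex.I * s * x) = ((-(s * x) : ℝ) : ℂ) * Complex.I := by push_cast; ring
    simp only [norm_mul]
    rw [this, Complex.norm_exp_ofReal_mul_I, mul_one]
  | succ k ih =>
    have hd : ContDiff ℝ ∞ (deriv φ) := ((contDiff_infty_iff_deriv (𝕜 := ℝ)).1 hφ).2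
    obtain ⟨C, hC⟩ := ih (deriv φ) hd (ha.deriv.trans (by simp [Filter.EventuallyEq.refl]))
      (hb.deriv.trans (by simp [Filter.EventuallyEq.refl]))
    refine ⟨C, fun s => ?_⟩
    by_cases hs : s = 0
    · subst hs
      have h0 := hC 0
      simp only [abs_zero, ne_eq, Nat.add_eq_zero_iff, one_ne_zero, and_false, not_false_eq_true,
        zero_pow, zero_mul]
      exact (by positivity : (0 : ℝ) ≤ _).trans h0
    · have hs' : (Complex.I * s : ℂ) ≠ 0 := mul_ne_zero Complex.I_ne_zero (by exact_mod_cast hs)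
      have hv : ∀ x : ℝ, HasDerivAt (fun x : ℝ => Complex.exp (-(Complex.I * s * x)))
          (-(Complex.I * s) * Complex.exp (-(Complex.I * s * x))) x := by
        intro x
        have h1 : HasDerivAt (fun x : ℝ => -(Complex.I * s * (x : ℂ))) (-(Complex.I * s)) x := by
          have := (hasDerivAt_id x).ofReal_comp.const_mul (-(Complex.I * s))
          simpa only [id, Complex.ofReal_one, mul_one, neg_mul] using this
        rw [mul_comm (-(Complex.I * s))]
        exact h1.cexp
      have hu : ∀ x, HasDerivAt φ (deriv φ x) x := fun x =>
        ((hφ.differentiable (by simp)) x).hasDerivAt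
      have hparts := intervalIntegral.integral_mul_deriv_eq_deriv_mul (a := a) (b := b)
        (fun x _ => hu x) (fun x _ => hv x)
        (hd.continuous.intervalIntegrable _ _)
        ((by fun_prop : Continuous fun x : ℝ =>
          -(Complex.I * s) * Complex.exp (-(Complex.I * s * x))).intervalIntegrable _ _)
      -- The boundary terms vanish because `φ` does at both ends. Periodicity could not replace
      -- this, since `s` is not restricted to integers.
      rw [ha.eq_of_nhds, hb.eq_of_nhds] at hparts
      simp only [Pi.zero_apply, zero_mul, sub_self, zero_sub] at hparts
      have e : (Complex.I * s) * ∫ x in a..b, φ x * Complex.exp (-(Complex.I * s * x))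
          = ∫ x in a..b, deriv φ x * Complex.exp (-(Complex.I * s * x)) := by
        rw [← neg_eq_iff_eq_neg] at hparts
        rw [← hparts, ← intervalIntegral.integral_const_mul, ← intervalIntegral.integral_neg]
        congr 1
        funext x
        ring
      have := hC s
      rw [← e, norm_mul, norm_mul, Complex.norm_I, one_mul, Complex.norm_real, Real.norm_eq_abs,
        ← mul_assoc, ← pow_succ] at this
      exact this

/-- A choice of representatives embeds `S` into `F × ℤ`, where each of the finitely many rows is
dominated by `∑ 1/n²`. -/
theorem summable_inv_one_add_abs_sq {F : Set ℝ} (hF : F.Finite) {S : Set ℝ}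
    (hS : ∀ s ∈ S, ∃ a ∈ F, ∃ n : ℤ, s = n + a) :
    Summable fun s : S => ((1 + |(s : ℝ)|) ^ 2)⁻¹ := by
  choose a haF n hn using hS
  have : Fintype F := hF.fintype
  let g : S → F × ℤ := fun s => (⟨a s s.2, haF s s.2⟩, n s s.2)
  have hg : Function.Injective g := by
    intro s s' h
    apply Subtype.ext
    rw [hn s s.2, hn s' s'.2]
    have h1 := congrArg (fun z => ((z.1 : F) : ℝ)) h
    have h2 := congrArg (fun z => z.2) h
    simp only [g] at h1 h2
    rw [h1, h2]
  have hsum : Summable fun z : F × ℤ => ((1 + |(z.2 : ℝ) + z.1|) ^ 2)⁻¹ := by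
    rw [← (Equiv.sigmaEquivProd F ℤ).summable_iff]
    refine (summable_sigma_of_nonneg (fun _ => inv_nonneg.2 (sq_nonneg _))).2 ⟨fun x => ?_,
      Summable.of_finite⟩
    have h1 : Summable fun n : ℤ => 1 / (n : ℝ) ^ 2 :=
      Real.summable_one_div_int_pow.2 one_lt_two
    refine Summable.of_norm_bounded_eventually (h1.mul_left ((1 + |(x : ℝ)|) ^ 2)) ?_
    have : ∀ᶠ n : ℤ in Filter.cofinite, n ≠ 0 := by
      simpa using (Set.finite_singleton (0 : ℤ)).compl_mem_cofinite
    filter_upwards [this] with n hn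
    have hn0 : (0 : ℝ) < |(n : ℝ)| := abs_pos.2 (by exact_mod_cast hn)
    simp only [Equiv.sigmaEquivProd_apply]
    rw [Real.norm_of_nonneg (by positivity), ← sq_abs (n : ℝ), mul_one_div,
      inv_le_comm₀ (by positivity) (by positivity), inv_div, div_le_iff₀ (by positivity),
      ← mul_pow]
    gcongr
    have : |(n : ℝ)| ≤ |(n : ℝ) + x| + |(x : ℝ)| := by
      simpa using abs_sub ((n : ℝ) + x) x
    nlinarith [abs_nonneg ((n : ℝ) + x), abs_nonneg (x : ℝ)]
  have := hsum.comp_injective hg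
  refine this.congr fun s => ?_
  simp only [Function.comp, g]
  rw [← hn s s.2]

namespace TestFun

theorem eventuallyEq_zero (f : TestFun) {t : ℝ} (ht : Circle.exp t = -1) :
    (fun t : ℝ => f.toFun (Circle.exp t)) =ᶠ[nhds t] 0 := by
  have h1 : f.toFun =ᶠ[nhds (Circle.exp t)] 0 := by
    rw [ht]
    exact notMem_tsupport_iff_eventuallyEq.1 f.support'
  exact (Circle.exp.continuous.tendsto t).eventually h1

theorem circle_exp_pi : Circle.exp Real.pi = -1 := by
  apply Circle.ext
  simp [Complex.exp_pi_mul_I]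

theorem circle_exp_neg_pi : Circle.exp (-Real.pi) = -1 := by
  rw [Circle.exp_neg, circle_exp_pi, inv_neg, inv_one]

theorem exists_mode_le (f : TestFun) (k : ℕ) :
    ∃ C, ∀ s : ℝ, (1 + |s|) ^ k * ‖f.mode s‖ ≤ C := by
  have key : ∀ k : ℕ, ∃ C, ∀ s : ℝ, |s| ^ k * ‖f.mode s‖ ≤ C := by
    intro k
    obtain ⟨C, hC⟩ := exists_norm_pow_mul_integral_le k
      (fun t => f.toFun (Circle.exp t) * (1 / (2 * Real.pi))) (-Real.pi) Real.pi
      (by linarith [Real.pi_pos]) (f.smooth'.mul contDiff_const)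
      ((f.eventuallyEq_zero circle_exp_neg_pi).mono fun t ht => by simp [ht])
      ((f.eventuallyEq_zero circle_exp_pi).mono fun t ht => by simp [ht])
    refine ⟨C, fun s => ?_⟩
    have e : f.mode s = ∫ x in (-Real.pi)..Real.pi, f.toFun (Circle.exp x) *
        (1 / (2 * Real.pi)) * Complex.exp (-(Complex.I * s * x)) := by
      rw [mode]
      congr 1
      funext t
      ring
    rw [e]
    exact hC s
  choose C hC using key
  refine ⟨∑ l ∈ Finset.range (k + 1), (k.choose l : ℝ) * C (k - l), fun s => ?_⟩
  rw [add_pow, Finset.sum_mul]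
  refine Finset.sum_le_sum fun l _ => ?_
  have := mul_le_mul_of_nonneg_left (hC (k - l) s) (Nat.cast_nonneg (α := ℝ) (k.choose l))
  calc _ = (k.choose l : ℝ) * (|s| ^ (k - l) * ‖f.mode s‖) := by ring
    _ ≤ _ := this

theorem summable_mode (f : TestFun) (q : ℝ) {F : Set ℝ} (hF : F.Finite) {S : Set ℝ}
    (hS : ∀ s ∈ S, ∃ a ∈ F, ∃ n : ℤ, s = n + a) :
    Summable fun s : S => (1 + |(s : ℝ)|) ^ q * ‖f.mode s‖ := by
  -- Two powers beyond `q` are kept for the summable factor `(1+|s|)^(-2)`.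
  obtain ⟨C, hC⟩ := f.exists_mode_le (⌈q⌉₊ + 2)
  refine Summable.of_nonneg_of_le (fun s => by positivity) (fun s => ?_)
    ((summable_inv_one_add_abs_sq hF hS).mul_left C)
  have h1 : (1 : ℝ) ≤ 1 + |(s : ℝ)| := by linarith [abs_nonneg (s : ℝ)]
  rw [← div_eq_mul_inv, le_div_iff₀ (by positivity)]
  refine le_trans ?_ (hC s)
  have h2 : (1 + |(s : ℝ)|) ^ q ≤ (1 + |(s : ℝ)|) ^ ⌈q⌉₊ := by
    rw [← Real.rpow_natCast]
    exact Real.rpow_le_rpow_of_exponent_le h1 (Nat.le_ceil q)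
  calc _ ≤ (1 + |(s : ℝ)|) ^ ⌈q⌉₊ * ‖f.mode s‖ * (1 + |(s : ℝ)|) ^ 2 := by gcongr
    _ = _ := by ring

/-- Conjugation reverses frequencies and `e_ρ` translates them; on the interval of integration `arg
e^{iθ} = θ`. -/
theorem mode_conjE (ρ : ℝ) (f : TestFun) (s : ℝ) :
    (conjE ρ f).mode s = conj (f.mode (-s - ρ)) := by
  rw [mode, mode, intervalIntegral.integral_of_le (by linarith [Real.pi_pos]),
    intervalIntegral.integral_of_le (by linarith [Real.pi_pos]), ← integral_conj]
  refine MeasureTheory.setIntegral_congr_fun measurableSet_Ioc fun t ht => ?_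
  have harg : Complex.arg (Circle.exp t) = t := by
    rw [Circle.arg_exp ht.1 ht.2]
  simp only [conjE, e, harg, map_mul, map_div₀, Complex.conj_ofReal, ← Complex.exp_conj, map_neg,
    Complex.conj_I, map_ofNat]
  rw [mul_right_comm (Complex.exp _), mul_comm (Complex.exp _ * Complex.exp _), ← Complex.exp_add]
  congr 3
  push_cast
  ring

end TestFun

section

variable {Wj Wk : Type v} [NormedAddCommGroup Wj] [InnerProductSpace ℂ Wj]
  [NormedAddCommGroup Wk] [InnerProductSpace ℂ Wk]

theorem smearedForm_eq_finsum (A : ℝ → Wj →ₗ[ℂ] Wk) (f : TestFun) (x : Wj) (y : Wk)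
    (h : {s : ℝ | inner ℂ y (A s x) ≠ (0 : ℂ)}.Finite) :
    smearedForm A f x y = ∑ᶠ s : ℝ, f.mode s * inner ℂ y (A s x) := by
  have hp : ∀ t, pointForm A x y t = ∑ s ∈ h.toFinset,
      inner ℂ y (A s x) * Complex.exp (-(Complex.I * (s + 1) * t)) := by
    intro t
    refine finsum_eq_finsetSum_of_support_subset _ ?_
    intro s hs
    simp only [Set.Finite.coe_toFinset, Set.mem_ofPred_eq]
    exact fun h0 => hs (by simp [h0])
  rw [finsum_eq_finsetSum_of_support_subset (s := h.toFinset)]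
  · unfold smearedForm
    simp_rw [hp, Finset.sum_mul]
    rw [intervalIntegral.integral_finsetSum]
    · refine Finset.sum_congr rfl fun s _ => ?_
      rw [TestFun.mode, ← intervalIntegral.integral_mul_const]
      congr 1
      funext t
      -- The factor `e^{iθ}` of the measure cancels the `-1` in the exponent `-s-1`, leaving the
      -- Fourier mode of index `s`.
      have : Complex.exp (-(Complex.I * (s + 1) * t)) * Complex.exp (Complex.I * t)
          = Complex.exp (-(Complex.I * s * t)) := by
        rw [← Complex.exp_add]
        congr 1
        ring
      rw [← this]
      ring
    · intro s _
      apply Continuous.intervalIntegrable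
      have := f.smooth'.continuous
      fun_prop
  · intro s hs
    simp only [Set.Finite.coe_toFinset, Set.mem_ofPred_eq]
    exact fun h0 => hs (by simp [h0])

end

/-! ## Sobolev spaces -/

namespace UnitaryModule

open UniformSpace (Completion)

variable {V : Type u} [NormedAddCommGroup V] [InnerProductSpace ℂ V] {𝓥 : UnitaryVOA V}
  {W : Type v} [NormedAddCommGroup W] [InnerProductSpace ℂ W]

/-- The weight space `W(s)` inside of the Hilbert space completion. -/
noncomputable def weightSpace (M : UnitaryModule 𝓥 W) (s : ℝ) : Submodule ℂ (Completion W) :=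
  (M.grading s).map (Completion.toComplₗᵢ (𝕜 := ℂ) (E := W)).toLinearMap

instance (M : UnitaryModule 𝓥 W) (s : ℝ) : FiniteDimensional ℂ (M.weightSpace s) := by
  have := M.finiteDim s
  unfold weightSpace
  infer_instance

theorem proj_eq (M : UnitaryModule 𝓥 W) (s : ℝ) : M.proj s = (M.weightSpace s).starProjection :=
  rfl

theorem coe_mem_weightSpace (M : UnitaryModule 𝓥 W) {s : ℝ} {x : W} (hx : x ∈ M.grading s) :
    (x : Completion W) ∈ M.weightSpace s := ⟨x, hx, rfl⟩

theorem inner_weightSpace (M : UnitaryModule 𝓥 W) {s q : ℝ} (h : s ≠ q) {a b : Completion W}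
    (ha : a ∈ M.weightSpace s) (hb : b ∈ M.weightSpace q) : inner ℂ a b = (0 : ℂ) := by
  obtain ⟨x, hx, rfl⟩ := ha
  obtain ⟨y, hy, rfl⟩ := hb
  change inner ℂ (x : Completion W) (y : Completion W) = _
  rw [Completion.inner_coe]
  exact M.inner_eq_zero (Ne.symm h) hy hx

theorem proj_mem (M : UnitaryModule 𝓥 W) (s : ℝ) (ξ : Completion W) :
    M.proj s ξ ∈ M.weightSpace s := by
  rw [proj_eq]
  exact Submodule.starProjection_apply_mem (M.weightSpace s) ξ

theorem proj_of_mem (M : UnitaryModule 𝓥 W) {s : ℝ} {ξ : Completion W}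
    (h : ξ ∈ M.weightSpace s) : M.proj s ξ = ξ := by
  rw [proj_eq]
  exact Submodule.starProjection_eq_self_iff.2 h

theorem proj_of_ne (M : UnitaryModule 𝓥 W) {s q : ℝ} (hq : q ≠ s) {ξ : Completion W}
    (h : ξ ∈ M.weightSpace s) : M.proj q ξ = 0 := by
  rw [proj_eq, Submodule.starProjection_apply_eq_zero_iff]
  exact fun y hy => M.inner_weightSpace hq hy h

theorem inner_proj (M : UnitaryModule 𝓥 W) (s : ℝ) (ξ η : Completion W) :
    inner ℂ (M.proj s ξ) η = inner ℂ ξ (M.proj s η) :=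
  Submodule.inner_starProjection_left_eq_right (M.weightSpace s) ξ η

theorem proj_coe (M : UnitaryModule 𝓥 W) (s : ℝ) (x : W) :
    M.proj s (x : Completion W) = (M.P s x : Completion W) := by
  induction x using M.toVOAModule.induction_grading with
  | h0 => simp only [map_zero, Completion.coe_zero]
  | hadd y z hy hz => simp only [Completion.coe_add, map_add, hy, hz]
  | hmem q y hy =>
    have hy' := M.coe_mem_weightSpace hy
    by_cases h : s = q
    · subst h
      rw [M.proj_of_mem hy', M.P_of_mem hy]
    · rw [M.proj_of_ne h hy', M.P_of_ne hy h, Completion.coe_zero]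

/-- This discards the weights at which `(1 + s) ^ p` is not monotone in `p` or has a nonpositive
base. -/
theorem proj_eq_zero_of_neg (M : UnitaryModule 𝓥 W) {s : ℝ} (hs : s < 0) (ξ : Completion W) :
    M.proj s ξ = 0 := by
  obtain ⟨x, hx, e⟩ := M.proj_mem s ξ
  rw [← e]
  by_cases h0 : x = 0
  · simp [h0]
  · exact absurd (M.weight_nonneg ((Submodule.ne_bot_iff _).2 ⟨x, hx, h0⟩)) (not_le.2 hs)

theorem orthogonalFamily (M : UnitaryModule 𝓥 W) :
    OrthogonalFamily ℂ (fun s => M.weightSpace s) fun s => (M.weightSpace s).subtypeₗᵢ := by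
  intro s q h a b
  exact M.inner_weightSpace h a.2 b.2

/-- The operator `∑_{s ∈ G} (1+s)^p P_s`. -/
noncomputable def cutoff (M : UnitaryModule 𝓥 W) (p : ℝ) (G : Finset ℝ) :
    Completion W →L[ℂ] Completion W :=
  ∑ s ∈ G, (((1 + s) ^ p : ℝ) : ℂ) • M.proj s

theorem cutoff_apply (M : UnitaryModule 𝓥 W) (p : ℝ) (G : Finset ℝ) (ξ : Completion W) :
    M.cutoff p G ξ = ∑ s ∈ G, (((1 + s) ^ p : ℝ) : ℂ) • M.proj s ξ := by
  simp [cutoff]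

theorem norm_sq_cutoff (M : UnitaryModule 𝓥 W) (p : ℝ) (G : Finset ℝ) (ξ : Completion W) :
    ‖M.cutoff p G ξ‖ ^ 2 = ∑ s ∈ G, (|(1 + s) ^ p| * ‖M.proj s ξ‖) ^ 2 := by
  have := M.orthogonalFamily.norm_sum
    (fun s => (⟨(((1 + s) ^ p : ℝ) : ℂ) • M.proj s ξ,
      Submodule.smul_mem _ _ (M.proj_mem s ξ)⟩ : M.weightSpace s)) G
  rw [cutoff_apply]
  refine this.trans (Finset.sum_congr rfl fun s _ => ?_)
  rw [← Real.norm_eq_abs, ← Complex.norm_real, ← norm_smul]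
  rfl

theorem norm_cutoff_mono (M : UnitaryModule 𝓥 W) (p : ℝ) {G G' : Finset ℝ} (h : G ⊆ G')
    (ξ : Completion W) : ‖M.cutoff p G ξ‖ ≤ ‖M.cutoff p G' ξ‖ := by
  refine (sq_le_sq₀ (norm_nonneg _) (norm_nonneg _)).1 ?_
  rw [norm_sq_cutoff, norm_sq_cutoff]
  exact Finset.sum_le_sum_of_subset_of_nonneg h fun _ _ _ => sq_nonneg _

theorem norm_cutoff_le_of_le (M : UnitaryModule 𝓥 W) {p p' : ℝ} (h : p ≤ p') (G : Finset ℝ)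
    (ξ : Completion W) : ‖M.cutoff p G ξ‖ ≤ ‖M.cutoff p' G ξ‖ := by
  refine (sq_le_sq₀ (norm_nonneg _) (norm_nonneg _)).1 ?_
  rw [norm_sq_cutoff, norm_sq_cutoff]
  refine Finset.sum_le_sum fun s _ => ?_
  rcases lt_or_ge s 0 with hs | hs
  · rw [M.proj_eq_zero_of_neg hs]
    simp
  · have h1 : (1 + s) ^ p ≤ (1 + s) ^ p' :=
      Real.rpow_le_rpow_of_exponent_le (by linarith) h
    rw [abs_of_nonneg (by positivity), abs_of_nonneg (by positivity)]
    gcongr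

theorem mem_sobolevSpace_iff (M : UnitaryModule 𝓥 W) {p : ℝ} {ξ : Completion W} :
    ξ ∈ M.sobolevSpace p ↔ Summable fun s : ℝ => (((1 + s) ^ p : ℝ) : ℂ) • M.proj s ξ := Iff.rfl

theorem tendsto_cutoff (M : UnitaryModule 𝓥 W) {p : ℝ} {ξ : Completion W}
    (h : ξ ∈ M.sobolevSpace p) :
    Filter.Tendsto (fun G => M.cutoff p G ξ) Filter.atTop
      (nhds (M.onePlusL0Pow p ⟨ξ, h⟩)) := by
  have : HasSum (fun s : ℝ => (((1 + s) ^ p : ℝ) : ℂ) • M.proj s ξ) (M.onePlusL0Pow p ⟨ξ, h⟩) :=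
    Summable.hasSum h
  simp_rw [cutoff_apply]
  exact this

theorem sobolevNorm_of_mem (M : UnitaryModule 𝓥 W) {p : ℝ} {ξ : Completion W}
    (h : ξ ∈ M.sobolevSpace p) : M.sobolevNorm p ξ = ‖M.onePlusL0Pow p ⟨ξ, h⟩‖ := dif_pos h

theorem norm_cutoff_le (M : UnitaryModule 𝓥 W) {p : ℝ} {ξ : Completion W}
    (h : ξ ∈ M.sobolevSpace p) (G : Finset ℝ) : ‖M.cutoff p G ξ‖ ≤ M.sobolevNorm p ξ := by
  rw [M.sobolevNorm_of_mem h]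
  exact Monotone.ge_of_tendsto (f := fun G => ‖M.cutoff p G ξ‖)
    (fun _ _ hG => M.norm_cutoff_mono p hG ξ) (M.tendsto_cutoff h).norm G

/-- An orthogonal series converges once its partial sums are bounded. Sobolev regularity is
therefore always proved through uniform bounds on the continuous operators `cutoff`, which pass to
limits. -/
theorem mem_sobolevSpace_of_cutoff (M : UnitaryModule 𝓥 W) {p C : ℝ} {ξ : Completion W}
    (h : ∀ G, ‖M.cutoff p G ξ‖ ≤ C) : ξ ∈ M.sobolevSpace p := by
  have hs := (M.orthogonalFamily.summable_iff_norm_sq_summable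
    (fun s => (⟨(((1 + s) ^ p : ℝ) : ℂ) • M.proj s ξ,
      Submodule.smul_mem _ _ (M.proj_mem s ξ)⟩ : M.weightSpace s))).2 (by
    refine summable_of_sum_le (c := C ^ 2) (fun _ => sq_nonneg _) fun G => ?_
    have := (sq_le_sq₀ (norm_nonneg _) ((norm_nonneg _).trans (h G))).2 (h G)
    rw [norm_sq_cutoff] at this
    refine le_trans (le_of_eq (Finset.sum_congr rfl fun s _ => ?_)) this
    rw [← Real.norm_eq_abs, ← Complex.norm_real, ← norm_smul]
    rfl)
  exact hs

theorem sobolevNorm_le_of_cutoff (M : UnitaryModule 𝓥 W) {p C : ℝ} {ξ : Completion W}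
    (h : ∀ G, ‖M.cutoff p G ξ‖ ≤ C) : M.sobolevNorm p ξ ≤ C := by
  have hm := M.mem_sobolevSpace_of_cutoff h
  rw [M.sobolevNorm_of_mem hm]
  exact le_of_tendsto (M.tendsto_cutoff hm).norm (Filter.Eventually.of_forall h)

theorem sobolevSpace_antitone (M : UnitaryModule 𝓥 W) {p p' : ℝ} (h : p ≤ p') :
    M.sobolevSpace p' ≤ M.sobolevSpace p := fun ξ hξ =>
  M.mem_sobolevSpace_of_cutoff (C := M.sobolevNorm p' ξ) fun G =>
    (M.norm_cutoff_le_of_le h G ξ).trans (M.norm_cutoff_le hξ G)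

theorem mem_smooth_iff (M : UnitaryModule 𝓥 W) {ξ : Completion W} :
    ξ ∈ M.smooth ↔ ∀ p, ξ ∈ M.sobolevSpace p := by
  simp only [smooth, Submodule.mem_iInf]
  refine ⟨fun h p => ?_, fun h p _ => h p⟩
  exact M.sobolevSpace_antitone (le_abs_self p) (h |p| (abs_nonneg p))

theorem proj_proj (M : UnitaryModule 𝓥 W) (s q : ℝ) (ξ : Completion W) :
    M.proj s (M.proj q ξ) = if s = q then M.proj q ξ else 0 := by
  split_ifs with h
  · subst h; exact M.proj_of_mem (M.proj_mem s ξ)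
  · exact M.proj_of_ne h (M.proj_mem q ξ)

theorem proj_cutoff_zero (M : UnitaryModule 𝓥 W) (s : ℝ) (G : Finset ℝ) (ξ : Completion W) :
    M.proj s (M.cutoff 0 G ξ) = if s ∈ G then M.proj s ξ else 0 := by
  rw [cutoff_apply, map_sum]
  simp only [Real.rpow_zero, Complex.ofReal_one, one_smul, proj_proj]
  rw [Finset.sum_ite_eq]

theorem norm_cutoff_cutoff_zero_le (M : UnitaryModule 𝓥 W) (p : ℝ) (G G' : Finset ℝ)
    (ξ : Completion W) : ‖M.cutoff p G (M.cutoff 0 G' ξ)‖ ≤ ‖M.cutoff p G' ξ‖ := by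
  refine (sq_le_sq₀ (norm_nonneg _) (norm_nonneg _)).1 ?_
  rw [norm_sq_cutoff, norm_sq_cutoff]
  simp only [proj_cutoff_zero]
  calc ∑ s ∈ G, (|(1 + s) ^ p| * ‖if s ∈ G' then M.proj s ξ else 0‖) ^ 2
      = ∑ s ∈ G, if s ∈ G' then (|(1 + s) ^ p| * ‖M.proj s ξ‖) ^ 2 else 0 := by
        refine Finset.sum_congr rfl fun s _ => ?_
        split_ifs <;> simp
    _ = ∑ s ∈ G ∩ G', (|(1 + s) ^ p| * ‖M.proj s ξ‖) ^ 2 := by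
        rw [Finset.sum_ite_mem]
    _ ≤ _ := Finset.sum_le_sum_of_subset_of_nonneg Finset.inter_subset_right
        fun _ _ _ => sq_nonneg _

/-- At order `0` the cutoff is a sum of mutually orthogonal projections, hence itself an orthogonal
projection. -/
theorem norm_cutoff_zero_le (M : UnitaryModule 𝓥 W) (G : Finset ℝ) (ξ : Completion W) :
    ‖M.cutoff 0 G ξ‖ ≤ ‖ξ‖ := by
  have h1 : inner ℂ (M.cutoff 0 G ξ) (M.cutoff 0 G ξ) = inner ℂ (M.cutoff 0 G ξ) ξ := by
    nth_rewrite 2 4 [cutoff_apply]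
    simp only [Real.rpow_zero, Complex.ofReal_one, one_smul, inner_sum, ← M.inner_proj]
    rw [cutoff_apply, sum_inner]
    simp only [Real.rpow_zero, Complex.ofReal_one, one_smul]
    refine Finset.sum_congr rfl fun s hs => ?_
    rw [map_sum]
    simp only [proj_proj]
    rw [Finset.sum_ite_eq, if_pos hs]
  have h2 := norm_inner_le_norm (𝕜 := ℂ) (M.cutoff 0 G ξ) ξ
  rw [← h1, inner_self_eq_norm_sq_to_K] at h2
  simp only [norm_pow, Complex.coe_algebraMap, Complex.norm_real, norm_norm] at h2
  by_cases h0 : ‖M.cutoff 0 G ξ‖ = 0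
  · rw [h0]; positivity
  · have : 0 < ‖M.cutoff 0 G ξ‖ := lt_of_le_of_ne (norm_nonneg _) (Ne.symm h0)
    rw [pow_two] at h2
    exact le_of_mul_le_mul_left h2 this

theorem cutoff_zero_coe (M : UnitaryModule 𝓥 W) {G : Finset ℝ} {x : W}
    (hG : ∀ s ∉ G, M.P s x = 0) : M.cutoff 0 G (x : Completion W) = x := by
  rw [cutoff_apply]
  simp only [Real.rpow_zero, Complex.ofReal_one, one_smul, proj_coe]
  have := congrArg (fun z : W => (z : Completion W)) (M.sum_P hG)
  rw [← this]
  exact (map_sum (Completion.toComplL (𝕜 := ℂ) (E := W)) _ _).symm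

theorem eventually_cutoff_zero_coe (M : UnitaryModule 𝓥 W) (x : W) :
    ∀ᶠ G in Filter.atTop, M.cutoff 0 G (x : Completion W) = x := by
  filter_upwards [Filter.eventually_ge_atTop (M.finite_support_P x).toFinset] with G hG
  refine M.cutoff_zero_coe fun s hs => ?_
  by_contra h
  exact hs (hG (by simpa using h))

theorem tendsto_cutoff_zero (M : UnitaryModule 𝓥 W) (ξ : Completion W) :
    Filter.Tendsto (fun G => M.cutoff 0 G ξ) Filter.atTop (nhds ξ) := by
  rw [Metric.tendsto_nhds]
  intro ε hε
  obtain ⟨x, hx⟩ := Metric.denseRange_iff.1 (Completion.denseRange_coe (α := W)) ξ (ε / 2)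
    (by positivity)
  filter_upwards [M.eventually_cutoff_zero_coe x] with G hG
  rw [dist_eq_norm] at hx ⊢
  have e : M.cutoff 0 G ξ - ξ = M.cutoff 0 G (ξ - x) - (ξ - x) := by
    rw [map_sub, hG]; abel
  rw [e]
  calc _ ≤ ‖M.cutoff 0 G (ξ - x)‖ + ‖ξ - x‖ := norm_sub_le _ _
    _ ≤ ‖ξ - x‖ + ‖ξ - x‖ := by gcongr; exact M.norm_cutoff_zero_le G _
    _ < ε := by linarith

theorem norm_cutoff_coe_le (M : UnitaryModule 𝓥 W) (p : ℝ) {q : ℝ} {x : W}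
    (hx : x ∈ M.grading q) (G : Finset ℝ) :
    ‖M.cutoff p G (x : Completion W)‖ ≤ |(1 + q) ^ p| * ‖x‖ := by
  have hx' := M.coe_mem_weightSpace hx
  refine (sq_le_sq₀ (norm_nonneg _) (by positivity)).1 ?_
  rw [norm_sq_cutoff, ← Completion.norm_coe x]
  nth_rewrite 2 [← M.proj_of_mem hx']
  refine le_trans (Finset.sum_le_sum (g := fun s => if s = q then
    (|(1 + q) ^ p| * ‖M.proj q (x : Completion W)‖) ^ 2 else 0) fun s _ => ?_) ?_
  · split_ifs with h
    · rw [h]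
    · rw [M.proj_of_ne h hx']; simp
  · rw [Finset.sum_ite_eq']
    split_ifs
    · exact le_rfl
    · positivity

theorem coe_mem_smooth (M : UnitaryModule 𝓥 W) (x : W) : (x : Completion W) ∈ M.smooth := by
  induction x using M.toVOAModule.induction_grading with
  | h0 => rw [Completion.coe_zero]; exact Submodule.zero_mem _
  | hadd y z hy hz => rw [Completion.coe_add]; exact Submodule.add_mem _ hy hz
  | hmem q y hy =>
    exact M.mem_smooth_iff.2 fun p => M.mem_sobolevSpace_of_cutoff (M.norm_cutoff_coe_le p hy)

theorem sobolevNorm_coe_le (M : UnitaryModule 𝓥 W) (p : ℝ) {q : ℝ} {x : W}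
    (hx : x ∈ M.grading q) : M.sobolevNorm p (x : Completion W) ≤ |(1 + q) ^ p| * ‖x‖ :=
  M.sobolevNorm_le_of_cutoff (M.norm_cutoff_coe_le p hx)

theorem coe_mem_sobolevSpace (M : UnitaryModule 𝓥 W) (p : ℝ) (x : W) :
    (x : Completion W) ∈ M.sobolevSpace p := M.mem_smooth_iff.1 (M.coe_mem_smooth x) p

/-- The component of weight `s` of a vector of the completion, as an element of `W`. -/
noncomputable def component (M : UnitaryModule 𝓥 W) (s : ℝ) (ξ : Completion W) : W :=
  (M.proj_mem s ξ).choose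

theorem coe_component (M : UnitaryModule 𝓥 W) (s : ℝ) (ξ : Completion W) :
    (M.component s ξ : Completion W) = M.proj s ξ := (M.proj_mem s ξ).choose_spec.2

/-- The truncation of a vector of the completion to finitely many weights. -/
noncomputable def truncate (M : UnitaryModule 𝓥 W) (G : Finset ℝ) (ξ : Completion W) : W :=
  ∑ s ∈ G, M.component s ξ

theorem coe_truncate (M : UnitaryModule 𝓥 W) (G : Finset ℝ) (ξ : Completion W) :
    (M.truncate G ξ : Completion W) = M.cutoff 0 G ξ := by
  rw [truncate, cutoff_apply]
  simp only [Real.rpow_zero, Complex.ofReal_one, one_smul, ← coe_component]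
  exact map_sum (Completion.toComplL (𝕜 := ℂ) (E := W)) _ _

theorem sobolevNorm_truncate_le (M : UnitaryModule 𝓥 W) (p : ℝ) (G : Finset ℝ)
    (ξ : Completion W) :
    M.sobolevNorm p (M.truncate G ξ : Completion W) ≤ ‖M.cutoff p G ξ‖ := by
  rw [coe_truncate]
  exact M.sobolevNorm_le_of_cutoff fun G' => M.norm_cutoff_cutoff_zero_le p G' G ξ

theorem norm_le_of_cutoff_zero (M : UnitaryModule 𝓥 W) {C : ℝ} {ξ : Completion W}
    (h : ∀ G, ‖M.cutoff 0 G ξ‖ ≤ C) : ‖ξ‖ ≤ C :=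
  le_of_tendsto (M.tendsto_cutoff_zero ξ).norm (Filter.Eventually.of_forall h)

end UnitaryModule

/-! ## Smearing of energy bounded families -/

/-- Peetre's inequality. The case of negative `p` is the positive case with `a` and `b` exchanged.
-/
theorem one_add_rpow_le_peetre {a b : ℝ} (ha : 0 ≤ a) (hb : 0 ≤ b) (p : ℝ) :
    (1 + a) ^ p ≤ (1 + b) ^ p * (1 + |a - b|) ^ |p| := by
  have h1 : 1 + a ≤ (1 + b) * (1 + |a - b|) := by
    nlinarith [le_abs_self (a - b), mul_nonneg hb (abs_nonneg (a - b))]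
  have h2 : 1 + b ≤ (1 + a) * (1 + |a - b|) := by
    nlinarith [neg_abs_le (a - b), mul_nonneg ha (abs_nonneg (a - b))]
  have hc : (0 : ℝ) < 1 + |a - b| := by positivity
  rcases le_total 0 p with hp | hp
  · rw [abs_of_nonneg hp, ← Real.mul_rpow (by positivity) hc.le]
    exact Real.rpow_le_rpow (by positivity) h1 hp
  · rw [abs_of_nonpos hp]
    have := Real.rpow_le_rpow_of_nonpos (by positivity : (0 : ℝ) < 1 + b) h2 hp
    rw [Real.mul_rpow (by positivity) hc.le] at this
    rw [Real.rpow_neg hc.le, ← div_eq_mul_inv, le_div_iff₀ (by positivity)]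
    exact this

theorem one_add_abs_rpow_le (d s p : ℝ) :
    (1 + |d - s|) ^ |p| ≤ (1 + |d|) ^ |p| * (1 + |s|) ^ |p| := by
  rw [← Real.mul_rpow (by positivity) (by positivity)]
  refine Real.rpow_le_rpow (by positivity) ?_ (abs_nonneg p)
  nlinarith [abs_sub d s, mul_nonneg (abs_nonneg d) (abs_nonneg s)]

/-- `S` is contained in a finite union of cosets of `ℤ`. -/
def IsThin (S : Set ℝ) : Prop := ∃ F : Set ℝ, F.Finite ∧ ∀ s ∈ S, ∃ a ∈ F, ∃ n : ℤ, s = n + a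

section

open UniformSpace (Completion)

variable {V : Type u} [NormedAddCommGroup V] [InnerProductSpace ℂ V] {𝓥 : UnitaryVOA V}
  {Wj Wk : Type v} [NormedAddCommGroup Wj] [InnerProductSpace ℂ Wj]
  [NormedAddCommGroup Wk] [InnerProductSpace ℂ Wk]

/-- A family of modes `A s` that behaves like the modes of a homogeneous vector of weight `D` that
satisfies polynomial energy bounds. -/
structure EnergyBounded (Mj : UnitaryModule 𝓥 Wj) (Mk : UnitaryModule 𝓥 Wk)
    (A : ℝ → Wj →ₗ[ℂ] Wk) (S : Set ℝ) (D K t r : ℝ) : Prop where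
  thin : IsThin S
  shift : ∀ s q : ℝ, ∀ x ∈ Mj.grading q, A s x ∈ Mk.grading (q + (D - s - 1))
  support : ∀ s ∉ S, A s = 0
  nonneg : 0 ≤ K
  bound : ∀ s q : ℝ, ∀ x ∈ Mj.grading q, ‖A s x‖ ≤ K * (1 + |s|) ^ t * (1 + |q|) ^ r * ‖x‖

theorem UnitaryModule.nonneg_of_mem (M : UnitaryModule 𝓥 Wj) {q : ℝ} {x : Wj}
    (hx : x ∈ M.grading q) (h0 : x ≠ 0) : 0 ≤ q :=
  M.weight_nonneg ((Submodule.ne_bot_iff _).2 ⟨x, hx, h0⟩)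

namespace EnergyBounded

variable {Mj : UnitaryModule 𝓥 Wj} {Mk : UnitaryModule 𝓥 Wk} {A : ℝ → Wj →ₗ[ℂ] Wk} {S : Set ℝ}
  {D K t r : ℝ}

theorem finite_inner (h : EnergyBounded Mj Mk A S D K t r) (x : Wj) (y : Wk) :
    {s : ℝ | inner ℂ y (A s x) ≠ (0 : ℂ)}.Finite := by
  induction x using Mj.toVOAModule.induction_grading with
  | h0 => simp
  | hadd x z hx hz =>
    refine (hx.union hz).subset fun s hs => ?_
    by_contra hc
    simp only [Set.mem_union, Set.mem_ofPred_eq, not_or, not_not] at hc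
    exact hs (by rw [map_add, inner_add_right, hc.1, hc.2, add_zero])
  | hmem q x hx =>
    induction y using Mk.toVOAModule.induction_grading with
    | h0 => simp
    | hadd y z hy hz =>
      refine (hy.union hz).subset fun s hs => ?_
      by_contra hc
      simp only [Set.mem_union, Set.mem_ofPred_eq, not_or, not_not] at hc
      exact hs (by rw [inner_add_left, hc.1, hc.2, add_zero])
    | hmem q' y hy =>
      refine (Set.finite_singleton (q + D - 1 - q')).subset fun s hs => ?_
      by_contra hc
      refine hs (Mk.inner_eq_zero ?_ (h.shift s q x hx) hy)
      intro e
      exact hc (by rw [Set.mem_singleton_iff, ← e]; ring)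

theorem P_mode (h : EnergyBounded Mj Mk A S D K t r) (s q : ℝ) (x : Wj) :
    Mk.P q (A s x) = A s (Mj.P (q - (D - s - 1)) x) := by
  induction x using Mj.toVOAModule.induction_grading with
  | h0 => simp
  | hadd x z hx hz => simp only [map_add, hx, hz]
  | hmem q' x hx =>
    have hm := h.shift s q' x hx
    by_cases hq : q = q' + (D - s - 1)
    · rw [hq, Mk.P_of_mem hm, add_sub_cancel_right, Mj.P_of_mem hx]
    · rw [Mk.P_of_ne hm hq, Mj.P_of_ne hx (fun e => hq (by rw [← e]; ring)), map_zero]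

/-- `A s` sends distinct weight spaces into distinct, hence orthogonal, ones. The estimate thus
splits into blocks, and in each block Peetre's inequality compares two weights differing by `D - 1 -
s`. -/
theorem norm_cutoff_mode_le (h : EnergyBounded Mj Mk A S D K t r) (p s : ℝ) (G : Finset ℝ)
    (x : Wj) :
    ‖Mk.cutoff p G (A s x : Completion Wk)‖
      ≤ K * (1 + |D - 1|) ^ |p| * (1 + |s|) ^ (|p| + t)
        * Mj.sobolevNorm (p + r) (x : Completion Wj) := by
  set C := K * (1 + |D - 1|) ^ |p| * (1 + |s|) ^ (|p| + t) with hC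
  have hK := h.nonneg
  have hC0 : 0 ≤ C := by positivity
  have term : ∀ q' : ℝ, |(1 + q') ^ p| * ‖Mk.proj q' (A s x : Completion Wk)‖
      ≤ C * (|(1 + (q' - (D - s - 1))) ^ (p + r)|
        * ‖Mj.proj (q' - (D - s - 1)) (x : Completion Wj)‖) := by
    intro q'
    rw [Mk.proj_coe, Mj.proj_coe, Completion.norm_coe, Completion.norm_coe, h.P_mode]
    set q := q' - (D - s - 1) with hq
    -- When this vector is nonzero, both `q` and `q'` carry nonzero vectors and are nonnegative, as
    -- Peetre's inequality requires.
    by_cases h0 : A s (Mj.P q x) = 0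
    · rw [h0, norm_zero, mul_zero]; positivity
    have hx0 : Mj.P q x ≠ 0 := fun e => h0 (by rw [e, map_zero])
    have hq0 := Mj.nonneg_of_mem (Mj.P_mem q x) hx0
    have hq0' : 0 ≤ q' := by
      refine Mk.nonneg_of_mem (x := A s (Mj.P q x)) ?_ h0
      have := h.shift s q _ (Mj.P_mem q x)
      rwa [hq, sub_add_cancel] at this
    have hb := h.bound s q _ (Mj.P_mem q x)
    have h1 := one_add_rpow_le_peetre hq0' hq0 p
    have h2 := one_add_abs_rpow_le (D - 1) s p
    rw [show q' - q = D - 1 - s by rw [hq]; ring] at h1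
    rw [abs_of_nonneg hq0] at hb
    rw [abs_of_nonneg (by positivity), abs_of_nonneg (by positivity),
      Real.rpow_add (by positivity)]
    calc (1 + q') ^ p * ‖A s (Mj.P q x)‖
        ≤ ((1 + q) ^ p * ((1 + |D - 1|) ^ |p| * (1 + |s|) ^ |p|))
          * (K * (1 + |s|) ^ t * (1 + q) ^ r * ‖Mj.P q x‖) := by
          gcongr
          exact h1.trans (by gcongr)
      _ = _ := by
          rw [hC, Real.rpow_add (by positivity)]
          ring
  let G' := G.image fun q' => q' - (D - s - 1)
  have hle : ‖Mk.cutoff p G (A s x : Completion Wk)‖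
      ≤ C * ‖Mj.cutoff (p + r) G' (x : Completion Wj)‖ := by
    refine (sq_le_sq₀ (norm_nonneg _) (by positivity)).1 ?_
    rw [mul_pow, UnitaryModule.norm_sq_cutoff, UnitaryModule.norm_sq_cutoff, Finset.mul_sum,
      Finset.sum_image (fun a _ b _ e => by simpa using e)]
    refine Finset.sum_le_sum fun q' _ => ?_
    rw [← mul_pow]
    have := term q'
    gcongr
  exact hle.trans (by gcongr; exact Mj.norm_cutoff_le (Mj.coe_mem_sobolevSpace _ x) G')

theorem norm_mode_le (h : EnergyBounded Mj Mk A S D K t r) (s : ℝ) (x : Wj) :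
    ‖A s x‖ ≤ K * (1 + |s|) ^ t * Mj.sobolevNorm r (x : Completion Wj) := by
  rw [← Completion.norm_coe]
  refine Mk.norm_le_of_cutoff_zero fun G => ?_
  simpa using h.norm_cutoff_mode_le 0 s G x

theorem summable_weight (h : EnergyBounded Mj Mk A S D K t r) (f : TestFun) (q : ℝ) :
    Summable fun s : S => (1 + |(s : ℝ)|) ^ q * ‖f.mode s‖ := by
  obtain ⟨F, hF, hS⟩ := h.thin
  exact f.summable_mode q hF hS

theorem summable_norm_smear (h : EnergyBounded Mj Mk A S D K t r) (f : TestFun) (x : Wj) :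
    Summable fun s : S => ‖f.mode s • (A s x : Completion Wk)‖ := by
  refine Summable.of_nonneg_of_le (fun _ => norm_nonneg _) (fun s => ?_)
    ((h.summable_weight f t).mul_left (K * Mj.sobolevNorm r (x : Completion Wj)))
  rw [norm_smul, Completion.norm_coe]
  calc _ ≤ ‖f.mode s‖ * (K * (1 + |(s : ℝ)|) ^ t * Mj.sobolevNorm r (x : Completion Wj)) := by
        gcongr; exact h.norm_mode_le s x
    _ = _ := by ring

/-- The operator `A(f) = ∑_s f^(s) A(s)` on the algebraic module. -/
noncomputable def smear (h : EnergyBounded Mj Mk A S D K t r) (f : TestFun) :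
    Wj →ₗ[ℂ] Completion Wk where
  toFun x := ∑' s : S, f.mode s • (A s x : Completion Wk)
  map_add' x y := by
    simp only [map_add, Completion.coe_add, smul_add]
    exact (h.summable_norm_smear f x).of_norm.tsum_add (h.summable_norm_smear f y).of_norm
  map_smul' c x := by
    simp only [map_smul, Completion.coe_smul, RingHom.id_apply, smul_comm _ c]
    exact (h.summable_norm_smear f x).of_norm.tsum_const_smul c

theorem hasSum_smear (h : EnergyBounded Mj Mk A S D K t r) (f : TestFun) (x : Wj) :
    HasSum (fun s : S => f.mode s • (A s x : Completion Wk)) (h.smear f x) :=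
  (h.summable_norm_smear f x).of_norm.hasSum

theorem norm_cutoff_smear_le (h : EnergyBounded Mj Mk A S D K t r) (f : TestFun) (p : ℝ)
    (G : Finset ℝ) (x : Wj) :
    ‖Mk.cutoff p G (h.smear f x)‖
      ≤ K * (1 + |D - 1|) ^ |p| * (∑' s : S, (1 + |(s : ℝ)|) ^ (|p| + t) * ‖f.mode s‖)
        * Mj.sobolevNorm (p + r) (x : Completion Wj) := by
  have h1 := (h.hasSum_smear f x).mapL (Mk.cutoff p G)
  have h2 := (h.summable_weight f (|p| + t)).hasSum.mul_left
    (K * (1 + |D - 1|) ^ |p| * Mj.sobolevNorm (p + r) (x : Completion Wj))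
  refine (h1.norm_le_of_bounded h2 fun s => ?_).trans (le_of_eq (by ring))
  rw [map_smul, norm_smul]
  calc _ ≤ ‖f.mode s‖ * (K * (1 + |D - 1|) ^ |p| * (1 + |(s : ℝ)|) ^ (|p| + t)
        * Mj.sobolevNorm (p + r) (x : Completion Wj)) := by
        gcongr; exact h.norm_cutoff_mode_le p s G x
    _ = _ := by ring

theorem inner_smear (h : EnergyBounded Mj Mk A S D K t r) (f : TestFun) (x : Wj) (y : Wk) :
    inner ℂ (y : Completion Wk) (h.smear f x) = smearedForm A f x y := by
  have hfin := h.finite_inner x y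
  rw [smearedForm_eq_finsum A f x y hfin]
  have h1 := (h.hasSum_smear f x).mapL (innerSL ℂ (y : Completion Wk))
  simp only [map_smul, innerSL_apply_apply, Completion.inner_coe, smul_eq_mul] at h1
  rw [← h1.tsum_eq, tsum_subtype_eq_of_support_subset
    (f := fun s : ℝ => f.mode s * inner ℂ y (A s x))]
  · refine tsum_eq_finsum (hfin.subset fun s hs h0 => hs ?_)
    simp [h0]
  · intro s hs
    by_contra hc
    refine hs ?_
    simp [h.support s hc]

/-- The convergent series `smear` represents the form, and a representing vector is unique because
`W_k` is dense. -/
theorem mem_smearedGraph (h : EnergyBounded Mj Mk A S D K t r) (f : TestFun)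
    {q : Completion Wj × Completion Wk} :
    q ∈ smearedGraph A f ↔ ∃ x : Wj, q.1 = x ∧ q.2 = h.smear f x := by
  constructor
  · rintro ⟨x, hx, hy⟩
    refine ⟨x, hx, ?_⟩
    refine (Completion.denseRange_coe (α := Wk)).eq_of_inner_right ℂ fun y => ?_
    rw [(hy y).2, h.inner_smear f x y]
  · rintro ⟨x, hx, hy⟩
    exact ⟨x, hx, fun y => ⟨h.finite_inner x y, by rw [hy, h.inner_smear f x y]⟩⟩

theorem smearedGraph_fst (h : EnergyBounded Mj Mk A S D K t r) (f : TestFun)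
    (q : Completion Wj × Completion Wk) (hq : q ∈ smearedGraph A f) (h0 : q.1 = 0) : q.2 = 0 := by
  obtain ⟨x, hx, hy⟩ := (h.mem_smearedGraph f).1 hq
  rw [h0] at hx
  have : x = 0 := by
    rw [← norm_eq_zero, ← Completion.norm_coe, ← hx, norm_zero]
  rw [hy, this, map_zero]

theorem graph_smearedCore (h : EnergyBounded Mj Mk A S D K t r) (f : TestFun) :
    (smearedCore A f).graph = smearedGraph A f :=
  Submodule.toLinearPMap_graph_eq _ (h.smearedGraph_fst f)

theorem smearedCore_domain (h : EnergyBounded Mj Mk A S D K t r) (f : TestFun) :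
    ((smearedCore A f).domain : Set (Completion Wj)) = Set.range ((↑) : Wj → Completion Wj) := by
  ext ξ
  change ξ ∈ (smearedGraph A f).map (LinearMap.fst ℂ _ _) ↔ _
  rw [Submodule.mem_map]
  constructor
  · rintro ⟨q, hq, rfl⟩
    obtain ⟨x, hx, -⟩ := (h.mem_smearedGraph f).1 hq
    exact ⟨x, hx.symm⟩
  · rintro ⟨x, rfl⟩
    exact ⟨(x, h.smear f x), (h.mem_smearedGraph f).2 ⟨x, rfl, rfl⟩, rfl⟩

/-- At order `p = -r` the Sobolev estimate bounds cutoffs of the image by the Hilbert norm of the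
argument. This condition is closed, so in a limit `(0, ζ)` of graph points all weight components of
`ζ` vanish. -/
theorem isClosable (h : EnergyBounded Mj Mk A S D K t r) (f : TestFun) :
    (smearedCore A f).IsClosable := by
  refine ⟨((smearedCore A f).graph.topologicalClosure).toLinearPMap, ?_⟩
  refine (Submodule.toLinearPMap_graph_eq _ ?_).symm
  rintro ⟨ξ, ζ⟩ hq h0
  simp only at h0
  subst h0
  rw [h.graph_smearedCore f] at hq
  have hzero : ∀ G, ‖Mk.cutoff (-r) G ζ‖ ≤ 0 := by
    intro G
    set C := K * (1 + |D - 1|) ^ |-r| *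
      (∑' s : S, (1 + |(s : ℝ)|) ^ (|-r| + t) * ‖f.mode s‖) with hC
    have hK := h.nonneg
    have hC0 : 0 ≤ C := mul_nonneg (by positivity) (tsum_nonneg fun _ => by positivity)
    have hcl : IsClosed {q : Completion Wj × Completion Wk | ‖Mk.cutoff (-r) G q.2‖ ≤ C * ‖q.1‖} :=
      isClosed_le (by fun_prop) (by fun_prop)
    have hsub : (smearedGraph A f : Set _) ⊆
        {q : Completion Wj × Completion Wk | ‖Mk.cutoff (-r) G q.2‖ ≤ C * ‖q.1‖} := by
      intro q hq
      obtain ⟨x, hx, hy⟩ := (h.mem_smearedGraph f).1 hq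
      have := h.norm_cutoff_smear_le f (-r) G x
      rw [neg_add_cancel] at this
      simp only [Set.mem_ofPred_eq]
      rw [hx, hy]
      refine this.trans ?_
      gcongr
      exact Mj.sobolevNorm_le_of_cutoff fun G => Mj.norm_cutoff_zero_le G _
    have := closure_minimal hsub hcl hq
    simpa using this
  have hproj : ∀ s, Mk.proj s ζ = 0 := by
    intro s
    rcases lt_or_ge s 0 with hs | hs
    · exact Mk.proj_eq_zero_of_neg hs ζ
    · have h1 := hzero {s}
      rw [norm_le_zero_iff, UnitaryModule.cutoff_apply, Finset.sum_singleton] at h1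
      refine (smul_eq_zero.1 h1).resolve_left ?_
      have : (0 : ℝ) < (1 + s) ^ (-r) := by positivity
      exact_mod_cast this.ne'
  refine norm_le_zero_iff.1 (Mk.norm_le_of_cutoff_zero fun G => ?_)
  rw [UnitaryModule.cutoff_apply]
  simp [hproj]

theorem norm_smear_le (h : EnergyBounded Mj Mk A S D K t r) (f : TestFun) (x : Wj) :
    ‖h.smear f x‖ ≤ K * (∑' s : S, (1 + |(s : ℝ)|) ^ t * ‖f.mode s‖)
        * Mj.sobolevNorm r (x : Completion Wj) := by
  refine Mk.norm_le_of_cutoff_zero fun G => ?_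
  simpa using h.norm_cutoff_smear_le f 0 G x

/-- The estimate at order `0` transfers the Cauchy property of the series for `(1 + L_0)^r ξ` to the
images of its components. -/
theorem summable_smear_component (h : EnergyBounded Mj Mk A S D K t r) (f : TestFun)
    {ξ : Completion Wj} (hξ : ξ ∈ Mj.smooth) :
    Summable fun s : ℝ => h.smear f (Mj.component s ξ) := by
  rw [summable_iff_vanishing_norm]
  intro ε hε
  set C := K * (∑' s : S, (1 + |(s : ℝ)|) ^ t * ‖f.mode s‖) with hC
  have hC0 : 0 ≤ C := mul_nonneg h.nonneg (tsum_nonneg fun _ => by positivity)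
  -- The denominator `C + 1` covers the case `C = 0`.
  have hs := summable_iff_vanishing_norm.1
    (Mj.mem_sobolevSpace_iff.1 (Mj.mem_smooth_iff.1 hξ r)) (ε / (C + 1)) (by positivity)
  obtain ⟨G, hG⟩ := hs
  refine ⟨G, fun G' hG' => ?_⟩
  have h1 := hG G' hG'
  rw [← UnitaryModule.cutoff_apply] at h1
  rw [← map_sum]
  change ‖h.smear f (Mj.truncate G' ξ)‖ < ε
  calc _ ≤ C * Mj.sobolevNorm r (Mj.truncate G' ξ : Completion Wj) := h.norm_smear_le f _
    _ ≤ C * ‖Mj.cutoff r G' ξ‖ := by gcongr; exact Mj.sobolevNorm_truncate_le r G' ξ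
    _ ≤ C * (ε / (C + 1)) := by gcongr
    _ < ε := by
      rw [mul_div_assoc', div_lt_iff₀ (by positivity)]
      nlinarith

/-- The truncations of `ξ` and their images are graph points that converge, so the limit lies on the
graph of the closure. -/
theorem exists_hasSum_smeared (h : EnergyBounded Mj Mk A S D K t r) (f : TestFun)
    {ξ : Completion Wj} (hξ : ξ ∈ Mj.smooth) :
    ∃ hd : ξ ∈ (smeared Mj A f).domain,
      HasSum (fun s : ℝ => h.smear f (Mj.component s ξ)) (smeared Mj A f ⟨ξ, hd⟩) := by
  have hsum := (h.summable_smear_component f hξ).hasSum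
  set a := ∑' s : ℝ, h.smear f (Mj.component s ξ)
  have hmem : (ξ, a) ∈ (smearedCore A f).closure.graph := by
    rw [← (h.isClosable f).graph_closure_eq_closure_graph, h.graph_smearedCore f]
    have hlim : Filter.Tendsto (fun G : Finset ℝ =>
        ((Mj.truncate G ξ : Completion Wj), h.smear f (Mj.truncate G ξ))) Filter.atTop
        (nhds (ξ, a)) := by
      refine Filter.Tendsto.prodMk_nhds ?_ ?_
      · simp_rw [UnitaryModule.coe_truncate]
        exact Mj.tendsto_cutoff_zero ξ
      · simp only [UnitaryModule.truncate, map_sum]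
        exact hsum
    exact mem_closure_of_tendsto hlim (Filter.Eventually.of_forall fun G =>
      (h.mem_smearedGraph f).2 ⟨_, rfl, rfl⟩)
  obtain ⟨y, hy1, hy2⟩ := (LinearPMap.mem_graph_iff _).1 hmem
  simp only at hy1 hy2
  have hd : ξ ∈ (smeared Mj A f).domain := ⟨hξ, by rw [← hy1]; exact y.2⟩
  refine ⟨hd, ?_⟩
  have e : smeared Mj A f ⟨ξ, hd⟩ = a := by
    rw [← hy2]
    exact LinearPMap.domRestrict_apply hy1.symm
  rw [e]
  exact hsum

theorem smeared_domain (h : EnergyBounded Mj Mk A S D K t r) (f : TestFun) :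
    (smeared Mj A f).domain = Mj.smooth :=
  le_antisymm (fun _ hξ => hξ.1) fun _ hξ => (h.exists_hasSum_smeared f hξ).1

theorem smeared_hasSum (h : EnergyBounded Mj Mk A S D K t r) (f : TestFun)
    (ξ : (smeared Mj A f).domain) :
    HasSum (fun s : ℝ => h.smear f (Mj.component s ξ)) (smeared Mj A f ξ) :=
  (h.exists_hasSum_smeared f ξ.2.1).2

theorem norm_cutoff_smeared_le (h : EnergyBounded Mj Mk A S D K t r) (f : TestFun) (p : ℝ)
    (G : Finset ℝ) (ξ : (smeared Mj A f).domain) :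
    ‖Mk.cutoff p G (smeared Mj A f ξ)‖
      ≤ K * (1 + |D - 1|) ^ |p| * (∑' s : S, (1 + |(s : ℝ)|) ^ (|p| + t) * ‖f.mode s‖)
        * Mj.sobolevNorm (p + r) (ξ : Completion Wj) := by
  have hlim := (((Mk.cutoff p G).continuous.tendsto _).comp (h.smeared_hasSum f ξ)).norm
  refine le_of_tendsto hlim (Filter.Eventually.of_forall fun G' => ?_)
  have hK := h.nonneg
  have hN : 0 ≤ ∑' s : S, (1 + |(s : ℝ)|) ^ (|p| + t) * ‖f.mode s‖ :=
    tsum_nonneg fun _ => by positivity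
  simp only [Function.comp]
  rw [← map_sum]
  refine (h.norm_cutoff_smear_le f p G (Mj.truncate G' ξ)).trans ?_
  gcongr
  exact (Mj.sobolevNorm_truncate_le _ G' _).trans
    (Mj.norm_cutoff_le (Mj.mem_smooth_iff.1 ξ.2.1 _) G')

theorem smeared_mem_smooth (h : EnergyBounded Mj Mk A S D K t r) (f : TestFun)
    (ξ : (smeared Mj A f).domain) : smeared Mj A f ξ ∈ Mk.smooth :=
  Mk.mem_smooth_iff.2 fun p =>
    Mk.mem_sobolevSpace_of_cutoff fun G => h.norm_cutoff_smeared_le f p G ξ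

theorem sobolevNorm_smeared_le (h : EnergyBounded Mj Mk A S D K t r) (f : TestFun) (p : ℝ)
    (ξ : (smeared Mj A f).domain) :
    Mk.sobolevNorm p (smeared Mj A f ξ)
      ≤ K * (1 + |D - 1|) ^ |p| * (∑' s : S, (1 + |(s : ℝ)|) ^ (|p| + t) * ‖f.mode s‖)
        * Mj.sobolevNorm (p + r) (ξ : Completion Wj) :=
  Mk.sobolevNorm_le_of_cutoff fun G => h.norm_cutoff_smeared_le f p G ξ

end EnergyBounded

/-! ## Energy bounds for intertwining operators and their adjoints -/

theorem VOA.IsC2Cofinite.isThin_exponents {𝓥 : UnitaryVOA V} (h : 𝓥.IsC2Cofinite) :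
    IsThin (VOA.exponents.{u, v} 𝓥.toVOA) := by
  have hF := VOA.IsC2Cofinite.finite_conformalWeights.{u, v} h
  refine ⟨(fun z : ℝ × ℝ × ℝ => z.1 + z.2.1 - z.2.2) '' (VOA.conformalWeights.{u, v} 𝓥.toVOA ×ˢ
    VOA.conformalWeights.{u, v} 𝓥.toVOA ×ˢ VOA.conformalWeights.{u, v} 𝓥.toVOA),
    (hF.prod (hF.prod hF)).image _, ?_⟩
  rintro s ⟨a, ha, b, hb, c, hc, n, rfl⟩
  exact ⟨a + b - c, ⟨(a, b, c), ⟨ha, hb, hc⟩, rfl⟩, n, rfl⟩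

variable {Wi : Type v} [NormedAddCommGroup Wi] [InnerProductSpace ℂ Wi]
  {Mi : UnitaryModule 𝓥 Wi} {Mj : UnitaryModule 𝓥 Wj} {Mk : UnitaryModule 𝓥 Wk}

/-- A nonzero value exhibits weights of all three modules related by `s = D + q - q' - 1`, where
`q'` is the weight of the value. Modulo `ℤ` each is the conformal weight of an irreducible module.
-/
theorem mode_eq_zero_of_notMem_exponents {D : ℝ} (hD : Mi.grading D ≠ ⊥)
    {A : ℝ → Wj →ₗ[ℂ] Wk}
    (hA : ∀ s q : ℝ, ∀ x ∈ Mj.grading q, A s x ∈ Mk.grading (q + (D - s - 1)))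
    {s : ℝ} (hs : s ∉ VOA.exponents.{u, v} 𝓥.toVOA) : A s = 0 := by
  ext x
  induction x using Mj.toVOAModule.induction_grading with
  | h0 => simp
  | hadd y z hy hz => simp only [map_add, hy, hz]
  | hmem q x hx =>
    by_contra h0
    have hx0 : x ≠ 0 := fun e => h0 (by rw [e]; simp)
    obtain ⟨a, ha, n₁, h1⟩ := Mi.exists_conformalWeight hD
    obtain ⟨b, hb, n₂, h2⟩ := Mj.exists_conformalWeight ((Submodule.ne_bot_iff _).2 ⟨x, hx, hx0⟩)
    obtain ⟨c, hc, n₃, h3⟩ := Mk.exists_conformalWeight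
      ((Submodule.ne_bot_iff _).2 ⟨_, hA s q x hx, h0⟩)
    refine hs ((VOA.mem_exponents _).2 ⟨a, ha, b, hb, c, hc, n₁ + n₂ - n₃ - 1, ?_⟩)
    push_cast
    linarith

namespace EnergyBounded

variable {A : ℝ → Wj →ₗ[ℂ] Wk} {S : Set ℝ} {D K t r : ℝ}

theorem zero (hS : IsThin S) (hK : 0 ≤ K) :
    EnergyBounded Mj Mk (fun _ => 0) S D K t r where
  thin := hS
  shift _ _ _ _ := Submodule.zero_mem _
  support _ _ := rfl
  nonneg := hK
  bound _ _ _ _ := by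
    rw [LinearMap.zero_apply, norm_zero]
    positivity

theorem mono (h : EnergyBounded Mj Mk A S D K t r) {K' t' r' : ℝ} (hK : K ≤ K') (ht : t ≤ t')
    (hr : r ≤ r') : EnergyBounded Mj Mk A S D K' t' r' where
  thin := h.thin
  shift := h.shift
  support := h.support
  nonneg := h.nonneg.trans hK
  bound s q x hx := by
    have h1 := h.nonneg
    have h2 := h1.trans hK
    refine (h.bound s q x hx).trans ?_
    gcongr <;> linarith [abs_nonneg s, abs_nonneg q]

end EnergyBounded

namespace IntertwiningOperator

theorem commutator (α : IntertwiningOperator Mi.toVOAModule Mj.toVOAModule Mk.toVOAModule) (a : V)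
    (w : Wi) (m : ℕ) (s : ℝ) (x : Wj) :
    Mk.Y a m (α.Y w s x) - α.Y w s (Mj.Y a m x)
      = ∑ l ∈ Finset.range (m + 1), (m.choose l : ℂ) • α.Y (Mi.Y a l w) (m + s - l) x := by
  have h := α.jacobi a w x m 0 s
  rw [finsum_ringChoose_smul, finsum_ringChoose_zero_smul, finsum_ringChoose_zero_smul] at h
  simpa using h.symm

/-- Commuting with `L_1 = Y(ν,2)` produces modes of `L_{-1} w`, `L_0 w` and `L_1 w`; the first two
are multiples of the mode `s + 1` of `w`. -/
theorem L_one_mode (α : IntertwiningOperator Mi.toVOAModule Mj.toVOAModule Mk.toVOAModule)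
    {w : Wi} {Δ : ℝ} (hw : w ∈ Mi.grading Δ) (s : ℝ) (x : Wj) :
    α.Y (Mi.L 1 w) s x = Mk.L 1 (α.Y w s x) - α.Y w s (Mj.L 1 x)
      - ((2 * Δ - s - 2 : ℝ) : ℂ) • α.Y w (s + 1) x := by
  have h := α.commutator 𝓥.ν w 2 s x
  have e1 := α.translation w (s + 2) x
  rw [show s + 2 - 1 = s + 1 by ring] at e1
  simp only [VOAModule.L] at e1 ⊢
  norm_num [Finset.sum_range_succ, Mi.energy Δ w hw] at h e1 ⊢
  rw [show 2 + s - 1 = s + 1 by ring, add_comm 2 s, e1] at h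
  rw [h]
  module

theorem energyBounded_of_le
    (α : IntertwiningOperator Mi.toVOAModule Mj.toVOAModule Mk.toVOAModule)
    (hC2 : 𝓥.IsC2Cofinite) {w : Wi} {Δ : ℝ} (hw : w ∈ Mi.grading Δ) {K t r : ℝ} (hK : 0 ≤ K)
    (hb : ∀ s q : ℝ, ∀ x ∈ Mj.grading q, x ≠ 0 →
      ‖α.Y w s x‖ ≤ K * (1 + |s|) ^ t * (1 + |q|) ^ r * ‖x‖) :
    EnergyBounded Mj Mk (α.Y w) (VOA.exponents.{u, v} 𝓥.toVOA) Δ K t r where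
  thin := hC2.isThin_exponents
  shift s _ _ hx := α.mode_mem hw s hx
  support s hs := by
    by_cases h0 : w = 0
    · rw [h0, map_zero]; rfl
    · exact mode_eq_zero_of_notMem_exponents (Mj := Mj) (Mk := Mk)
        ((Submodule.ne_bot_iff _).2 ⟨w, hw, h0⟩) (fun s _ _ hx => α.mode_mem hw s hx) hs
  nonneg := hK
  bound s q x hx := by
    by_cases h0 : x = 0
    · rw [h0, map_zero, norm_zero, norm_zero, mul_zero]
    · exact hb s q x hx h0

/-- The three terms of `L_one_mode` cost at most one extra power of `1 + |s|` and one of `1 + q`: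
`L_1` is bounded by the weight it acts on, and the scalar is linear in `s`. The factors `2 ^ r` and
`2 ^ t` pay for the shifts to weight `q - 1` and to mode `s + 1`. -/
theorem energyBounded_L_one
    (α : IntertwiningOperator Mi.toVOAModule Mj.toVOAModule Mk.toVOAModule)
    (hC2 : 𝓥.IsC2Cofinite) {w : Wi} {Δ : ℝ} (hw : w ∈ Mi.grading Δ) {K t r : ℝ}
    (ht : 0 ≤ t) (hr : 0 ≤ r)
    (h : EnergyBounded Mj Mk (α.Y w) (VOA.exponents.{u, v} 𝓥.toVOA) Δ K t r) :
    ∃ K', EnergyBounded Mj Mk (α.Y (Mi.L 1 w)) (VOA.exponents.{u, v} 𝓥.toVOA) (Δ - 1) K'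
      (t + 1) (r + 1) := by
  have hK := h.nonneg
  have hw' : Mi.L 1 w ∈ Mi.grading (Δ - 1) := Mi.L1_mem hw
  set d : ℝ := 1 + |Δ - 1| with hd
  have hd1 : 1 ≤ d := by rw [hd]; linarith [abs_nonneg (Δ - 1)]
  refine ⟨K * d + K * 2 ^ r + 2 * d * K * 2 ^ t,
    α.energyBounded_of_le hC2 hw' (by positivity) fun s q x hx hx0 => ?_⟩
  have hq := Mj.nonneg_of_mem hx hx0
  rw [abs_of_nonneg hq, Real.rpow_add_one (by positivity), Real.rpow_add_one (by positivity)]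
  set a := 1 + |s| with ha
  set b := 1 + q with hb
  have ha1 : 1 ≤ a := by rw [ha]; linarith [abs_nonneg s]
  have hb1 : 1 ≤ b := by rw [hb]; linarith
  have h0 := h.bound s q x hx
  rw [abs_of_nonneg hq] at h0
  have t1 : ‖Mk.L 1 (α.Y w s x)‖ ≤ d * a * b * (K * a ^ t * b ^ r * ‖x‖) := by
    refine (Mk.norm_L_one_le (α.mode_mem hw s hx)).trans ?_
    have : |q + (Δ - s - 1)| ≤ d * a * b := by
      have e : q + (Δ - s - 1) = (Δ - 1) + q - s := by ring
      rw [e]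
      calc |(Δ - 1) + q - s| ≤ |Δ - 1| + |q| + |s| :=
            (abs_sub _ _).trans (by gcongr; exact abs_add_le _ _)
        _ ≤ d + b + a - 2 := by rw [abs_of_nonneg hq, hd, hb, ha]; linarith
        _ ≤ d * a * b := by
          nlinarith [mul_nonneg (sub_nonneg.2 hd1) (sub_nonneg.2 ha1),
            mul_nonneg (sub_nonneg.2 (one_le_mul_of_one_le_of_one_le hd1 ha1))
              (sub_nonneg.2 hb1)]
    gcongr
  have t2 : ‖α.Y w s (Mj.L 1 x)‖ ≤ K * a ^ t * (2 ^ r * b ^ r) * (b * ‖x‖) := by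
    refine (h.bound s (q - 1) _ (Mj.L1_mem hx)).trans ?_
    have e1 : (1 + |q - 1|) ^ r ≤ 2 ^ r * b ^ r := by
      rw [← Real.mul_rpow (by norm_num) (by positivity)]
      refine Real.rpow_le_rpow (by positivity) ?_ hr
      have := abs_sub q 1
      rw [abs_of_nonneg hq, abs_one] at this
      rw [hb]; linarith
    have e2 : ‖Mj.L 1 x‖ ≤ b * ‖x‖ := by
      refine (Mj.norm_L_one_le hx).trans ?_
      rw [abs_of_nonneg hq]
      gcongr
      rw [hb]; linarith
    gcongr
  have t3 : ‖((2 * Δ - s - 2 : ℝ) : ℂ) • α.Y w (s + 1) x‖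
      ≤ (2 * d * a) * (K * (2 ^ t * a ^ t) * b ^ r * ‖x‖) := by
    rw [norm_smul, Complex.norm_real, Real.norm_eq_abs]
    have e1 : (1 + |s + 1|) ^ t ≤ 2 ^ t * a ^ t := by
      rw [← Real.mul_rpow (by norm_num) (by positivity)]
      refine Real.rpow_le_rpow (by positivity) ?_ ht
      have := abs_add_le s 1
      rw [abs_one] at this
      rw [ha]; linarith [abs_nonneg s]
    have e2 : |2 * Δ - s - 2| ≤ 2 * d * a := by
      rw [show 2 * Δ - s - 2 = 2 * (Δ - 1) - s by ring]
      have := abs_sub (2 * (Δ - 1)) s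
      rw [abs_mul, abs_two] at this
      refine this.trans ?_
      rw [hd, ha]
      nlinarith [abs_nonneg (Δ - 1), abs_nonneg s, mul_nonneg (abs_nonneg (Δ - 1)) (abs_nonneg s)]
    have e3 := h.bound (s + 1) q x hx
    rw [abs_of_nonneg hq] at e3
    refine mul_le_mul e2 (e3.trans ?_) (norm_nonneg _) (by positivity)
    gcongr
  rw [α.L_one_mode hw]
  set X := a ^ t * b ^ r * ‖x‖ with hX
  have hX0 : 0 ≤ X := by positivity
  calc _ ≤ ‖Mk.L 1 (α.Y w s x)‖ + ‖α.Y w s (Mj.L 1 x)‖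
        + ‖((2 * Δ - s - 2 : ℝ) : ℂ) • α.Y w (s + 1) x‖ :=
        (norm_sub_le _ _).trans (by gcongr; exact norm_sub_le _ _)
    _ ≤ d * a * b * (K * a ^ t * b ^ r * ‖x‖) + K * a ^ t * (2 ^ r * b ^ r) * (b * ‖x‖)
        + (2 * d * a) * (K * (2 ^ t * a ^ t) * b ^ r * ‖x‖) := by gcongr
    _ = K * d * (a * b) * X + K * 2 ^ r * (1 * b) * X + 2 * d * K * 2 ^ t * (a * 1) * X := by
        rw [hX]; ring
    _ ≤ K * d * (a * b) * X + K * 2 ^ r * (a * b) * X + 2 * d * K * 2 ^ t * (a * b) * X := by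
        gcongr
    _ = _ := by rw [hX]; ring

theorem exists_L_one_pow_eq_zero (M : UnitaryModule 𝓥 Wi) {w : Wi} {Δ : ℝ}
    (hw : w ∈ M.grading Δ) : ∃ N : ℕ, ∀ n ≥ N, ((M.L 1) ^ n : Wi →ₗ[ℂ] Wi) w = 0 := by
  refine ⟨⌊Δ⌋₊ + 1, fun n hn => ?_⟩
  by_contra h0
  have := M.nonneg_of_mem (M.L1_pow_mem hw n) h0
  have h1 := Nat.lt_floor_add_one Δ
  have h2 : ((⌊Δ⌋₊ + 1 : ℕ) : ℝ) ≤ n := by exact_mod_cast hn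
  push_cast at h2
  linarith

/-- Positivity of the energy leaves only finitely many nonzero `L_1^n w`, so one set of constants
serves all `n`. -/
theorem exists_energyBounded_L_one_pow
    (α : IntertwiningOperator Mi.toVOAModule Mj.toVOAModule Mk.toVOAModule)
    (hC2 : 𝓥.IsC2Cofinite) {w : Wi} {Δ : ℝ} (hw : w ∈ Mi.grading Δ) {K t r : ℝ}
    (ht : 0 ≤ t) (hr : 0 ≤ r)
    (h : EnergyBounded Mj Mk (α.Y w) (VOA.exponents.{u, v} 𝓥.toVOA) Δ K t r) :
    ∃ K' t' r' : ℝ, 0 ≤ t' ∧ 0 ≤ r' ∧ ∀ n : ℕ,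
      EnergyBounded Mj Mk (α.Y (((Mi.L 1) ^ n : Wi →ₗ[ℂ] Wi) w))
        (VOA.exponents.{u, v} 𝓥.toVOA) (Δ - n) K' t' r' := by
  have step : ∀ n : ℕ, ∃ K', EnergyBounded Mj Mk (α.Y (((Mi.L 1) ^ n : Wi →ₗ[ℂ] Wi) w))
        (VOA.exponents.{u, v} 𝓥.toVOA) (Δ - n) K' (t + n) (r + n) := by
    intro n
    induction n with
    | zero => exact ⟨K, by simpa using h⟩
    | succ n ih =>
      obtain ⟨K', hK'⟩ := ih
      obtain ⟨K'', hK''⟩ := α.energyBounded_L_one hC2 (Mi.L1_pow_mem hw n) (by positivity)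
        (by positivity) hK'
      refine ⟨K'', ?_⟩
      rw [pow_succ', Module.End.mul_apply]
      push_cast
      rw [← add_assoc, ← add_assoc, ← sub_sub]
      exact hK''
  choose K' hK' using step
  obtain ⟨N, hN⟩ := exists_L_one_pow_eq_zero Mi hw
  have hK0 : ∀ n ∈ Finset.range N, 0 ≤ K' n := fun n _ => (hK' n).nonneg
  refine ⟨∑ n ∈ Finset.range N, K' n, t + N, r + N, by positivity, by positivity, fun n => ?_⟩
  rcases lt_or_ge n N with hn | hn
  · have hn' : (n : ℝ) ≤ N := by exact_mod_cast hn.le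
    exact (hK' n).mono (Finset.single_le_sum hK0 (Finset.mem_range.2 hn)) (by linarith)
      (by linarith)
  · rw [hN n hn, map_zero]
    exact EnergyBounded.zero hC2.isThin_exponents (Finset.sum_nonneg hK0)

theorem reflectedMode_apply
    (α : IntertwiningOperator Mi.toVOAModule Mj.toVOAModule Mk.toVOAModule)
    {w : Wi} {Δ : ℝ} (hw : w ∈ Mi.grading Δ) {N : ℕ}
    (hN : ∀ n ≥ N, ((Mi.L 1) ^ n : Wi →ₗ[ℂ] Wi) w = 0) (s : ℝ) (x : Wj) :
    α.reflectedMode w s x = ∑ n ∈ Finset.range N,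
      (Complex.exp (-(Complex.I * Real.pi * Δ)) / (n.factorial : ℂ)) •
        α.Y (((Mi.L 1) ^ n : Wi →ₗ[ℂ] Wi) w) (2 * Δ - s - n - 2) x := by
  rw [reflectedMode, finsum_eq_single _ Δ, finsum_eq_finsetSum_of_support_subset
    (s := Finset.range N), LinearMap.sum_apply]
  · simp only [Mi.P_of_mem hw, LinearMap.smul_apply]
  · intro n hn
    by_contra hc
    refine hn ?_
    simp only [Finset.coe_range, Set.mem_Iio, not_lt] at hc
    simp only [Mi.P_of_mem hw, hN n hc, map_zero, Pi.zero_apply, smul_zero]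
  · intro q hq
    simp only [Mi.P_of_ne hw hq, map_zero, Pi.zero_apply, smul_zero, finsum_zero]

theorem reflectedMode_mem
    (α : IntertwiningOperator Mi.toVOAModule Mj.toVOAModule Mk.toVOAModule)
    {w : Wi} {Δ : ℝ} (hw : w ∈ Mi.grading Δ) (s : ℝ) {q : ℝ} {x : Wj} (hx : x ∈ Mj.grading q) :
    α.reflectedMode w s x ∈ Mk.grading (q - (Δ - s - 1)) := by
  obtain ⟨N, hN⟩ := exists_L_one_pow_eq_zero Mi hw
  rw [α.reflectedMode_apply hw hN]
  refine Submodule.sum_mem _ fun n _ => Submodule.smul_mem _ _ ?_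
  have := α.mode_mem (Mi.L1_pow_mem hw n) (2 * Δ - s - n - 2) hx
  rwa [show q + (Δ - n - (2 * Δ - s - n - 2) - 1) = q - (Δ - s - 1) by ring] at this

end IntertwiningOperator

/-- The conjugations in the definition cancel, so an adjoint mode is the formal adjoint of a
reflected mode. Later arguments use the adjoint operator only through this identity. -/
theorem inner_adjointIntertwiner
    (α : IntertwiningOperator Mi.toVOAModule Mj.toVOAModule Mk.toVOAModule)
    (w : Wi) (s : ℝ) (x : Wj) (y : Wk) :
    inner ℂ (adjointIntertwiner α (Mi.C w) s y) x = inner ℂ y (α.reflectedMode w s x) := by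
  have h : Mj.C (adjointIntertwiner α (Mi.C w) s y) = α.contragredient w s (Mk.C y) := by
    have := Mj.C.apply_symm_apply (α.contragredient (Mi.C.symm (Mi.C w)) s (Mk.C y))
    rw [Mi.C.symm_apply_apply] at this
    have e : adjointIntertwiner α (Mi.C w) s y
        = Mj.C.symm (α.contragredient (Mi.C.symm (Mi.C w)) s (Mk.C y)) := rfl
    rw [e, Mi.C.symm_apply_apply]
    exact this
  exact congrArg (fun φ : Mj.gradedDual => (φ : Module.Dual ℂ Wj) x) h

theorem UnitaryModule.mem_grading_of_inner (M : UnitaryModule 𝓥 Wj) {s : ℝ} {x : Wj}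
    (h : ∀ q ≠ s, ∀ y ∈ M.grading q, inner ℂ x y = (0 : ℂ)) : x ∈ M.grading s := by
  have : x = M.P s x := by
    apply M.eq_of_P
    intro q
    by_cases hq : q = s
    · rw [hq, M.P_of_mem (M.P_mem s x)]
    · rw [M.P_of_ne (M.P_mem s x) hq, ← norm_eq_zero, ← Completion.norm_coe, ← M.proj_coe,
        norm_eq_zero, ← inner_self_eq_zero (𝕜 := ℂ), M.inner_proj, M.proj_of_mem (M.proj_mem q _),
        M.proj_coe, Completion.inner_coe]
      exact h q hq _ (M.P_mem q x)
  rw [this]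
  exact M.P_mem s x

/-- With `z` the value of the adjoint mode at `y`, one has `‖z‖² ≤ ‖y‖ ‖R z‖` for the reflected mode
`R`. Since `z` is homogeneous of weight `q + Δ - s - 1`, the bounds for the `L_1^n w` apply to `R
z`. -/
theorem exists_energyBounded_adjointIntertwiner
    (α : IntertwiningOperator Mi.toVOAModule Mj.toVOAModule Mk.toVOAModule)
    (hC2 : 𝓥.IsC2Cofinite) {w : Wi} {Δ : ℝ} (hw : w ∈ Mi.grading Δ) {K t r : ℝ}
    (ht : 0 ≤ t) (hr : 0 ≤ r)
    (h : ∀ n : ℕ, EnergyBounded Mj Mk (α.Y (((Mi.L 1) ^ n : Wi →ₗ[ℂ] Wi) w))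
      (VOA.exponents.{u, v} 𝓥.toVOA) (Δ - n) K t r) :
    ∃ K' t' r' : ℝ, EnergyBounded Mk Mj (adjointIntertwiner α (Mi.C w))
      (VOA.exponents.{u, v} 𝓥.toVOA) Δ K' t' r' := by
  obtain ⟨N, hN⟩ := IntertwiningOperator.exists_L_one_pow_eq_zero Mi hw
  have hK := (h 0).nonneg
  have hshift : ∀ s q : ℝ, ∀ y ∈ Mk.grading q,
      adjointIntertwiner α (Mi.C w) s y ∈ Mj.grading (q + (Δ - s - 1)) := by
    intro s q y hy
    refine Mj.mem_grading_of_inner fun q' hq' x hx => ?_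
    rw [inner_adjointIntertwiner]
    refine Mk.inner_eq_zero (fun e => hq' ?_) (α.reflectedMode_mem hw s hx) hy
    rw [← e]; ring
  -- These constants remain after splitting `(1+|s|)^t` from the mode index `2Δ - s - n - 2` and
  -- `(1+|s|)^r` from the weight of `z`; whence the exponent `t + r`.
  set K' : ℝ := ∑ n ∈ Finset.range N, K * (1 + |2 * Δ - n - 2|) ^ t * (1 + |Δ - 1|) ^ r with hK'
  refine ⟨K', t + r, r, hC2.isThin_exponents, hshift, fun s hs => ?_, by positivity,
    fun s q y hy => ?_⟩
  · by_cases h0 : w = 0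
    · ext y
      refine ext_inner_right ℂ fun x => ?_
      rw [inner_adjointIntertwiner, α.reflectedMode_apply hw hN, h0]
      simp
    · exact mode_eq_zero_of_notMem_exponents ((Submodule.ne_bot_iff _).2 ⟨w, hw, h0⟩) hshift hs
  · set z := adjointIntertwiner α (Mi.C w) s y with hz
    have hzm := hshift s q y hy
    rw [← hz] at hzm
    by_cases hz0 : z = 0
    · rw [hz0, norm_zero]; positivity
    have hR : ‖α.reflectedMode w s z‖ ≤ K' * (1 + |s|) ^ (t + r) * (1 + |q|) ^ r * ‖z‖ := by
      rw [α.reflectedMode_apply hw hN, hK', Finset.sum_mul, Finset.sum_mul, Finset.sum_mul]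
      refine norm_sum_le_of_le _ fun n _ => ?_
      have e0 : ‖Complex.exp (-(Complex.I * Real.pi * Δ)) / (n.factorial : ℂ)‖ ≤ 1 := by
        have : -(Complex.I * Real.pi * Δ) = ((-(Real.pi * Δ) : ℝ) : ℂ) * Complex.I := by
          push_cast; ring
        rw [norm_div, this, Complex.norm_exp_ofReal_mul_I, Complex.norm_natCast]
        exact div_le_one_of_le₀ (by exact_mod_cast n.factorial_pos) (by positivity)
      have e1 : (1 + |2 * Δ - s - n - 2|) ^ t
          ≤ (1 + |2 * Δ - n - 2|) ^ t * (1 + |s|) ^ t := by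
        have := one_add_abs_rpow_le (2 * Δ - n - 2) s t
        rw [abs_of_nonneg ht] at this
        rwa [show 2 * Δ - s - n - 2 = 2 * Δ - n - 2 - s by ring]
      have e2 : (1 + |q + (Δ - s - 1)|) ^ r
          ≤ (1 + |q|) ^ r * ((1 + |Δ - 1|) ^ r * (1 + |s|) ^ r) := by
        have h1 := one_add_abs_rpow_le q (s - (Δ - 1)) r
        have h2 := one_add_abs_rpow_le (Δ - 1) s r
        rw [abs_of_nonneg hr] at h1 h2
        rw [abs_sub_comm s] at h1
        rw [show q + (Δ - s - 1) = q - (s - (Δ - 1)) by ring]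
        exact h1.trans (by gcongr)
      have e3 := (h n).bound (2 * Δ - s - n - 2) _ z hzm
      rw [norm_smul]
      calc _ ≤ 1 * (K * ((1 + |2 * Δ - n - 2|) ^ t * (1 + |s|) ^ t) *
            ((1 + |q|) ^ r * ((1 + |Δ - 1|) ^ r * (1 + |s|) ^ r)) * ‖z‖) := by
            refine mul_le_mul e0 (e3.trans ?_) (norm_nonneg _) zero_le_one
            gcongr
        _ = _ := by rw [Real.rpow_add (by positivity)]; ring
    have hin := norm_inner_le_norm (𝕜 := ℂ) y (α.reflectedMode w s z)
    rw [← inner_adjointIntertwiner, ← hz, inner_self_eq_norm_sq_to_K] at hin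
    simp only [norm_pow, Complex.coe_algebraMap, Complex.norm_real, norm_norm] at hin
    have hzpos : 0 < ‖z‖ := norm_pos_iff.2 hz0
    refine le_of_mul_le_mul_right ?_ hzpos
    calc ‖z‖ * ‖z‖ = ‖z‖ ^ 2 := by ring
      _ ≤ ‖y‖ * ‖α.reflectedMode w s z‖ := hin
      _ ≤ ‖y‖ * (K' * (1 + |s|) ^ (t + r) * (1 + |q|) ^ r * ‖z‖) := by gcongr
      _ = _ := by ring

/-! ## The adjoint relation -/

/-- This is `e^{-X} e^{X} = 1` for nilpotent `X`. Collecting terms with `m + n = k` leaves the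
alternating sum of the binomials of `k`, which vanishes unless `k = 0`. -/
theorem sum_sum_neg_one_pow_div_factorial (N : ℕ) (φ : ℕ → ℂ) (hN : 0 < N)
    (hφ : ∀ k ≥ N, φ k = 0) :
    ∑ m ∈ Finset.range N, ∑ n ∈ Finset.range N,
      ((-1 : ℂ) ^ m / ((m.factorial : ℂ) * (n.factorial : ℂ))) * φ (m + n) = φ 0 := by
  have h1 : ∀ m ∈ Finset.range N, ∑ n ∈ Finset.range N,
      ((-1 : ℂ) ^ m / ((m.factorial : ℂ) * (n.factorial : ℂ))) * φ (m + n)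
      = ∑ k ∈ Finset.range N, if m ≤ k then
        ((-1 : ℂ) ^ m / ((m.factorial : ℂ) * ((k - m).factorial : ℂ))) * φ k else 0 := by
    intro m _
    have e : ∑ k ∈ Finset.range (m + N), (if m ≤ k then
        ((-1 : ℂ) ^ m / ((m.factorial : ℂ) * ((k - m).factorial : ℂ))) * φ k else 0)
        = ∑ n ∈ Finset.range N,
          ((-1 : ℂ) ^ m / ((m.factorial : ℂ) * (n.factorial : ℂ))) * φ (m + n) := by
      rw [Finset.sum_range_add, Finset.sum_eq_zero, zero_add]
      · simp
      · intro k hk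
        rw [if_neg (not_le.2 (Finset.mem_range.1 hk))]
    -- The range of `k` depends on `m`, but indices from `N` on contribute nothing and can be cut
    -- off.
    rw [← e, add_comm m N, Finset.sum_range_add, add_eq_left]
    refine Finset.sum_eq_zero fun k _ => ?_
    rw [hφ (N + k) (Nat.le_add_right _ _), mul_zero, ite_self]
  rw [Finset.sum_congr rfl h1, Finset.sum_comm]
  have h2 : ∀ k ∈ Finset.range N, ∑ m ∈ Finset.range N, (if m ≤ k then
        ((-1 : ℂ) ^ m / ((m.factorial : ℂ) * ((k - m).factorial : ℂ))) * φ k else 0)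
      = if k = 0 then φ 0 else 0 := by
    intro k hk
    have hk' := Finset.mem_range.1 hk
    have e : ∑ m ∈ Finset.range N, (if m ≤ k then
        ((-1 : ℂ) ^ m / ((m.factorial : ℂ) * ((k - m).factorial : ℂ))) * φ k else 0)
        = ∑ m ∈ Finset.range (k + 1), ((-1 : ℂ) ^ m * (k.choose m : ℂ)) * (φ k / k.factorial) := by
      rw [← Finset.sum_subset (Finset.range_subset_range.2 (Nat.succ_le_of_lt hk'))]
      · refine Finset.sum_congr rfl fun m hm => ?_
        have hmk : m ≤ k := Nat.lt_succ_iff.1 (Finset.mem_range.1 hm)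
        rw [if_pos hmk, Nat.cast_choose ℂ hmk]
        have := k.factorial_ne_zero
        have := m.factorial_ne_zero
        have := (k - m).factorial_ne_zero
        field_simp
      · intro m _ hm
        rw [if_neg]
        simpa using hm
    rw [e, ← Finset.sum_mul]
    have := Int.alternating_sum_range_choose (n := k)
    have hc : ∑ m ∈ Finset.range (k + 1), ((-1 : ℂ) ^ m * (k.choose m : ℂ))
        = if k = 0 then 1 else 0 := by
      exact_mod_cast congrArg (Int.cast : ℤ → ℂ) this
    rw [hc]
    split_ifs with h0
    · subst h0; simp
    · simp
  rw [Finset.sum_congr rfl h2, Finset.sum_ite_eq', if_pos (Finset.mem_range.2 hN)]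

theorem conj_smearedForm_adjointIntertwiner
    (α : IntertwiningOperator Mi.toVOAModule Mj.toVOAModule Mk.toVOAModule) {w : Wi} (ρ : ℝ)
    (f : TestFun) (x : Wj) (y : Wk)
    (hfin : {s : ℝ | inner ℂ x (adjointIntertwiner α (Mi.C w) s y) ≠ (0 : ℂ)}.Finite) :
    conj (smearedForm (adjointIntertwiner α (Mi.C w)) (TestFun.conjE ρ f) y x)
      = ∑ᶠ s : ℝ, f.mode s * inner ℂ y (α.reflectedMode w (-ρ - s) x) := by
  rw [smearedForm_eq_finsum _ _ _ _ hfin, ← finsum_comp_equiv (Equiv.subLeft (-ρ))]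
  refine ((starRingEnd ℂ).toAddMonoidHom.map_finsum_of_injective star_injective _).trans
    (finsum_congr fun s => ?_)
  change conj (TestFun.mode _ (-ρ - s) * _) = _
  rw [TestFun.mode_conjE, map_mul, Complex.conj_conj, inner_conj_symm, Equiv.subLeft_apply,
    inner_adjointIntertwiner]
  congr 2
  ring

/-- The phase of the adjoint relation and that of the reflection of `L_1^m w`, of weight `Δ - m`,
combine to the sign needed in `e^{-X}`. -/
theorem exp_mul_conj_exp (Δ : ℝ) (m : ℕ) :
    conj (Complex.exp (-(Complex.I * Real.pi * Δ)))
      * Complex.exp (-(Complex.I * Real.pi * ((Δ - m : ℝ) : ℂ))) = (-1) ^ m := by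
  rw [← Complex.exp_conj, ← Complex.exp_add, ← Complex.exp_pi_mul_I, ← Complex.exp_nat_mul]
  congr 1
  simp only [map_neg, map_mul, Complex.conj_I, Complex.conj_ofReal]
  push_cast
  ring

/-- After expansion in modes, the coefficient of `f^(s)` is a double sum over `m` and `n` of modes
of `L_1^(m+n) w`. The twist by `e_{m+2-2Δ}` makes the mode index `s - (m + n)`, so everything
depends on `m + n` alone and the exponential identity leaves the term `0`. -/
theorem smearedForm_eq_sum
    (α : IntertwiningOperator Mi.toVOAModule Mj.toVOAModule Mk.toVOAModule) {w : Wi} {Δ : ℝ}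
    (hw : w ∈ Mi.grading Δ) {N : ℕ} (hN0 : 0 < N)
    (hN : ∀ n ≥ N, ((Mi.L 1) ^ n : Wi →ₗ[ℂ] Wi) w = 0) (f : TestFun) (x : Wj) (y : Wk)
    (hfinA : {s : ℝ | inner ℂ y (α.Y w s x) ≠ (0 : ℂ)}.Finite)
    (hfin : ∀ m : ℕ, {s : ℝ | inner ℂ x (adjointIntertwiner α
      (Mi.C (((Mi.L 1) ^ m : Wi →ₗ[ℂ] Wi) w)) s y) ≠ (0 : ℂ)}.Finite) :
    smearedForm (α.Y w) f x y = ∑ m ∈ Finset.range N,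
      conj (Complex.exp (-(Complex.I * Real.pi * Δ)) / (m.factorial : ℂ)) *
        conj (smearedForm (adjointIntertwiner α (Mi.C (((Mi.L 1) ^ m : Wi →ₗ[ℂ] Wi) w)))
          (TestFun.conjE (m + 2 - 2 * Δ) f) y x) := by
  have hterm : ∀ m : ℕ, conj (Complex.exp (-(Complex.I * Real.pi * Δ)) / (m.factorial : ℂ)) *
        conj (smearedForm (adjointIntertwiner α (Mi.C (((Mi.L 1) ^ m : Wi →ₗ[ℂ] Wi) w)))
          (TestFun.conjE (m + 2 - 2 * Δ) f) y x)
      = ∑ᶠ s : ℝ, conj (Complex.exp (-(Complex.I * Real.pi * Δ)) / (m.factorial : ℂ)) *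
        (f.mode s * inner ℂ y (α.reflectedMode (((Mi.L 1) ^ m : Wi →ₗ[ℂ] Wi) w)
          (-(m + 2 - 2 * Δ) - s) x)) := by
    intro m
    rw [conj_smearedForm_adjointIntertwiner α _ f x y (hfin m), ← smul_eq_mul, smul_finsum]
    simp only [smul_eq_mul]
  rw [Finset.sum_congr rfl fun m _ => hterm m, ← finsum_sum_comm, smearedForm_eq_finsum _ _ _ _
    hfinA]
  · refine finsum_congr fun s => ?_
    have hφ := sum_sum_neg_one_pow_div_factorial N
      (fun k => inner ℂ y (α.Y (((Mi.L 1) ^ k : Wi →ₗ[ℂ] Wi) w) (s - k) x)) hN0 (fun k hk => by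
        rw [hN k hk, map_zero, Pi.zero_apply, LinearMap.zero_apply, inner_zero_right])
    simp only [pow_zero, Module.End.one_apply, Nat.cast_zero, sub_zero] at hφ
    rw [← hφ, Finset.mul_sum]
    refine Finset.sum_congr rfl fun m _ => ?_
    rw [α.reflectedMode_apply (Mi.L1_pow_mem hw m) (N := N) (fun n hn => by
      rw [← Module.End.mul_apply, ← pow_add, hN _ (by omega)]), inner_sum, Finset.mul_sum,
      Finset.mul_sum, Finset.mul_sum]
    refine Finset.sum_congr rfl fun n _ => ?_
    rw [inner_smul_right, ← Module.End.mul_apply, ← pow_add, add_comm n m,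
      show 2 * (Δ - m) - (-(m + 2 - 2 * Δ) - s) - n - 2 = s - ((m + n : ℕ) : ℝ) by
        push_cast; ring, ← exp_mul_conj_exp Δ m, map_div₀, Complex.conj_natCast]
    ring
  · intro m _
    refine ((hfin m).preimage (f := fun s => -(m + 2 - 2 * Δ) - s)
      (sub_right_injective.injOn)).subset fun s hs h0 => hs ?_
    have h0' : inner ℂ x (adjointIntertwiner α (Mi.C (((Mi.L 1) ^ m : Wi →ₗ[ℂ] Wi) w))
      (-(m + 2 - 2 * Δ) - s) y) = (0 : ℂ) := h0
    rw [← inner_conj_symm, inner_adjointIntertwiner] at h0'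
    have h1 := star_injective (h0'.trans (star_zero ℂ).symm)
    simp only [h1, mul_zero]

/-! ### Passage of the adjoint relation to smooth vectors -/

theorem EnergyBounded.tendsto_smear_truncate {A : ℝ → Wj →ₗ[ℂ] Wk} {S : Set ℝ} {D K t r : ℝ}
    (h : EnergyBounded Mj Mk A S D K t r) (f : TestFun) (ξ : (smeared Mj A f).domain) :
    Filter.Tendsto (fun G => h.smear f (Mj.truncate G ξ)) Filter.atTop
      (nhds (smeared Mj A f ξ)) := by
  simp only [UnitaryModule.truncate, map_sum]
  exact h.smeared_hasSum f ξ

theorem UnitaryModule.tendsto_truncate (M : UnitaryModule 𝓥 Wj) (ξ : Completion Wj) :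
    Filter.Tendsto (fun G => (M.truncate G ξ : Completion Wj)) Filter.atTop (nhds ξ) := by
  simp_rw [UnitaryModule.coe_truncate]
  exact M.tendsto_cutoff_zero ξ

theorem UnitaryModule.dense_smooth (M : UnitaryModule 𝓥 Wj) :
    Dense (M.smooth : Set (Completion Wj)) :=
  (Completion.denseRange_coe (α := Wj)).mono (by rintro _ ⟨x, rfl⟩; exact M.coe_mem_smooth x)

section Adjoint

variable (α : IntertwiningOperator Mi.toVOAModule Mj.toVOAModule Mk.toVOAModule) {w : Wi} {Δ : ℝ}
  {K t r : ℝ}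

theorem smeared_adjointIntertwiner_domain (B : ∀ m : ℕ, ∃ K' t' r' : ℝ,
      EnergyBounded Mk Mj (adjointIntertwiner α (Mi.C (((Mi.L 1) ^ m : Wi →ₗ[ℂ] Wi) w)))
        (VOA.exponents.{u, v} 𝓥.toVOA) (Δ - m) K' t' r') (f : TestFun) (m : ℕ) :
    (smeared Mk (adjointIntertwiner α (Mi.C (((Mi.L 1) ^ m : Wi →ₗ[ℂ] Wi) w)))
      (TestFun.conjE (m + 2 - 2 * Δ) f)).domain = Mk.smooth := by
  obtain ⟨K', t', r', h⟩ := B m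
  exact h.smeared_domain _

/-- Both sides are limits of their values on truncations of `ξ` and `η`, where `smearedForm_eq_sum`
applies. -/
theorem inner_sum_smeared_adjointIntertwiner (hw : w ∈ Mi.grading Δ)
    (A : EnergyBounded Mj Mk (α.Y w) (VOA.exponents.{u, v} 𝓥.toVOA) Δ K t r)
    (B : ∀ m : ℕ, ∃ K' t' r' : ℝ,
      EnergyBounded Mk Mj (adjointIntertwiner α (Mi.C (((Mi.L 1) ^ m : Wi →ₗ[ℂ] Wi) w)))
        (VOA.exponents.{u, v} 𝓥.toVOA) (Δ - m) K' t' r')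
    {N : ℕ} (hN0 : 0 < N) (hN : ∀ n ≥ N, ((Mi.L 1) ^ n : Wi →ₗ[ℂ] Wi) w = 0)
    (f : TestFun) (ξ : (smeared Mj (α.Y w) f).domain) (η : Completion Wk)
    (hη : ∀ m : ℕ, η ∈ (smeared Mk (adjointIntertwiner α
      (Mi.C (((Mi.L 1) ^ m : Wi →ₗ[ℂ] Wi) w))) (TestFun.conjE (m + 2 - 2 * Δ) f)).domain) :
    inner ℂ (∑ m ∈ Finset.range N,
        (Complex.exp (-(Complex.I * Real.pi * Δ)) / (m.factorial : ℂ)) •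
          smeared Mk (adjointIntertwiner α (Mi.C (((Mi.L 1) ^ m : Wi →ₗ[ℂ] Wi) w)))
            (TestFun.conjE (m + 2 - 2 * Δ) f) ⟨η, hη m⟩) (ξ : Completion Wj)
      = inner ℂ η (smeared Mj (α.Y w) f ξ) := by
  choose K' t' r' B using B
  have hcore : ∀ (x : Wj) (y : Wk), inner ℂ (∑ m ∈ Finset.range N,
        (Complex.exp (-(Complex.I * Real.pi * Δ)) / (m.factorial : ℂ)) •
          (B m).smear (TestFun.conjE (m + 2 - 2 * Δ) f) y) (x : Completion Wj)
      = inner ℂ (y : Completion Wk) (A.smear f x) := by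
    intro x y
    rw [A.inner_smear, smearedForm_eq_sum α hw hN0 hN f x y (A.finite_inner x y)
      (fun m => (B m).finite_inner y x), sum_inner]
    refine Finset.sum_congr rfl fun m _ => ?_
    rw [inner_smul_left, ← (B m).inner_smear, inner_conj_symm]
  have hl : Filter.Tendsto (fun G => ∑ m ∈ Finset.range N,
        (Complex.exp (-(Complex.I * Real.pi * Δ)) / (m.factorial : ℂ)) •
          (B m).smear (TestFun.conjE (m + 2 - 2 * Δ) f) (Mk.truncate G η)) Filter.atTop
      (nhds (∑ m ∈ Finset.range N,
        (Complex.exp (-(Complex.I * Real.pi * Δ)) / (m.factorial : ℂ)) •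
          smeared Mk (adjointIntertwiner α (Mi.C (((Mi.L 1) ^ m : Wi →ₗ[ℂ] Wi) w)))
            (TestFun.conjE (m + 2 - 2 * Δ) f) ⟨η, hη m⟩)) :=
    tendsto_finsetSum _ fun m _ => ((B m).tendsto_smear_truncate _ ⟨η, hη m⟩).const_smul _
  have h1 := Filter.Tendsto.inner (𝕜 := ℂ) hl (Mj.tendsto_truncate (ξ : Completion Wj))
  have h2 := Filter.Tendsto.inner (𝕜 := ℂ) (Mk.tendsto_truncate η) (A.tendsto_smear_truncate f ξ)
  refine tendsto_nhds_unique h1 (h2.congr fun G => ?_)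
  exact (hcore _ _).symm

/-- The sum represents `ξ ↦ ⟨A(f) ξ|η⟩`, so `η` lies in the domain of the adjoint. Density of the
smooth vectors makes the representing vector unique. -/
theorem formalAdjoint_smeared (hw : w ∈ Mi.grading Δ)
    (A : EnergyBounded Mj Mk (α.Y w) (VOA.exponents.{u, v} 𝓥.toVOA) Δ K t r)
    (B : ∀ m : ℕ, ∃ K' t' r' : ℝ,
      EnergyBounded Mk Mj (adjointIntertwiner α (Mi.C (((Mi.L 1) ^ m : Wi →ₗ[ℂ] Wi) w)))
        (VOA.exponents.{u, v} 𝓥.toVOA) (Δ - m) K' t' r')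
    {N : ℕ} (hN0 : 0 < N) (hN : ∀ n ≥ N, ((Mi.L 1) ^ n : Wi →ₗ[ℂ] Wi) w = 0) (f : TestFun)
    {η : Completion Wk} (hη : η ∈ Mk.smooth)
    (hη' : ∀ m : ℕ, η ∈ (smeared Mk (adjointIntertwiner α
      (Mi.C (((Mi.L 1) ^ m : Wi →ₗ[ℂ] Wi) w))) (TestFun.conjE (m + 2 - 2 * Δ) f)).domain) :
    ∃ hd : η ∈ (formalAdjoint Mk (smeared Mj (α.Y w) f)).domain,
      formalAdjoint Mk (smeared Mj (α.Y w) f) ⟨η, hd⟩ = ∑ m ∈ Finset.range N,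
        (Complex.exp (-(Complex.I * Real.pi * Δ)) / (m.factorial : ℂ)) •
          smeared Mk (adjointIntertwiner α (Mi.C (((Mi.L 1) ^ m : Wi →ₗ[ℂ] Wi) w)))
            (TestFun.conjE (m + 2 - 2 * Δ) f) ⟨η, hη' m⟩ := by
  have hinner := fun ξ => inner_sum_smeared_adjointIntertwiner α hw A B hN0 hN f ξ η hη'
  have hmem := LinearPMap.mem_adjoint_domain_of_exists (T := smeared Mj (α.Y w) f) η ⟨_, hinner⟩
  have hdense : Dense ((smeared Mj (α.Y w) f).domain : Set (Completion Wj)) := by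
    rw [A.smeared_domain f]
    exact Mj.dense_smooth
  refine ⟨⟨hη, hmem⟩, ?_⟩
  rw [← LinearPMap.adjoint_apply_eq hdense ⟨η, hmem⟩ hinner]
  exact LinearPMap.domRestrict_apply rfl

end Adjoint

theorem smeared_adjointIntertwiner_zero
    (α : IntertwiningOperator Mi.toVOAModule Mj.toVOAModule Mk.toVOAModule)
    {S : Set ℝ} {D K t r : ℝ} (h : EnergyBounded Mk Mj (adjointIntertwiner α (Mi.C 0)) S D K t r)
    (f : TestFun) (η : (smeared Mk (adjointIntertwiner α (Mi.C 0)) f).domain) :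
    smeared Mk (adjointIntertwiner α (Mi.C 0)) f η = 0 := by
  have hB : ∀ s y, adjointIntertwiner α (Mi.C 0) s y = 0 := by
    intro s y
    refine ext_inner_right ℂ fun x => ?_
    rw [inner_adjointIntertwiner, α.reflectedMode_apply (Submodule.zero_mem (Mi.grading 0))
      (N := 0) (fun n _ => map_zero _)]
    simp
  have hs : ∀ y, h.smear f y = 0 := by
    intro y
    refine (h.hasSum_smear f y).unique ?_
    simp only [hB, Completion.coe_zero, smul_zero]
    exact hasSum_zero
  refine (h.smeared_hasSum f η).unique ?_
  simp only [hs]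
  exact hasSum_zero

end

/-! ### Smeared intertwining operators: Sobolev bounds and the adjoint relation -/

theorem proposition3p9
    {V : Type u} [NormedAddCommGroup V] [InnerProductSpace ℂ V] (𝓥 : UnitaryVOA V)
    (hCFT : 𝓥.IsCFTType) (hC2 : 𝓥.IsC2Cofinite)
    {Wi Wj Wk : Type v}
    [NormedAddCommGroup Wi] [InnerProductSpace ℂ Wi]
    [NormedAddCommGroup Wj] [InnerProductSpace ℂ Wj]
    [NormedAddCommGroup Wk] [InnerProductSpace ℂ Wk]
    (Mi : UnitaryModule 𝓥 Wi) (Mj : UnitaryModule 𝓥 Wj) (Mk : UnitaryModule 𝓥 Wk)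
    (α : IntertwiningOperator Mi.toVOAModule Mj.toVOAModule Mk.toVOAModule)
    (w : Wi) (Δ : ℝ) (hw : w ∈ Mi.grading Δ)
    (M r t : ℝ) (hM : 0 ≤ M) (hr : 0 ≤ r) (ht : 0 ≤ t)
    (hbound : ∀ (s : ℝ) (x : Wj),
      ‖α.Y w s x‖ ≤ M * (1 + |s|) ^ t * Mj.sobolevNorm r (x : UniformSpace.Completion Wj)) :
    -- the norms `|f|_{V,q}` are finite
    (∀ (q : ℝ) (f : TestFun), Summable (TestFun.normTerm.{u, v} 𝓥.toVOA q f)) ∧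
    -- `𝒴_α(w,f)` is defined on `W_j`, preclosed, and maps `ℋ_j^∞` to `ℋ_k^∞`
    (∀ f : TestFun,
      ((smearedCore (α.Y w) f).domain : Set (UniformSpace.Completion Wj))
          = Set.range ((↑) : Wj → UniformSpace.Completion Wj) ∧
      (smearedCore (α.Y w) f).IsClosable ∧
      (smeared Mj (α.Y w) f).domain = Mj.smooth ∧
      ∀ ξ : (smeared Mj (α.Y w) f).domain, smeared Mj (α.Y w) f ξ ∈ Mk.smooth) ∧
    -- Sobolev bounds, with a constant independent of `f`
    (∀ p : ℝ, ∃ Mp : ℝ, 0 ≤ Mp ∧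
      ∀ (f : TestFun) (ξ : (smeared Mj (α.Y w) f).domain),
        Mk.sobolevNorm p (smeared Mj (α.Y w) f ξ)
          ≤ Mp * TestFun.norm.{u, v} 𝓥.toVOA (|p| + t) f * Mj.sobolevNorm (p + r) ξ) ∧
    -- the formal adjoint is defined on `ℋ_k^∞` and maps it to `ℋ_j^∞`
    (∀ f : TestFun,
      (formalAdjoint Mk (smeared Mj (α.Y w) f)).domain = Mk.smooth ∧
      ∀ η : (formalAdjoint Mk (smeared Mj (α.Y w) f)).domain,
        formalAdjoint Mk (smeared Mj (α.Y w) f) η ∈ Mj.smooth) ∧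
    -- the general adjoint relation
    (∀ f : TestFun, ∀ T : ℕ → UniformSpace.Completion Wk →ₗ.[ℂ] UniformSpace.Completion Wj,
      (∀ m : ℕ, T m = smeared Mk (adjointIntertwiner α (Mi.C (((Mi.L 1) ^ m : Wi →ₗ[ℂ] Wi) w)))
        (TestFun.conjE (m + 2 - 2 * Δ) f)) →
      (∀ m : ℕ, (T m).domain = Mk.smooth) ∧
      ∀ (η : UniformSpace.Completion Wk)
        (h : η ∈ (formalAdjoint Mk (smeared Mj (α.Y w) f)).domain)
        (h' : ∀ m : ℕ, η ∈ (T m).domain),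
        HasSum (fun m : ℕ =>
          (Complex.exp (-(Complex.I * Real.pi * Δ)) / (m.factorial : ℂ)) • T m ⟨η, h' m⟩)
          (formalAdjoint Mk (smeared Mj (α.Y w) f) ⟨η, h⟩)) ∧
    -- the adjoint relation for quasi-primary `w`
    (Mi.L 1 w = 0 → ∀ f : TestFun,
      formalAdjoint Mk (smeared Mj (α.Y w) f)
        = Complex.exp (-(Complex.I * Real.pi * Δ)) •
          smeared Mk (adjointIntertwiner α (Mi.C w)) (TestFun.conjE (2 - 2 * Δ) f)) := by
  -- On weight `q` the Sobolev norm of order `r` is at most `(1 + q)^r ‖x‖`.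
  have hA : EnergyBounded Mj Mk (α.Y w) (VOA.exponents.{u, v} 𝓥.toVOA) Δ M t r := by
    refine α.energyBounded_of_le hC2 hw hM fun s q x hx hx0 => ?_
    have hq := Mj.nonneg_of_mem hx hx0
    have h1 := Mj.sobolevNorm_coe_le r hx
    rw [abs_of_nonneg (by positivity)] at h1
    rw [abs_of_nonneg hq, mul_assoc _ ((1 + q) ^ r)]
    exact (hbound s x).trans (by gcongr)
  obtain ⟨K', t', r', ht', hr', hpow⟩ := α.exists_energyBounded_L_one_pow hC2 hw ht hr hA
  have hB : ∀ m : ℕ, ∃ K' t' r' : ℝ,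
      EnergyBounded Mk Mj (adjointIntertwiner α (Mi.C (((Mi.L 1) ^ m : Wi →ₗ[ℂ] Wi) w)))
        (VOA.exponents.{u, v} 𝓥.toVOA) (Δ - m) K' t' r' := by
    intro m
    refine exists_energyBounded_adjointIntertwiner (K := K') α hC2 (Mi.L1_pow_mem hw m) ht' hr'
      fun n => ?_
    have := hpow (n + m)
    rw [pow_add, Module.End.mul_apply] at this
    convert! this using 1
    push_cast
    ring
  have hdom := smeared_adjointIntertwiner_domain α hB
  have hdom' : ∀ (f : TestFun) {η : UniformSpace.Completion Wk}, η ∈ Mk.smooth → ∀ m : ℕ,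
      η ∈ (smeared Mk (adjointIntertwiner α (Mi.C (((Mi.L 1) ^ m : Wi →ₗ[ℂ] Wi) w)))
        (TestFun.conjE (m + 2 - 2 * Δ) f)).domain := by
    intro f η hη m
    rw [hdom f m]
    exact hη
  obtain ⟨N, hN⟩ := IntertwiningOperator.exists_L_one_pow_eq_zero Mi hw
  -- `N` may be `0` when `w = 0`, while the exponential identity needs the term `0` in its range.
  have hN' : ∀ n ≥ N + 1, ((Mi.L 1) ^ n : Wi →ₗ[ℂ] Wi) w = 0 := fun n hn => hN n (by omega)
  have hadj : ∀ f : TestFun, (formalAdjoint Mk (smeared Mj (α.Y w) f)).domain = Mk.smooth :=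
    fun f => le_antisymm (fun _ hη => hη.1) fun η hη =>
      (formalAdjoint_smeared α hw hA hB N.succ_pos hN' f hη (hdom' f hη)).1
  refine ⟨fun q f => hA.summable_weight f q, fun f => ⟨hA.smearedCore_domain f, hA.isClosable f,
    hA.smeared_domain f, hA.smeared_mem_smooth f⟩, fun p => ⟨M * (1 + |Δ - 1|) ^ |p|,
    by positivity, fun f ξ => hA.sobolevNorm_smeared_le f p ξ⟩, fun f => ⟨hadj f, fun η => ?_⟩,
    fun f T hT => ?_, fun hL f => ?_⟩
  · obtain ⟨_, e⟩ := formalAdjoint_smeared α hw hA hB N.succ_pos hN' f η.2.1 (hdom' f η.2.1)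
    rw [e]
    refine Submodule.sum_mem _ fun m _ => Submodule.smul_mem _ _ ?_
    obtain ⟨_, _, _, h⟩ := hB m
    exact h.smeared_mem_smooth _ _
  · obtain rfl : T = fun m : ℕ => smeared Mk (adjointIntertwiner α
        (Mi.C (((Mi.L 1) ^ m : Wi →ₗ[ℂ] Wi) w))) (TestFun.conjE (m + 2 - 2 * Δ) f) := funext hT
    refine ⟨hdom f, fun η h h' => ?_⟩
    obtain ⟨_, e⟩ := formalAdjoint_smeared α hw hA hB N.succ_pos hN' f h.1 h'
    rw [e]
    refine hasSum_sum_of_ne_finset_zero fun m hm => ?_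
    have hz : ((Mi.L 1) ^ m : Wi →ₗ[ℂ] Wi) w = 0 := hN' m (by simpa using hm)
    obtain ⟨_, _, _, hBm⟩ := hB m
    -- The vector is generalized to `u` because the domain of the operator depends on it, which
    -- blocks rewriting `L_1^m w` to `0` in place.
    have key : ∀ (u : Wi) (_ : u = 0) (S : Set ℝ) (D K t r : ℝ)
        (_ : EnergyBounded Mk Mj (adjointIntertwiner α (Mi.C u)) S D K t r) (g : TestFun)
        (ζ : (smeared Mk (adjointIntertwiner α (Mi.C u)) g).domain),
        smeared Mk (adjointIntertwiner α (Mi.C u)) g ζ = 0 := by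
      rintro u rfl S D K t r h g ζ
      exact smeared_adjointIntertwiner_zero α h g ζ
    exact (congrArg _ (key _ hz _ _ _ _ _ hBm _ _)).trans (smul_zero _)
  -- For quasi-primary `w` the finite sum can be taken with the single term `m = 0`.
  · have h1 : ∀ n ≥ 1, ((Mi.L 1) ^ n : Wi →ₗ[ℂ] Wi) w = 0 := by
      intro n hn
      obtain ⟨k, rfl⟩ := Nat.exists_eq_add_of_le' hn
      rw [pow_succ, Module.End.mul_apply, hL, map_zero]
    have e0 : smeared Mk (adjointIntertwiner α (Mi.C (((Mi.L 1) ^ 0 : Wi →ₗ[ℂ] Wi) w)))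
        (TestFun.conjE ((0 : ℕ) + 2 - 2 * Δ) f)
        = smeared Mk (adjointIntertwiner α (Mi.C w)) (TestFun.conjE (2 - 2 * Δ) f) := by
      rw [pow_zero, Module.End.one_apply, Nat.cast_zero, zero_add]
    rw [← e0]
    refine LinearPMap.ext ((hadj f).trans (hdom f 0).symm) fun η hη hη' => ?_
    obtain ⟨_, e⟩ := formalAdjoint_smeared α hw hA hB one_pos h1 f hη.1 (hdom' f hη.1)
    rw [e, Finset.sum_range_one, Nat.factorial_zero, Nat.cast_one, div_one]
    rfl
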